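/- Red-green calculus. A diagram is a finite undirected open graph (parallel edges, loops and bare wires allowed) whose vertices are green ($Z$) or red ($X$) spiders of any degree, each with a phase $\alpha\in\mathbb R/2\pi\mathbb Z$ (phase $0$ if not mentioned), and degree-two vertices $H$. Write $p_Z(\alpha),p_X(\alpha)$ for the green/red spider of phase $\alpha$ with two legs. Equations between diagrams with the same open ends may be applied inside any larger diagram. The axioms are the following, and the same with the colours exchanged. (Spider law) A connected diagram with spiders of one colour only equals the single spider of that colour with the same open ends and the sum of the phases; a spider of phase $0$ with two legs is a plain wire. (Copying) A red vertex of degree one joined to a green vertex of degree three equals two red vertices of degree one. (Bialgebra) The alternating $4$-cycle of two red and two green vertices of degree three, with open ends $a,b$ at the red and $c,d$ at the green vertices, equals a green vertex with open ends $a,b$ joined by one wire to a red vertex with open ends $c,d$. ($\pi$-commutation) A red vertex of degree three with $p_Z(\pi)$ on two of its legs equals the same vertex with $p_Z(\pi)$ on the third leg instead; $p_Z(\pi)$ followed by a red vertex of degree one equals that vertex. (Equations for $H$) $H\circ H=\mathrm{id}$; $H$ on one leg of a red vertex of degree three equals a green vertex of degree three with $H$ on the two other legs; $H$ on a red vertex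 of degree one equals a green vertex of degree one; $p_X(\alpha)\circ H=H\circ p_Z(\alpha)$ for all $\alpha$. (Scalars are suppressed) The following diagrams without open ends equal the empty diagram: a vertex without legs of phase $\alpha\ne\pi$; a vertex of degree one and phase $\alpha$ joined to a vertex of degree one of the other colour and of phase $0$ or $\pi$. Graph states. For a finite simple graph $G$, the diagram $|G\rangle$ has one green vertex of phase $0$ for each vertex of $G$, with one output wire at each of them, and two green vertices are connected through an $H$ if and only if the corresponding vertices of $G$ are adjacent. For $u\in V(G)$ let $N_G(u)$ be the set of neighbours of $u$, and let $G*u$ be the graph on $V(G)$ in which two distinct vertices $v,w$ are adjacent if and only if exactly one of "$vw\in E(G)$" and "$v,w\in N_G(u)$" holds. For an angle $\theta$, the local complementation property $\mathrm{LC}(\theta)$ (Van den Nest's theorem) is the family of equations, over all finite simple graphs $G$ and all $u\in V(G)$, \[ R_x(\theta)^{(u)}\,R_z(-\theta)^{(N_G(u))}\,|G\rangle=|G*u\rangle, \] where $p_X(\theta)$ is attached to the output wire of $u$ and $p_Z(-\theta)$ to the output wire of every neighbour of $u$. Theorem. Let $E$ be any set of equations between diagrams, and consider the red-green calculus with the equations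 in $E$ as additional axioms. For $\theta=-\pi/2$, and likewise for $\theta=\pi/2$, all equations of $\mathrm{LC}(\theta)$ are derivable if and only if the Euler decomposition \[ H=p_Z(-\pi/2)\circ p_X(-\pi/2)\circ p_Z(-\pi/2) \] is derivable. In particular, adding $\mathrm{LC}(\theta)$ to the axioms makes the Euler decomposition derivable, and adding the Euler decomposition makes $\mathrm{LC}(\theta)$ derivable. -/

import Mathlib

/-!
# The red-green calculus

A diagram is a finite undirected open graph. It is given here by its list of vertices, each with
the unordered list of the wires at its legs. A wire that occurs twice joins two legs; a wire that
occurs once is an open end (an input or an output) of the diagram.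
-/

namespace RedGreen

/-- The two families of vertices: green (`Z`) and red (`X`). -/
inductive Colour
  | green
  | red

/-- The other colour. -/
def Colour.swap : Colour → Colour
  | .green => .red
  | .red => .green

/-- Kinds of vertices. A spider has a colour, a phase `α` (mod `2π`) and any number of legs:
`δ` and `δ†` are the spiders of phase `0` with three legs, `ε` and `ε†` the spiders of phase `0`
with one leg, and `p(α)` is the spider of phase `α` with two legs. `line` is not a vertex proper
but a plain piece of wire, needed to draw a bare wire between two open ends (the identity, the cup
and the cap) and to connect two open ends of a diagram. -/
inductive Kind
  | spider (c : Colour) (α : Real.Angle)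
  | had
  | line

/-- A vertex, with the wires attached to its legs. Legs are unordered, as graphs are undirected. -/
structure Vertex (W : Type) where
  kind : Kind
  legs : Multiset W

/-- The vertex of the given colour and phase on the given wires. -/
def spider {W : Type} (c : Colour) (α : Real.Angle) (S : Multiset W) : Vertex W :=
  ⟨.spider c α, S⟩

/-- The vertex `H` between the wires `x` and `y`. -/
def had {W : Type} (x y : W) : Vertex W := ⟨.had, {x, y}⟩

/-- A plain piece of wire that joins `x` and `y`. -/
def line {W : Type} (x y : W) : Vertex W := ⟨.line, {x, y}⟩

/-- Collections of vertices; juxtaposition is `+`, and shared wires are connected. -/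
abbrev Net (W : Type) := Multiset (Vertex W)

/-- Renaming of wires. -/
def Net.rename {W W' : Type} (f : W → W') (D : Net W) : Net W' :=
  D.map fun v => ⟨v.kind, v.legs.map f⟩

/-- The number of legs attached to the wire `x`. -/
def Net.deg (D : Net ℕ) (x : ℕ) : ℕ := (D.map fun v => v.legs.count x).sum

/-- A net is a diagram if every wire has at most two ends at legs, and every `H` and every piece
of wire has exactly two ends. -/
def Net.IsDiagram (D : Net ℕ) : Prop :=
  (∀ x, D.deg x ≤ 2) ∧ ∀ v ∈ D, v.kind = .had ∨ v.kind = .line → v.legs.card = 2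

/-- An equation between two diagrams with the same open ends. -/
structure Equation where
  lhs : Net ℕ
  rhs : Net ℕ
  lhs_isDiagram : lhs.IsDiagram
  rhs_isDiagram : rhs.IsDiagram
  same_open : ∀ x, lhs.deg x = 1 ↔ rhs.deg x = 1

/-- The real number `θ` as a phase, that is, modulo `2π`. -/
noncomputable def ang (θ : ℝ) : Real.Angle := (θ : Real.Angle)

/-- The axioms of the red-green calculus, each for both colours. -/
inductive Ax : Net ℕ → Net ℕ → Prop
  /- A piece of wire can be absorbed by whatever it is attached to. -/
  | absorb (k : Kind) (x y : ℕ) (S : Multiset ℕ) :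
      Ax {⟨k, x ::ₘ S⟩, line x y} {⟨k, y ::ₘ S⟩}
  /- Spider law: a connected diagram of one colour is the single spider of that colour with the
  same open ends and the sum of the phases (merge along an edge; remove an edge that
  has become a loop), and the spider of phase `0` with two legs is a plain wire. -/
  | fuse (c : Colour) (α β : Real.Angle) (w : ℕ) (S T : Multiset ℕ) :
      Ax {spider c α (w ::ₘ S), spider c β (w ::ₘ T)} {spider c (α + β) (S + T)}
  | loop (c : Colour) (α : Real.Angle) (w : ℕ) (S : Multiset ℕ) :
      Ax {spider c α (w ::ₘ w ::ₘ S)} {spider c α S}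
  | unit (c : Colour) (x y : ℕ) :
      Ax {spider c 0 {x, y}} {line x y}
  /- Copying. -/
  | copy (c : Colour) (w a b : ℕ) :
      Ax {spider c 0 {w}, spider c.swap 0 {w, a, b}} {spider c 0 {a}, spider c 0 {b}}
  /- Bialgebra. -/
  | bialgebra (c : Colour) (a b a' b' p q r s w : ℕ) :
      Ax {spider c 0 {a, p, q}, spider c 0 {b, r, s},
          spider c.swap 0 {a', p, r}, spider c.swap 0 {b', q, s}}
        {spider c.swap 0 {a, b, w}, spider c 0 {w, a', b'}}
  /- `π`-commutation. -/
  | pi_delta (c : Colour) (a b b' p q w : ℕ) :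
      Ax {spider c 0 {a, p, q}, spider c.swap (ang Real.pi) {p, b},
          spider c.swap (ang Real.pi) {q, b'}}
        {spider c.swap (ang Real.pi) {a, w}, spider c 0 {w, b, b'}}
  | pi_eps (c : Colour) (a w : ℕ) :
      Ax {spider c.swap (ang Real.pi) {a, w}, spider c 0 {w}} {spider c 0 {a}}
  /- The equations for `H`. -/
  | had_had (a b w : ℕ) :
      Ax {had a w, had w b} {line a b}
  | had_delta (c : Colour) (a b b' p q w : ℕ) :
      Ax {had a w, spider c 0 {w, b, b'}} {spider c.swap 0 {a, p, q}, had p b, had q b'}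
  | had_eps (c : Colour) (a w : ℕ) :
      Ax {had a w, spider c 0 {w}} {spider c.swap 0 {a}}
  | had_phase (c : Colour) (α : Real.Angle) (a b w w' : ℕ) :
      Ax {had a w, spider c α {w, b}} {spider c.swap α {a, w'}, had w' b}
  /- Scalar factors are suppressed: a vertex without legs of phase `α ≠ π`, and a vertex of phase
  `α` joined to one of the other colour of phase `0` or `π`. In Hilbert spaces these are the non-zero
  numbers `1 + exp (i α)`, `√2` and `√2 exp (i α)`. The vertex without legs of phase `π` is the
  number `0` and is kept. -/
  | scalar (c : Colour) (α : Real.Angle) (hα : α ≠ ang Real.pi) :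
      Ax {spider c α 0} 0
  | scalar_zero (c : Colour) (α : Real.Angle) (w : ℕ) :
      Ax {spider c α {w}, spider c.swap 0 {w}} 0
  | scalar_pi (c : Colour) (α : Real.Angle) (w : ℕ) :
      Ax {spider c α {w}, spider c.swap (ang Real.pi) {w}} 0

/-- `Derivable E D D'`: the equation `D = D'` is derivable in the red-green calculus extended by
the equations in `E` as additional axioms. The last two rules say that equations may be used
inside any larger diagram and that the names of wires carry no meaning. -/
inductive Derivable (E : Set Equation) : Net ℕ → Net ℕ → Prop
  | hyp (e : Equation) (he : e ∈ E) : Derivable E e.lhs e.rhs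
  | ax {D D' : Net ℕ} (h : Ax D D') (hD : D.IsDiagram) (hD' : D'.IsDiagram) : Derivable E D D'
  | refl (D : Net ℕ) : Derivable E D D
  | symm {D D' : Net ℕ} (h : Derivable E D D') : Derivable E D' D
  | trans {D D' D'' : Net ℕ} (h : Derivable E D D') (h' : Derivable E D' D'') : Derivable E D D''
  | context {D D' : Net ℕ} (C : Net ℕ) (h : Derivable E D D')
      (hD : (D + C).IsDiagram) (hD' : (D' + C).IsDiagram) : Derivable E (D + C) (D' + C)
  | rename {D D' : Net ℕ} (f : ℕ ↪ ℕ) (h : Derivable E D D') :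
      Derivable E (D.rename f) (D'.rename f)

/-! ### Graph states and local complementation -/

/-- Wires in the pictures of graph states: the output wire `out v` of the qubit `v`, the wire
`mid v` between the dot of `v` and a gate applied to this qubit, and the wire `half v w` from
the dot of `v` to the `H` on the edge between `v` and `w`. -/
inductive Wire (V : Type)
  | out (v : V)
  | mid (v : V)
  | half (v w : V)

/-- The `H` on an edge of the graph. -/
def edgeHad {V : Type} : Sym2 V → Vertex (Wire V) :=
  Sym2.lift ⟨fun v w => had (.half v w) (.half w v), fun v w => by
    simp only [had, Vertex.mk.injEq, true_and]
    exact Multiset.pair_comm _ _⟩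

open Classical in
/-- The graph state of `G`: one green dot for each vertex, two dots connected through an `H` if and
only if they are adjacent, and one output wire `o v` at each dot. -/
noncomputable def graphState {V : Type} [Fintype V] (G : SimpleGraph V) (o : V → Wire V) :
    Net (Wire V) :=
  Finset.univ.val.map (fun v : V =>
      spider .green 0 (o v ::ₘ (Finset.univ.filter fun w => G.Adj v w).val.map (Wire.half v)))
    + G.edgeFinset.val.map edgeHad

/-- Local complementation `G * u`: the edges between neighbours of `u` are complemented. -/
def localComplement {V : Type} (G : SimpleGraph V) (u : V) : SimpleGraph V where
  Adj v w := v ≠ w ∧ Xor (G.Adj v w) (G.Adj u v ∧ G.Adj u w)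
  symm := ⟨fun v w h => ⟨h.1.symm, by
    have := h.2
    rwa [G.adj_comm w v, and_comm (a := G.Adj u w)]⟩⟩
  loopless := ⟨fun _ h => h.1 rfl⟩

open Classical in
/-- The state `R_x(θ)^(u) R_z(-θ)^(N(u)) |G⟩`. -/
noncomputable def rotatedGraphState {V : Type} [Fintype V] (G : SimpleGraph V) (u : V) (θ : ℝ) :
    Net (Wire V) :=
  graphState G (fun v => if v = u ∨ G.Adj u v then .mid v else .out v)
    + {spider .red (ang θ) {.out u, .mid u}}
    + (Finset.univ.filter fun v => G.Adj u v).val.map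
        (fun v => spider .green (ang (-θ)) {.out v, .mid v})

/-- The local complementation property, with a red rotation by `θ` at `u` and green rotations by
`-θ` at its neighbours, is derivable from `E` for all finite simple graphs `G` and vertices `u`. -/
def VanDenNest (E : Set Equation) (θ : ℝ) : Prop :=
  ∀ (V : Type) [Fintype V] (G : SimpleGraph V) (u : V) (ν : Wire V ↪ ℕ),
    Derivable E ((rotatedGraphState G u θ).rename ν)
      ((graphState (localComplement G u) Wire.out).rename ν)

/-- The Euler decomposition `H = R_Z(-π/2) ∘ R_X(-π/2) ∘ R_Z(-π/2)` is derivable from `E`. -/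
def EulerDecomposition (E : Set Equation) : Prop :=
  ∀ a b x y : ℕ, [a, b, x, y].Nodup →
    Derivable E {had a b}
      {spider .green (ang (-(Real.pi / 2))) {a, x}, spider .red (ang (-(Real.pi / 2))) {x, y},
        spider .green (ang (-(Real.pi / 2))) {y, b}}

end RedGreen

/-! A diagram can be read as a sum of products. Wires joined by green vertices of phase `0` carry
one common variable with values 0 and 1; an `H` between x and y is the factor (-1)^(xy), a green leg
of phase α the factor e^(iαx), a red vertex of phase `0` the constraint that its variables have even
sum. Variables that are not open ends are summed over, and non-zero scalars are dropped. A graph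
state is then just the product of one `H` per edge, and a proof about graph states becomes algebra
with such factors.

This reading is made syntactic. A net whose wires have any number of ends stands for the diagram
`expand`, in which every variable is a green vertex, and `R E O D D'` says that the expansions of
`D` and `D'` with open variables `O` are derivably equal. By `R.app` an equation may be
instantiated, even with coinciding variables, and used in any context that does not capture hidden
variables; `R.line` is substitution; `R_iff_derivable` returns to diagrams. Behind these stand the
spider law and the renaming of inner wires.

Put τ = -θ, so that 2τ = π. Suppose `H` has the Euler decomposition with angle τ. Summing over a
variable of phase τ that is joined by `H`s to some variables produces phases -τ on these and an `H`
between any two of them (`Euler.fan_eq`). The Euler decomposition for -τ turns the red gate at u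
into one more such `H`, and the phases cancel, which is local complementation of a star
(`Euler.star_eq`). Edges away from u are a passive context, and double edges cancel by the Hopf law
`R.H_sq`; hence all of `VanDenNest`.

Conversely, local complementation at the centre of the path with three vertices is enough
(`euler_of_path`). Hiding outputs first shows that a loop with an `H` is a green phase π, then
yields the Euler decomposition up to a red dot of phase τ in place of a green one, and finally shows
that these two dots are inverse to each other.

Both signs of θ lead to the same decomposition because the Euler decompositions for τ and -τ are
equivalent (`Euler.neg`). -/

namespace RedGreen

/-! ### Wires, renaming and diagrams -/

/-- All the legs of a net, as a multiset of wires. -/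
def wires {W : Type} (D : Net W) : Multiset W := (D.map Vertex.legs).sum

section wires
variable {W W' W'' : Type}

@[simp] lemma wires_zero : wires (0 : Net W) = 0 := rfl

@[simp] lemma wires_add (D C : Net W) : wires (D + C) = wires D + wires C := by
  simp [wires]

@[simp] lemma wires_cons (v : Vertex W) (D : Net W) : wires (v ::ₘ D) = v.legs + wires D := by
  simp [wires]

@[simp] lemma wires_insert (v : Vertex W) (D : Net W) :
    wires (insert v D : Multiset (Vertex W)) = v.legs + wires D := wires_cons v D

@[simp] lemma wires_singleton (v : Vertex W) : wires ({v} : Net W) = v.legs := by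
  simp [wires]

@[simp] lemma spider_legs (c : Colour) (α : Real.Angle) (S : Multiset W) :
    (spider c α S).legs = S := rfl

@[simp] lemma had_legs (x y : W) : (had x y).legs = {x, y} := rfl

@[simp] lemma line_legs (x y : W) : (line x y).legs = {x, y} := rfl

lemma had_comm (x y : W) : had x y = had y x := by
  rw [had, had, Multiset.pair_comm]

lemma line_comm (x y : W) : line x y = line y x := by
  rw [line, line, Multiset.pair_comm]

lemma wires_le_of_le {D C : Net W} (h : D ≤ C) : wires D ≤ wires C := by
  obtain ⟨B, rfl⟩ := Multiset.le_iff_exists_add.1 h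
  simp

lemma mem_wires {D : Net W} {w : W} : w ∈ wires D ↔ ∃ v ∈ D, w ∈ v.legs := by
  induction D using Multiset.induction_on with
  | empty => simp
  | cons v D ih => simp [ih]

@[simp] lemma rename_zero (f : W → W') : Net.rename f (0 : Net W) = 0 := rfl

@[simp] lemma rename_add (f : W → W') (D C : Net W) :
    Net.rename f (D + C) = Net.rename f D + Net.rename f C := by
  simp [Net.rename]

@[simp] lemma rename_cons (f : W → W') (v : Vertex W) (D : Net W) :
    Net.rename f (v ::ₘ D) = ⟨v.kind, v.legs.map f⟩ ::ₘ Net.rename f D := by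
  simp [Net.rename]

@[simp] lemma rename_singleton (f : W → W') (v : Vertex W) :
    Net.rename f ({v} : Net W) = {⟨v.kind, v.legs.map f⟩} := by
  simp [Net.rename]

lemma wires_rename (f : W → W') (D : Net W) : wires (Net.rename f D) = (wires D).map f := by
  induction D using Multiset.induction_on with
  | empty => simp
  | cons v D ih => simp [ih]

lemma rename_rename (f : W → W') (g : W' → W'') (D : Net W) :
    Net.rename g (Net.rename f D) = Net.rename (g ∘ f) D := by
  simp [Net.rename]

lemma rename_congr {f g : W → W'} {D : Net W} (h : ∀ w ∈ wires D, f w = g w) :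
    Net.rename f D = Net.rename g D := by
  refine Multiset.map_congr rfl fun v hv => ?_
  rw [Multiset.map_congr rfl fun w hw => h w (mem_wires.2 ⟨v, hv, hw⟩)]

lemma rename_eq_self {f : W → W} {D : Net W} (h : ∀ w ∈ wires D, f w = w) :
    Net.rename f D = D := by
  rw [rename_congr (g := id) h]
  simp [Net.rename]

end wires

lemma deg_eq_count (D : Net ℕ) (x : ℕ) : D.deg x = (wires D).count x := by
  induction D using Multiset.induction_on with
  | empty => simp [Net.deg]
  | cons v D ih => simp_all [Net.deg]

/-- Every `H` and every piece of wire has exactly two legs. -/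
def HasArity {W : Type} (D : Net W) : Prop :=
  ∀ v ∈ D, v.kind = .had ∨ v.kind = .line → v.legs.card = 2

section arity
variable {W W' : Type}

@[simp] lemma hasArity_zero : HasArity (0 : Net W) := by simp [HasArity]

@[simp] lemma hasArity_add {D C : Net W} : HasArity (D + C) ↔ HasArity D ∧ HasArity C := by
  constructor
  · exact fun h => ⟨fun v hv => h v (Multiset.mem_add.2 (.inl hv)),
      fun v hv => h v (Multiset.mem_add.2 (.inr hv))⟩
  · rintro ⟨h, h'⟩ v hv
    exact (Multiset.mem_add.1 hv).elim (h v) (h' v)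

@[simp] lemma hasArity_cons {v : Vertex W} {D : Net W} :
    HasArity (v ::ₘ D) ↔ (v.kind = .had ∨ v.kind = .line → v.legs.card = 2) ∧ HasArity D := by
  simp only [HasArity, Multiset.mem_cons, forall_eq_or_imp]

@[simp] lemma hasArity_singleton {v : Vertex W} :
    HasArity ({v} : Net W) ↔ (v.kind = .had ∨ v.kind = .line → v.legs.card = 2) := by
  simp [HasArity]

@[simp] lemma hasArity_rename {f : W → W'} {D : Net W} :
    HasArity (Net.rename f D) ↔ HasArity D := by
  simp [HasArity, Net.rename]

@[simp] lemma spider_kind (c : Colour) (α : Real.Angle) (S : Multiset W) :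
    (spider c α S).kind = .spider c α := rfl

@[simp] lemma had_kind (x y : W) : (had x y).kind = .had := rfl

@[simp] lemma line_kind (x y : W) : (line x y).kind = .line := rfl

lemma hasArity_map_spider {ι : Type} (s : Multiset ι) (c : Colour) (α : ι → Real.Angle)
    (S : ι → Multiset W) : HasArity (s.map fun i => spider c (α i) (S i)) := by
  intro v hv
  obtain ⟨i, -, rfl⟩ := Multiset.mem_map.1 hv
  simp

end arity

lemma isDiagram_iff {D : Net ℕ} :
    D.IsDiagram ↔ (∀ x, (wires D).count x ≤ 2) ∧ HasArity D := by
  simp [Net.IsDiagram, HasArity, deg_eq_count]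

/-- A step that only consumes or permutes legs cannot give a wire too many ends. Most side
conditions of `Derivable.context` are settled in this way. -/
lemma isDiagram_of_wires_le {D D' : Net ℕ} (h : D.IsDiagram) (hw : wires D' ≤ wires D)
    (ha : HasArity D') : D'.IsDiagram :=
  isDiagram_iff.2 ⟨fun x => (Multiset.count_le_of_le x hw).trans ((isDiagram_iff.1 h).1 x), ha⟩

lemma isDiagram_of_le {D D' : Net ℕ} (h : D.IsDiagram) (hle : D' ≤ D) : D'.IsDiagram :=
  isDiagram_of_wires_le h (wires_le_of_le hle)
    fun v hv => (isDiagram_iff.1 h).2 v (Multiset.mem_of_le hle hv)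

/-! ### Basic derivations -/

section derivations
variable {E : Set Equation}

lemma derivable_of_eq {D D' : Net ℕ} (h : D = D') : Derivable E D D' := h ▸ .refl D

lemma derivable_ax {A A' : Net ℕ} (C : Net ℕ) (h : Ax A A') (hD : (A + C).IsDiagram)
    (hD' : (A' + C).IsDiagram) : Derivable E (A + C) (A' + C) :=
  .context C (.ax h (isDiagram_of_le hD (Multiset.le_add_right _ _))
    (isDiagram_of_le hD' (Multiset.le_add_right _ _))) hD hD'

lemma derivable_fuse {c : Colour} {α β : Real.Angle} {w : ℕ} {S T : Multiset ℕ} {C : Net ℕ}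
    (h : Net.IsDiagram ({spider c α (w ::ₘ S), spider c β (w ::ₘ T)} + C)) :
    Derivable E ({spider c α (w ::ₘ S), spider c β (w ::ₘ T)} + C)
      ({spider c (α + β) (S + T)} + C) := by
  refine derivable_ax C (.fuse c α β w S T) h (isDiagram_of_wires_le h ?_ ?_)
  · simp only [wires_add, wires_insert, wires_singleton, spider_legs]
    gcongr <;> exact Multiset.le_cons_self _ _
  · have := (isDiagram_iff.1 h).2
    simp_all

/-- Only the wires that occur matter: outside them `g` is changed so as to become injective on all
of `ℕ`, and the renaming rule applies. -/
lemma derivable_rename {D D' : Net ℕ} {g : ℕ → ℕ} (h : Derivable E D D')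
    (hg : Set.InjOn g {x | x ∈ wires D ∨ x ∈ wires D'}) :
    Derivable E (D.rename g) (D'.rename g) := by
  classical
  let A : Finset ℕ := (wires D + wires D').toFinset
  have hA : ∀ x, x ∈ A ↔ x ∈ wires D ∨ x ∈ wires D' := by simp [A]
  let B : ℕ := A.sup g
  have hB : ∀ x ∈ A, g x ≤ B := fun x hx => Finset.le_sup hx
  -- The remaining wires go beyond `B`, a bound for `g` on the wires that occur.
  let f : ℕ → ℕ := fun x => if x ∈ A then g x else x + B + 1
  have hf : Function.Injective f := by
    intro x y hxy
    simp only [f] at hxy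
    split_ifs at hxy with hx hy hy
    · exact hg ((hA x).1 hx) ((hA y).1 hy) hxy
    · have := hB x hx; omega
    · have := hB y hy; omega
    · omega
  have := Derivable.rename ⟨f, hf⟩ h
  rwa [rename_congr (f := (⟨f, hf⟩ : ℕ ↪ ℕ)) (g := g), rename_congr (f := (⟨f, hf⟩ : ℕ ↪ ℕ)) (g := g)]
    at this
  · intro w hw
    simp [f, (hA w).2 (.inr hw)]
  · intro w hw
    simp [f, (hA w).2 (.inl hw)]

lemma exists_eq_cons_of_mem_wires {D : Net ℕ} {a : ℕ} (h : a ∈ wires D) :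
    ∃ k S C, D = (⟨k, a ::ₘ S⟩ : Vertex ℕ) ::ₘ C := by
  obtain ⟨⟨k, L⟩, hv, ha⟩ := mem_wires.1 h
  obtain ⟨S, rfl⟩ := Multiset.exists_cons_of_mem ha
  obtain ⟨C, rfl⟩ := Multiset.exists_cons_of_mem hv
  exact ⟨k, S, C, rfl⟩

/-- The map that sends `a` to `b` and leaves everything else in place. -/
def sub (a b : ℕ) : ℕ → ℕ := Function.update id a b

@[simp] lemma sub_self (a b : ℕ) : sub a b a = b := by simp [sub]

lemma sub_of_ne {a b x : ℕ} (h : x ≠ a) : sub a b x = x := by simp [sub, h]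

lemma map_sub_of_notMem {a b : ℕ} {S : Multiset ℕ} (h : a ∉ S) : S.map (sub a b) = S := by
  conv_rhs => rw [← S.map_id]
  exact Multiset.map_congr rfl fun x hx => sub_of_ne fun e => h (e ▸ hx)

lemma rename_sub_of_notMem {a b : ℕ} {D : Net ℕ} (h : a ∉ wires D) : D.rename (sub a b) = D :=
  rename_eq_self fun _ hx => sub_of_ne fun e => h (e ▸ hx)

/-- A piece of wire between `a` and `b` is removed by giving `a` the name `b`. -/
lemma derivable_merge {K : Net ℕ} {a b : ℕ} (hd : (K + {line a b}).IsDiagram)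
    (ha : (wires K).count a = 1) : Derivable E (K + {line a b}) (K.rename (sub a b)) := by
  obtain ⟨k, S, C, rfl⟩ := exists_eq_cons_of_mem_wires
    (Multiset.count_pos.1 (by omega : 0 < (wires K).count a))
  simp only [wires_cons, Multiset.cons_add, Multiset.count_cons_self, Multiset.count_add] at ha
  have hS : a ∉ S := Multiset.count_eq_zero.1 (by omega)
  have hC : a ∉ wires C := Multiset.count_eq_zero.1 (by omega)
  have e : ((⟨k, a ::ₘ S⟩ : Vertex ℕ) ::ₘ C) + {line a b} = {⟨k, a ::ₘ S⟩, line a b} + C := by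
    simp only [Multiset.insert_eq_cons, ← Multiset.singleton_add]
    abel
  rw [e] at hd ⊢
  have e' : Net.rename (sub a b) ((⟨k, a ::ₘ S⟩ : Vertex ℕ) ::ₘ C) = {⟨k, b ::ₘ S⟩} + C := by
    simp [map_sub_of_notMem hS, rename_sub_of_notMem hC]
  rw [e']
  refine derivable_ax C (.absorb k a b S) hd (isDiagram_of_wires_le hd ?_ ?_)
  · simp only [wires_add, wires_singleton, line_legs, Multiset.insert_eq_cons,
      ← Multiset.singleton_add]
    rw [show {a} + S + ({a} + {b}) + wires C = ({b} + S + wires C) + ({a} + {a}) by abel]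
    exact Multiset.le_add_right _ _
  · have := (isDiagram_iff.1 hd).2
    simp_all

/-- Absorption read backwards creates a piece of wire between `y` and `x` at one end of the wire
`x`; absorbing that piece at the other end gives this end the name `y` as well. -/
lemma derivable_rename_sub {D : Net ℕ} {x y : ℕ} (hd : D.IsDiagram) (hx : (wires D).count x = 2)
    (hy : y ∉ wires D) : Derivable E D (D.rename (sub x y)) := by
  obtain ⟨k, S, C, rfl⟩ := exists_eq_cons_of_mem_wires
    (Multiset.count_pos.1 (by omega : 0 < (wires D).count x))
  simp only [wires_cons, Multiset.cons_add, Multiset.count_cons_self, Multiset.count_add,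
    Multiset.mem_cons, Multiset.mem_add, not_or] at hx hy
  have hxy : x ≠ y := Ne.symm hy.1
  have hS := Multiset.count_eq_zero.2 hy.2.1
  have hC := Multiset.count_eq_zero.2 hy.2.2
  obtain ⟨h1, h2⟩ := isDiagram_iff.1 hd
  have hd2 : Net.IsDiagram ({⟨k, y ::ₘ S⟩, line y x} + C) := by
    refine isDiagram_iff.2 ⟨fun z => ?_, by simp_all⟩
    have := h1 z
    simp only [wires_add, wires_cons, wires_singleton, line_legs,
      Multiset.insert_eq_cons, Multiset.count_add, Multiset.count_cons,
      Multiset.count_singleton] at this ⊢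
    split_ifs at this ⊢ with h3 h4 h5
    · omega
    · subst h3; omega
    · omega
    · omega
  have s1 : Derivable E ((⟨k, x ::ₘ S⟩ : Vertex ℕ) ::ₘ C) ({⟨k, y ::ₘ S⟩, line y x} + C) := by
    have := derivable_ax (E := E) C (.absorb k y x S) hd2 (by simpa using hd)
    simpa using this.symm
  have e : ({⟨k, y ::ₘ S⟩, line y x} + C : Net ℕ) = ({⟨k, y ::ₘ S⟩} + C) + {line x y} := by
    rw [line_comm y x]
    simp only [Multiset.insert_eq_cons, ← Multiset.singleton_add]
    abel
  refine s1.trans ?_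
  rw [e] at hd2 ⊢
  have := derivable_merge (E := E) hd2 (by
    simp [hxy]; omega)
  convert this using 1
  simp [sub_of_ne hxy.symm]

-- Names are changed one at a time; as the new names do not occur in `D`, every intermediate
-- renaming is injective on its wires.
open Classical in
lemma derivable_rename_fresh {D : Net ℕ} (hd : D.IsDiagram) (g : ℕ → ℕ) (A : Finset ℕ)
    (hA : ∀ a ∈ A, (wires D).count a = 2) (hg : Set.InjOn g A) (hgD : ∀ a ∈ A, g a ∉ wires D) :
    Derivable E D (D.rename fun x => if x ∈ A then g x else x) := by
  induction A using Finset.induction_on with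
  | empty => exact derivable_of_eq (rename_eq_self (by simp)).symm
  | insert a A ha ih =>
    simp only [Finset.mem_insert, forall_eq_or_imp] at hA hgD
    have ih' := ih hA.2 (hg.mono (by simp)) hgD.2
    refine ih'.trans ?_
    set f : ℕ → ℕ := fun x => if x ∈ A then g x else x with hf
    have haw : a ∈ wires D := Multiset.count_pos.1 (by omega)
    have hinj : Set.InjOn f {x | x ∈ wires D} := by
      intro x hx y hy hxy
      simp only [hf] at hxy
      split_ifs at hxy with h1 h2 h2
      · exact hg (by simp [h1]) (by simp [h2]) hxy
      · exact absurd (hxy ▸ hy) (hgD.2 x h1)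
      · exact absurd (hxy ▸ hx) (hgD.2 y h2)
      · exact hxy
    have hfa : f a = a := by simp [hf, ha]
    have hd' : (D.rename f).IsDiagram := by
      refine isDiagram_iff.2 ⟨fun x => ?_, by simpa using (isDiagram_iff.1 hd).2⟩
      rw [wires_rename]
      by_cases hx : x ∈ (wires D).map f
      · obtain ⟨y, hy, rfl⟩ := Multiset.mem_map.1 hx
        rw [Multiset.count_map_eq_count f _ hinj y hy]
        exact (isDiagram_iff.1 hd).1 y
      · simp [Multiset.count_eq_zero.2 hx]
    have := derivable_rename_sub (E := E) (x := a) (y := g a) hd' (by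
      rw [wires_rename]
      conv_lhs => rw [← hfa]
      rw [Multiset.count_map_eq_count f _ hinj a haw, hA.1]) (by
      rw [wires_rename, Multiset.mem_map]
      rintro ⟨y, hy, hya⟩
      simp only [hf] at hya
      split_ifs at hya with h1
      · exact ha (hg (by simp [h1]) (by simp) hya ▸ h1)
      · exact hgD.1 (hya ▸ hy))
    convert this using 1
    rw [rename_rename]
    refine rename_congr fun x hx => ?_
    simp only [Finset.mem_insert, Function.comp_apply, hf]
    by_cases hxa : x = a
    · subst hxa; simp [ha]
    · by_cases hxA : x ∈ A
      · simp only [hxA, or_true, if_true]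
        rw [sub_of_ne]
        rintro h
        exact hgD.2 x hxA (h ▸ haw)
      · simp [hxA, hxa, sub_of_ne]

/-- The names of the inner wires of a diagram carry no meaning. -/
lemma derivable_alpha {D : Net ℕ} (hd : D.IsDiagram) (g : ℕ → ℕ)
    (hg : Set.InjOn g {x | x ∈ wires D}) (hgo : ∀ x ∈ wires D, (wires D).count x ≠ 2 → g x = x) :
    Derivable E D (D.rename g) := by
  classical
  let A : Finset ℕ := (wires D).toFinset.filter fun x => (wires D).count x = 2
  have hA : ∀ x, x ∈ A ↔ x ∈ wires D ∧ (wires D).count x = 2 := by simp [A]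
  -- Since `g` may permute names, it cannot be carried out one name at a time. Both nets are brought
  -- to common fresh names instead: an inner wire `x` of `D` and the wire `g x` of the renamed net
  -- both become `x + N`.
  obtain ⟨N, hN⟩ : ∃ N, ∀ x ∈ wires D, x < N ∧ g x < N :=
    ⟨((wires D).toFinset.sup fun x => max x (g x)) + 1, fun x hx => by
      have := Finset.le_sup (f := fun x => max x (g x)) (Multiset.mem_toFinset.2 hx)
      omega⟩
  have hcount : ∀ x ∈ wires D, (wires (D.rename g)).count (g x) = (wires D).count x := by
    intro x hx
    rw [wires_rename, Multiset.count_map_eq_count g _ hg x hx]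
  have hd' : (D.rename g).IsDiagram := by
    refine isDiagram_iff.2 ⟨fun x => ?_, by simpa using (isDiagram_iff.1 hd).2⟩
    by_cases hx : x ∈ wires (D.rename g)
    · rw [wires_rename] at hx
      obtain ⟨y, hy, rfl⟩ := Multiset.mem_map.1 hx
      rw [hcount y hy]
      exact (isDiagram_iff.1 hd).1 y
    · simp [Multiset.count_eq_zero.2 hx]
  let g' := Function.invFunOn g {x | x ∈ wires D}
  have hg' : ∀ x ∈ wires D, g' (g x) = x := fun x hx => hg.leftInvOn_invFunOn hx
  have h1 := derivable_rename_fresh (E := E) hd (fun x => x + N) A (fun a ha => ((hA a).1 ha).2)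
    (fun x _ y _ h => by simpa using h) (fun a ha h => by have := (hN _ h).1; omega)
  have h2 := derivable_rename_fresh (E := E) hd' (fun x => g' x + N) (A.image g) (by
      intro a ha
      obtain ⟨x, hx, rfl⟩ := Finset.mem_image.1 ha
      rw [hcount x ((hA x).1 hx).1, ((hA x).1 hx).2]) (by
      intro a ha b hb hab
      obtain ⟨x, hx, rfl⟩ := Finset.mem_image.1 (Finset.mem_coe.1 ha)
      obtain ⟨y, hy, rfl⟩ := Finset.mem_image.1 (Finset.mem_coe.1 hb)
      simp only [hg' x ((hA x).1 hx).1, hg' y ((hA y).1 hy).1] at hab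
      rw [show x = y by omega]) (by
      intro a ha h
      rw [wires_rename] at h
      obtain ⟨y, hy, hya⟩ := Multiset.mem_map.1 h
      have := (hN y hy).2
      omega)
  refine h1.trans (Derivable.trans (derivable_of_eq ?_) h2.symm)
  rw [rename_rename]
  refine rename_congr fun x hx => ?_
  have : g x ∈ A.image g ↔ x ∈ A := by
    simp only [Finset.mem_image]
    constructor
    · rintro ⟨y, hy, hyx⟩
      rwa [← hg ((hA y).1 hy).1 hx hyx]
    · exact fun h => ⟨x, h, rfl⟩
  simp only [Function.comp_apply, this, hg' x hx]
  split_ifs with h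
  · rfl
  · exact (hgo x hx fun hc => h ((hA x).2 ⟨hx, hc⟩)).symm

end derivations

/-! ### Expansions

A net in which wires may have any number of ends is read as a diagram by putting each leg on a
wire of its own and joining the wires that belong to the same variable by a green vertex. -/

/-- Green vertices of phase `0`, one for each element `x` of `X`, with legs `S x`. -/
noncomputable def greens (X : Finset ℕ) (S : ℕ → Multiset ℕ) : Net ℕ := X.val.map fun x => spider .green 0 (S x)

lemma wires_greens (X : Finset ℕ) (S : ℕ → Multiset ℕ) : wires (greens X S) = ∑ x ∈ X, S x := by
  rw [wires, greens, Multiset.map_map]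
  rfl

lemma hasArity_greens (X : Finset ℕ) (S : ℕ → Multiset ℕ) : HasArity (greens X S) :=
  hasArity_map_spider _ _ _ _

lemma greens_insert {X : Finset ℕ} {x : ℕ} (hx : x ∉ X) (S : ℕ → Multiset ℕ) :
    greens (insert x X) S = {spider .green 0 (S x)} + greens X S := by
  simp [greens, Finset.insert_val_of_notMem hx]

lemma greens_congr {X : Finset ℕ} {S T : ℕ → Multiset ℕ} (h : ∀ x ∈ X, S x = T x) :
    greens X S = greens X T :=
  Multiset.map_congr rfl fun x hx => by rw [h x hx]

lemma greens_union {X Y : Finset ℕ} (h : Disjoint X Y) (S : ℕ → Multiset ℕ) :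
    greens (X ∪ Y) S = greens X S + greens Y S := by
  rw [← Finset.disjUnion_eq_union X Y h, greens, Finset.disjUnion_val, Multiset.map_add]
  rfl

lemma greens_image {X : Finset ℕ} {g : ℕ → ℕ} (hg : Set.InjOn g X) (S : ℕ → Multiset ℕ) :
    greens (X.image g) S = greens X (S ∘ g) := by
  rw [greens, Finset.image_val_of_injOn hg, Multiset.map_map]
  rfl

lemma rename_greens (f : ℕ → ℕ) (X : Finset ℕ) (S : ℕ → Multiset ℕ) :
    Net.rename f (greens X S) = greens X fun x => (S x).map f := by
  simp [greens, Net.rename, spider]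

/-- The legs of the green vertex that stands for the variable `x`. -/
def star (O : Finset ℕ) (f : ℕ → ℕ) (L : Multiset ℕ) (x : ℕ) : Multiset ℕ :=
  (if x ∈ O then {x} else 0) + L.filter (f · = x)

/-- The diagram with the vertices `M`, whose wires are joined according to `f`; the variables in
`X` that belong to `O` have an open end. -/
noncomputable def expand (X O : Finset ℕ) (M : Net ℕ) (f : ℕ → ℕ) : Net ℕ :=
  M + greens X (star O f (wires M))

/-- `M` is obtained from `D` by putting each leg on a wire of its own. -/
structure IsExpansion (X : Finset ℕ) (D M : Net ℕ) (f : ℕ → ℕ) : Prop where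
  nodup : (wires M).Nodup
  notMem : ∀ w ∈ wires M, w ∉ X
  maps : ∀ w ∈ wires M, f w ∈ X
  rename_eq : M.rename f = D

lemma sum_filter_eq {X : Finset ℕ} {L : Multiset ℕ} {f : ℕ → ℕ} (h : ∀ w ∈ L, f w ∈ X) :
    ∑ x ∈ X, L.filter (f · = x) = L := by
  ext w
  rw [Multiset.count_sum']
  simp only [Multiset.count_filter]
  rw [Finset.sum_ite_eq]
  split_ifs with hw
  · rfl
  · exact (Multiset.count_eq_zero.2 fun hm => hw (h w hm)).symm

lemma sum_open_eq {X O : Finset ℕ} (h : O ⊆ X) :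
    ∑ x ∈ X, (if x ∈ O then {x} else 0 : Multiset ℕ) = O.val := by
  rw [Finset.sum_ite_mem, Finset.inter_eq_right.2 h, Finset.sum_multiset_singleton]

lemma wires_expand {X O : Finset ℕ} {D M : Net ℕ} {f : ℕ → ℕ} (hO : O ⊆ X)
    (h : IsExpansion X D M f) : wires (expand X O M f) = wires M + (O.val + wires M) := by
  simp only [expand, wires_add, wires_greens, star, Finset.sum_add_distrib, sum_filter_eq h.maps,
    sum_open_eq hO]

/-- Made for expansions and their gluings: each leg has a second end at one green vertex, so all
legs together fit into two copies of a list without repetitions. -/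
lemma isDiagram_of_nodup {D : Net ℕ} {L : Multiset ℕ} (hL : L.Nodup) (hD : wires D ≤ L + L)
    (ha : HasArity D) : D.IsDiagram := by
  refine isDiagram_iff.2 ⟨fun x => ?_, ha⟩
  have h1 := Multiset.count_le_of_le x hD
  have h2 := Multiset.nodup_iff_count_le_one.1 hL x
  rw [Multiset.count_add] at h1
  omega

lemma hasArity_expand {X O : Finset ℕ} {D M : Net ℕ} {f : ℕ → ℕ}
    (h : IsExpansion X D M f) : HasArity (expand X O M f) ↔ HasArity D := by
  simp [expand, hasArity_greens, ← h.rename_eq]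

lemma isDiagram_expand {X O : Finset ℕ} {D M : Net ℕ} {f : ℕ → ℕ} (hO : O ⊆ X)
    (h : IsExpansion X D M f) (ha : HasArity D) : (expand X O M f).IsDiagram := by
  refine isDiagram_of_nodup (L := wires M + O.val) ?_ ?_ ((hasArity_expand h).2 ha)
  · refine Multiset.nodup_add.2 ⟨h.nodup, O.nodup, ?_⟩
    exact Multiset.disjoint_left.2 fun hw hw' => h.notMem _ hw (hO hw')
  · rw [wires_expand hO h]
    rw [show wires M + O.val + (wires M + O.val) = wires M + (O.val + wires M) + O.val by abel]
    exact Multiset.le_add_right _ _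

lemma exists_map_of_rel {r : ℕ → ℕ → Prop} {L L' : Multiset ℕ} (h : Multiset.Rel r L L')
    (hL : L.Nodup) : ∃ τ : ℕ → ℕ, L.map τ = L' ∧ ∀ w ∈ L, r w (τ w) := by
  induction h with
  | zero => exact ⟨id, by simp⟩
  | @cons a b L L' hab _ ih =>
    rw [Multiset.nodup_cons] at hL
    obtain ⟨τ, rfl, hr⟩ := ih hL.2
    refine ⟨Function.update τ a b, ?_, fun w hw => ?_⟩
    · rw [Multiset.map_cons, Function.update_self]
      congr 1
      exact Multiset.map_congr rfl fun x hx =>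
        Function.update_of_ne (ne_of_mem_of_not_mem hx hL.1) _ _
    · by_cases e : w = a
      · subst e; simpa using hab
      · rw [Function.update_of_ne e]
        exact hr w ((Multiset.mem_cons.1 hw).resolve_left e)

/-- Vertices are paired, and inside each pair the legs that belong to the same variable. As no wire
of `M` occurs twice, these choices assemble to a single map. -/
lemma exists_rename_of_rel {f f' : ℕ → ℕ} {M M' : Net ℕ}
    (h : Multiset.Rel (fun v v' : Vertex ℕ => v.kind = v'.kind ∧ v.legs.map f = v'.legs.map f') M M')
    (hM : (wires M).Nodup) : ∃ σ : ℕ → ℕ, M.rename σ = M' ∧ ∀ w ∈ wires M, f' (σ w) = f w := by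
  induction h with
  | zero => exact ⟨id, by simp⟩
  | @cons v v' M M' hv _ ih =>
    rw [wires_cons, Multiset.nodup_add] at hM
    obtain ⟨σ, rfl, hσ⟩ := ih hM.2.1
    obtain ⟨τ, hτ, hr⟩ := exists_map_of_rel (r := fun a b => f a = f' b)
      (Multiset.rel_map.1 (Multiset.rel_eq.2 hv.2)) hM.1
    have hd : ∀ w ∈ wires M, w ∉ v.legs := fun w => Multiset.disjoint_right.1 hM.2.2
    refine ⟨fun w => if w ∈ v.legs then τ w else σ w, ?_, fun w hw => ?_⟩
    · rw [rename_cons]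
      congr 1
      · rw [Multiset.map_congr (g := τ) rfl fun x hx => by simp [hx], hτ, hv.1]
      · exact rename_congr fun w hw => by simp [hd w hw]
    · by_cases e : w ∈ v.legs
      · simp [e, hr w e]
      · simp [e, hσ w (by simpa [e] using hw)]

lemma exists_nodup_map_eq (B : Finset ℕ) (L : Multiset ℕ) :
    ∃ (L₀ : Multiset ℕ) (f : ℕ → ℕ), L₀.Nodup ∧ (∀ w ∈ L₀, w ∉ B) ∧ L₀.map f = L := by
  induction L using Multiset.induction_on with
  | empty => exact ⟨0, id, by simp⟩
  | cons a L ih =>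
    obtain ⟨L₀, f, h1, h2, rfl⟩ := ih
    obtain ⟨w, hw⟩ := Infinite.exists_notMem_finset (B ∪ L₀.toFinset)
    simp only [Finset.mem_union, Multiset.mem_toFinset, not_or] at hw
    refine ⟨w ::ₘ L₀, Function.update f w a, by simp [h1, hw], by simpa [hw] using h2, ?_⟩
    rw [Multiset.map_cons, Function.update_self]
    congr 1
    exact Multiset.map_congr rfl fun x hx =>
      Function.update_of_ne (ne_of_mem_of_not_mem hx hw.2) _ _

/-- The set `B` of forbidden names serves to keep the new legs apart from nets that are already in
use. -/
lemma exists_isExpansion {X : Finset ℕ} (B : Finset ℕ) {D : Net ℕ} (hD : ∀ w ∈ wires D, w ∈ X) :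
    ∃ M f, IsExpansion X D M f ∧ ∀ w ∈ wires M, w ∉ B := by
  induction D using Multiset.induction_on with
  | empty => exact ⟨0, id, ⟨by simp, by simp, by simp, rfl⟩, by simp⟩
  | cons v D ih =>
    obtain ⟨M, f, hM, hB⟩ := ih fun w hw => hD w (by simp [hw])
    obtain ⟨L, f', h1, h2, h3⟩ := exists_nodup_map_eq (X ∪ B ∪ (wires M).toFinset) v.legs
    simp only [Finset.mem_union, Multiset.mem_toFinset, not_or] at h2
    have hdis : Disjoint L (wires M) := Multiset.disjoint_left.2 fun hw hw' => (h2 _ hw).2 hw'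
    have hF : ∀ w ∈ wires M, (if w ∈ L then f' w else f w) = f w := fun w hw => by
      rw [if_neg fun h => (h2 w h).2 hw]
    refine ⟨(⟨v.kind, L⟩ : Vertex ℕ) ::ₘ M, fun w => if w ∈ L then f' w else f w,
      ⟨?_, ?_, ?_, ?_⟩, ?_⟩
    · rw [wires_cons]
      exact Multiset.nodup_add.2 ⟨h1, hM.nodup, hdis⟩
    · intro w hw
      rw [wires_cons, Multiset.mem_add] at hw
      exact hw.elim (fun h => (h2 w h).1.1) (hM.notMem w)
    · intro w hw
      rw [wires_cons, Multiset.mem_add] at hw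
      rcases hw with hw | hw
      · simp only at hw
        rw [if_pos hw]
        refine hD _ ?_
        rw [wires_cons, Multiset.mem_add, ← h3]
        exact .inl (Multiset.mem_map_of_mem f' hw)
      · rw [hF w hw]
        exact hM.maps w hw
    · rw [rename_cons]
      congr 1
      · simp only
        rw [Multiset.map_congr (g := f') rfl fun x hx => by simp [hx], h3]
      · rw [rename_congr hF, hM.rename_eq]
    · intro w hw
      rw [wires_cons, Multiset.mem_add] at hw
      exact hw.elim (fun h => (h2 w h).1.2) (hB w)

/-! ### Independence of the chosen expansion, and the relation `R` -/

section
variable {E : Set Equation}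

/-- Over the same set of variables, two expansions differ only in the names of the legs. These are
inner wires, so `derivable_alpha` applies; open ends lie in `X`, hence are not names of legs, and
stay fixed. -/
lemma derivable_expand_of_isExpansion {X O : Finset ℕ} {D M M' : Net ℕ} {f f' : ℕ → ℕ}
    (hO : O ⊆ X) (ha : HasArity D) (h : IsExpansion X D M f) (h' : IsExpansion X D M' f') :
    Derivable E (expand X O M f) (expand X O M' f') := by
  have hrel : Multiset.Rel (fun v v' : Vertex ℕ => v.kind = v'.kind ∧
      v.legs.map f = v'.legs.map f') M M' := by
    have := Multiset.rel_eq.2 (h.rename_eq.trans h'.rename_eq.symm)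
    simpa [Net.rename, Multiset.rel_map] using this
  obtain ⟨σ, rfl, hσ⟩ := exists_rename_of_rel hrel h.nodup
  have hn := h'.nodup
  rw [wires_rename] at hn
  have hinj := Multiset.inj_on_of_nodup_map hn
  let τ : ℕ → ℕ := fun w => if w ∈ wires M then σ w else w
  have hτ : ∀ w ∈ wires M, τ w = σ w := fun w hw => by simp [τ, hw]
  have hτO : ∀ x ∈ O, τ x = x := fun x hx => by
    simp only [τ]
    rw [if_neg fun hw => h.notMem x hw (hO hx)]
  have hmem : ∀ w, w ∈ wires (expand X O M f) ↔ w ∈ wires M ∨ w ∈ O := fun w => by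
    rw [wires_expand hO h]
    simp only [Multiset.mem_add, Finset.mem_val]
    tauto
  have hnot : ∀ w ∈ wires M, σ w ∉ O := fun w hw hw' =>
    h'.notMem (σ w) (by rw [wires_rename]; exact Multiset.mem_map_of_mem σ hw) (hO hw')
  have key := derivable_alpha (E := E) (isDiagram_expand hO h ha) τ (by
    intro w hw w' hw' e
    simp only [Set.mem_ofPred_eq, hmem] at hw hw'
    rcases hw with hw | hw <;> rcases hw' with hw' | hw'
    · rw [hτ w hw, hτ w' hw'] at e
      exact hinj w hw w' hw' e
    · rw [hτ w hw, hτO w' hw'] at e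
      exact absurd (e ▸ hw') (hnot w hw)
    · rw [hτO w hw, hτ w' hw'] at e
      exact absurd (e ▸ hw) (hnot w' hw')
    · rwa [hτO w hw, hτO w' hw'] at e) (by
    intro w hw hc
    rw [hmem] at hw
    rcases hw with hw | hw
    · refine absurd ?_ hc
      rw [wires_expand hO h, Multiset.count_add, Multiset.count_add,
        Multiset.count_eq_one_of_mem h.nodup hw,
        Multiset.count_eq_zero.2 fun hw' => h.notMem w hw (hO hw')]
    · exact hτO w hw)
  refine key.trans (derivable_of_eq ?_)
  simp only [expand, rename_add, rename_greens, rename_congr hτ]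
  congr 1
  refine greens_congr fun x _ => ?_
  simp only [star, Multiset.map_add, wires_rename, Multiset.filter_map]
  congr 1
  · split_ifs with hx
    · simp [hτO x hx]
    · rfl
  · rw [Multiset.map_congr (g := σ) rfl fun w hw => hτ w (Multiset.mem_of_mem_filter hw)]
    congr 1
    exact Multiset.filter_congr fun w hw => by simp [hσ w hw]

/-- A hidden variable that occurs nowhere is a green vertex without legs. This scalar is suppressed
because its phase `0` differs from `π`. -/
lemma derivable_greens_zero {K : Net ℕ} (Y : Finset ℕ) (hK : K.IsDiagram) :
    Derivable E (greens Y (fun _ => 0) + K) K := by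
  induction Y using Finset.induction_on with
  | empty => exact derivable_of_eq (by simp [greens])
  | insert y Y hy ih =>
    have hd : Net.IsDiagram (greens Y (fun _ => 0) + K) := isDiagram_of_wires_le hK
      (by simp [wires_greens]) (by simp [hasArity_greens, (isDiagram_iff.1 hK).2])
    rw [greens_insert hy, add_assoc]
    refine Derivable.trans ?_ ih
    have := derivable_ax (E := E) (greens Y (fun _ => 0) + K) (.scalar .green 0 (by
      rw [ang]
      exact Real.Angle.pi_ne_zero.symm)) (isDiagram_of_wires_le hd (by simp) (by
        simpa using (isDiagram_iff.1 hd).2)) (by simpa using hd)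
    simpa using this

lemma derivable_expand_mono {X X' O : Finset ℕ} {D M : Net ℕ} {f : ℕ → ℕ}
    (hX : X ⊆ X') (hO : O ⊆ X) (ha : HasArity D) (h : IsExpansion X D M f) :
    Derivable E (expand X' O M f) (expand X O M f) := by
  rw [expand, ← Finset.sdiff_union_of_subset hX, greens_union Finset.sdiff_disjoint,
    greens_congr (X := X' \ X) (T := fun _ => 0), ← add_assoc, add_comm M, add_assoc]
  · exact derivable_greens_zero _ (isDiagram_expand hO h ha)
  · intro x hx
    rw [Finset.mem_sdiff] at hx
    rw [star, if_neg fun hx' => hx.2 (hO hx'), zero_add, Multiset.filter_eq_nil]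
    rintro w hw rfl
    exact hx.2 (h.maps w hw)

lemma IsExpansion.mono {X X' : Finset ℕ} {D M : Net ℕ} {f : ℕ → ℕ} (h : IsExpansion X D M f)
    (hX : X ⊆ X') (hX' : ∀ w ∈ wires M, w ∉ X') : IsExpansion X' D M f :=
  ⟨h.nodup, hX', fun w hw => hX (h.maps w hw), h.rename_eq⟩

lemma IsExpansion.wires_subset {X : Finset ℕ} {D M : Net ℕ} {f : ℕ → ℕ} (h : IsExpansion X D M f) :
    ∀ w ∈ wires D, w ∈ X := by
  intro w hw
  rw [← h.rename_eq, wires_rename] at hw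
  obtain ⟨y, hy, rfl⟩ := Multiset.mem_map.1 hw
  exact h.maps y hy

/-- Any two expansions of a net with the same open ends are derivably equal. -/
lemma derivable_expand {X X' O : Finset ℕ} {D M M' : Net ℕ} {f f' : ℕ → ℕ}
    (hO : O ⊆ X) (hO' : O ⊆ X') (ha : HasArity D) (h : IsExpansion X D M f)
    (h' : IsExpansion X' D M' f') : Derivable E (expand X O M f) (expand X' O M' f') := by
  -- The smallest possible set of variables. The legs of `N` avoid both `X` and `X'`, so `N` is also
  -- an expansion over each of them and links the two.
  let Y := O ∪ (wires D).toFinset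
  have hYX : Y ⊆ X := Finset.union_subset hO fun w hw => h.wires_subset w (by simpa using hw)
  have hYX' : Y ⊆ X' := Finset.union_subset hO' fun w hw => h'.wires_subset w (by simpa using hw)
  obtain ⟨N, e, hN, hB⟩ := exists_isExpansion (X := Y) (X ∪ X') (D := D)
    fun w hw => by simp [Y, hw]
  have hOY : O ⊆ Y := Finset.subset_union_left
  have h1 := derivable_expand_of_isExpansion (E := E) hO ha h
    (hN.mono hYX fun w hw hx => hB w hw (Finset.mem_union_left _ hx))
  have h2 := derivable_expand_of_isExpansion (E := E) hO' ha
    (hN.mono hYX' fun w hw hx => hB w hw (Finset.mem_union_right _ hx)) h'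
  exact h1.trans ((derivable_expand_mono hYX hOY ha hN).trans
    ((derivable_expand_mono hYX' hOY ha hN).symm.trans h2))

variable (E) in
/-- `R E O D D'`: the nets `D` and `D'`, in which wires may have any number of ends, are derivably
equal as diagrams with the open ends `O`. -/
def R (O : Finset ℕ) (D D' : Net ℕ) : Prop :=
  (HasArity D ↔ HasArity D') ∧ (HasArity D → ∃ X M f X' M' f', O ⊆ X ∧ O ⊆ X' ∧
    IsExpansion X D M f ∧ IsExpansion X' D' M' f' ∧
      Derivable E (expand X O M f) (expand X' O M' f'))

/-- The existential choice of expansions in `R` may be replaced by any other choice; transitivity of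
`R` depends on this. -/
lemma R.derivable {O : Finset ℕ} {D D' : Net ℕ} (hR : R E O D D') (ha : HasArity D)
    {X X' : Finset ℕ} {M M' : Net ℕ} {f f' : ℕ → ℕ} (hO : O ⊆ X) (hO' : O ⊆ X')
    (h : IsExpansion X D M f) (h' : IsExpansion X' D' M' f') :
    Derivable E (expand X O M f) (expand X' O M' f') := by
  obtain ⟨Y, N, e, Y', N', e', h1, h2, h3, h4, h5⟩ := hR.2 ha
  exact (derivable_expand hO h1 ha h h3).trans
    (h5.trans (derivable_expand h2 hO' (hR.1.1 ha) h4 h'))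

lemma exists_expand (O : Finset ℕ) (D : Net ℕ) : ∃ X M f, O ⊆ X ∧ IsExpansion X D M f := by
  obtain ⟨M, f, h, -⟩ := exists_isExpansion (X := O ∪ (wires D).toFinset) ∅ (D := D)
    fun w hw => by simp [hw]
  exact ⟨_, M, f, Finset.subset_union_left, h⟩

lemma R.refl (O : Finset ℕ) (D : Net ℕ) : R E O D D := by
  obtain ⟨X, M, f, hO, h⟩ := exists_expand O D
  exact ⟨Iff.rfl, fun _ => ⟨X, M, f, X, M, f, hO, hO, h, h, .refl _⟩⟩

lemma R.of_eq {O : Finset ℕ} {D D' : Net ℕ} (h : D = D') : R E O D D' := h ▸ R.refl O D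

lemma R.symm {O : Finset ℕ} {D D' : Net ℕ} (h : R E O D D') : R E O D' D := by
  refine ⟨h.1.symm, fun ha => ?_⟩
  obtain ⟨Y, N, e, Y', N', e', h1, h2, h3, h4, h5⟩ := h.2 (h.1.2 ha)
  exact ⟨Y', N', e', Y, N, e, h2, h1, h4, h3, h5.symm⟩

lemma R.trans {O : Finset ℕ} {D D' D'' : Net ℕ} (h : R E O D D') (h' : R E O D' D'') :
    R E O D D'' := by
  refine ⟨h.1.trans h'.1, fun ha => ?_⟩
  obtain ⟨Y, N, e, Y', N', e', h1, h2, h3, h4, h5⟩ := h.2 ha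
  obtain ⟨X, M, f, hX, hf⟩ := exists_expand O D''
  exact ⟨Y, N, e, X, M, f, h1, hX, h3, hf,
    h5.trans (h'.derivable (h.1.1 ha) h2 hX h4 hf)⟩

end

/-! ### Substitution and use in context -/

section
variable {E : Set Equation}

lemma greens_erase {X : Finset ℕ} {x : ℕ} (hx : x ∈ X) (S : ℕ → Multiset ℕ) :
    greens X S = {spider .green 0 (S x)} + greens (X.erase x) S := by
  conv_lhs => rw [← Finset.insert_erase hx]
  exact greens_insert (Finset.notMem_erase x X) S

/-- The vertices in `O` are fused one by one into those in `Y` along the wires `c x`. As `g` need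
not be injective, several may end in the same vertex. The induction leaves `T` free because it has
to hold the connecting wire of the vertex that is fused last. -/
lemma derivable_fuse_greens {K : Net ℕ} {Y O : Finset ℕ} {g c : ℕ → ℕ} {F T : ℕ → Multiset ℕ}
    (hg : ∀ x ∈ O, g x ∈ Y)
    (hd : Net.IsDiagram (K + greens Y (fun y => T y + ∑ x ∈ O, if g x = y then {c x} else 0) +
      greens O fun x => c x ::ₘ F x)) :
    Derivable E (K + greens Y (fun y => T y + ∑ x ∈ O, if g x = y then {c x} else 0) +
        greens O fun x => c x ::ₘ F x)
      (K + greens Y fun y => T y + ∑ x ∈ O, if g x = y then F x else 0) ∧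
    Net.IsDiagram (K + greens Y fun y => T y + ∑ x ∈ O, if g x = y then F x else 0) := by
  induction O using Finset.induction_on generalizing K T with
  | empty =>
    have e : greens ∅ (fun x => c x ::ₘ F x) = 0 := rfl
    simp only [Finset.sum_empty, e, add_zero] at hd ⊢
    exact ⟨.refl _, hd⟩
  | insert a O ha ih =>
    simp only [Finset.sum_insert ha, greens_insert ha, ← add_assoc] at hd ⊢
    have e : ∀ A B : Net ℕ, K + A + {spider .green 0 (c a ::ₘ F a)} + B =
        K + {spider .green 0 (c a ::ₘ F a)} + A + B := fun A B => by abel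
    rw [e] at hd ⊢
    obtain ⟨h1, h2⟩ := ih (T := fun y => T y + if g a = y then {c a} else 0)
      (fun x hx => hg x (Finset.mem_insert_of_mem hx)) hd
    have hY := hg a (Finset.mem_insert_self a O)
    have e1 : (K + {spider .green 0 (c a ::ₘ F a)} + greens Y fun y =>
        (T y + if g a = y then {c a} else 0) + ∑ x ∈ O, if g x = y then F x else 0) =
        {spider .green 0 (c a ::ₘ F a), spider .green 0 (c a ::ₘ (T (g a) +
          ∑ x ∈ O, if g x = g a then F x else 0))} + (K + greens (Y.erase (g a)) fun y =>
        T y + ∑ x ∈ O, if g x = y then F x else 0) := by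
      rw [greens_erase hY, greens_congr (X := Y.erase (g a))
        (T := fun y => T y + ∑ x ∈ O, if g x = y then F x else 0)]
      · simp only [if_true, Multiset.insert_eq_cons, ← Multiset.singleton_add]
        rw [show T (g a) + {c a} + (∑ x ∈ O, if g x = g a then F x else 0) =
          {c a} + (T (g a) + ∑ x ∈ O, if g x = g a then F x else 0) by abel]
        abel
      · intro y hy
        rw [if_neg (Finset.ne_of_mem_erase hy).symm, add_zero]
    have e2 : (K + greens Y fun y => T y + (if g a = y then F a else 0) +
          ∑ x ∈ O, if g x = y then F x else 0) =
        {spider .green (0 + 0) (F a + (T (g a) + ∑ x ∈ O, if g x = g a then F x else 0))} +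
        (K + greens (Y.erase (g a)) fun y => T y + ∑ x ∈ O, if g x = y then F x else 0) := by
      rw [greens_erase hY, greens_congr (X := Y.erase (g a))
        (T := fun y => T y + ∑ x ∈ O, if g x = y then F x else 0)]
      · simp only [if_true, add_zero]
        rw [show T (g a) + F a + (∑ x ∈ O, if g x = g a then F x else 0) =
          F a + (T (g a) + ∑ x ∈ O, if g x = g a then F x else 0) by abel]
        abel
      · intro y hy
        rw [if_neg (Finset.ne_of_mem_erase hy).symm, add_zero]
    rw [e1] at h1 h2
    rw [e2]
    refine ⟨h1.trans (derivable_fuse h2), isDiagram_of_wires_le h2 ?_ ?_⟩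
    · simp only [wires_add, wires_insert, wires_singleton, spider_legs]
      gcongr <;> exact Multiset.le_cons_self _ _
    · have := (isDiagram_iff.1 h2).2
      simp_all

lemma filter_comp_eq {X : Finset ℕ} {L : Multiset ℕ} {f g : ℕ → ℕ} (h : ∀ w ∈ L, f w ∈ X) (y : ℕ) :
    L.filter (fun w => g (f w) = y) = ∑ x ∈ X, if g x = y then L.filter (f · = x) else 0 := by
  ext w
  rw [Multiset.count_sum', Multiset.count_filter]
  have : ∀ x ∈ X, Multiset.count w (if g x = y then L.filter (f · = x) else 0) =
      if f w = x then (if g x = y then L.count w else 0) else 0 := by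
    intro x _
    split_ifs <;> simp_all
  rw [Finset.sum_congr rfl this, Finset.sum_ite_eq]
  by_cases hw : w ∈ L
  · simp [h w hw]
  · simp [Multiset.count_eq_zero.2 hw]

/-- The expansion of `D.rename g + C` is obtained by gluing the expansion of `D` to a diagram that
does not depend on `D`. -/
lemma derivable_glue {X X' Z O O' : Finset ℕ} {D M N : Net ℕ} {f e g c : ℕ → ℕ}
    (hO : O ⊆ X) (hX : ∀ x ∈ X, g x ∈ X') (hO' : O' ⊆ X')
    (hM : IsExpansion X D M f) (ha : HasArity D) (haN : HasArity N)
    (hN' : ∀ w ∈ wires N, e w ∈ X')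
    (hnodup : (wires M + wires N + O.val.map c + O'.val).Nodup)
    (hZ : Z = (X \ O).image g)
    (hfresh : ∀ x ∈ X, x ∉ O → (∀ w ∈ wires N, e w ≠ g x) ∧ g x ∉ O' ∧
      ∀ y ∈ X, g y = g x → y = x) :
    Derivable E ((expand X O M f).rename (fun x => if x ∈ O then c x else x) +
        (N + greens (X' \ Z) fun y => star O' e (wires N) y +
          ∑ x ∈ O, if g x = y then {c x} else 0))
      (expand X' O' (M + N) fun w => if w ∈ wires M then g (f w) else e w) ∧
    ((expand X O M f).rename (fun x => if x ∈ O then c x else x) +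
        (N + greens (X' \ Z) fun y => star O' e (wires N) y +
          ∑ x ∈ O, if g x = y then {c x} else 0)).IsDiagram := by
  have hMO : ∀ w ∈ wires M, w ∉ O := fun w hw h => hM.notMem w hw (hO h)
  have hMN : ∀ w ∈ wires N, w ∉ wires M := by
    have := (Multiset.nodup_add.1 (Multiset.nodup_add.1 (Multiset.nodup_add.1 hnodup).1).1).2.2
    exact fun w hw hw' => Multiset.disjoint_left.1 this hw' hw
  -- By freshness, no open variable has the same image as a hidden one.
  have hgO : ∀ x ∈ O, g x ∈ X' \ Z := by
    intro x hx
    rw [Finset.mem_sdiff, hZ, Finset.mem_image]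
    refine ⟨hX x (hO hx), ?_⟩
    rintro ⟨y, hy, hyx⟩
    rw [Finset.mem_sdiff] at hy
    exact hy.2 (((hfresh y hy.1 hy.2).2.2 x (hO hx) hyx.symm) ▸ hx)
  have hZX : Z ⊆ X' := by
    rw [hZ]
    intro y hy
    obtain ⟨x, hx, rfl⟩ := Finset.mem_image.1 hy
    exact hX x (Finset.mem_sdiff.1 hx).1
  -- the renamed expansion of `D`
  have e1 : (expand X O M f).rename (fun x => if x ∈ O then c x else x) =
      M + greens (X \ O) (fun x => (wires M).filter (f · = x)) +
        greens O (fun x => c x ::ₘ (wires M).filter (f · = x)) := by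
    have hid : ∀ x, ((wires M).filter (f · = x)).map (fun x => if x ∈ O then c x else x) =
        (wires M).filter (f · = x) := fun x => by
      conv_rhs => rw [← Multiset.map_id ((wires M).filter (f · = x))]
      exact Multiset.map_congr rfl fun w hw => if_neg (hMO w (Multiset.mem_of_mem_filter hw))
    rw [expand, rename_add, rename_eq_self (D := M) fun w hw => if_neg (hMO w hw), rename_greens,
      ← Finset.sdiff_union_of_subset hO, greens_union Finset.sdiff_disjoint,
      Finset.sdiff_union_of_subset hO, add_assoc]
    congr 2
    · refine greens_congr fun x hx => ?_
      rw [star, if_neg (Finset.mem_sdiff.1 hx).2, zero_add, hid]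
    · refine greens_congr fun x hx => ?_
      rw [star, if_pos hx, Multiset.map_add, hid]
      simp [hx]
  -- the expansion of the whole
  have hF : ∀ y, star O' (fun w => if w ∈ wires M then g (f w) else e w) (wires (M + N)) y =
      star O' e (wires N) y + (wires M).filter (fun w => g (f w) = y) := by
    intro y
    rw [star, star, wires_add, Multiset.filter_add,
      Multiset.filter_congr (s := wires M) (q := fun w => g (f w) = y) (fun w hw => by simp [hw]),
      Multiset.filter_congr (s := wires N) (q := fun w => e w = y) (fun w hw => by simp [hMN w hw])]
    abel
  have e2 : (expand X' O' (M + N) fun w => if w ∈ wires M then g (f w) else e w) =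
      (M + N + greens (X \ O) (fun x => (wires M).filter (f · = x))) +
      greens (X' \ Z) (fun y => star O' e (wires N) y +
        ∑ x ∈ O, if g x = y then (wires M).filter (f · = x) else 0) := by
    rw [expand, ← Finset.sdiff_union_of_subset hZX, greens_union Finset.sdiff_disjoint,
      Finset.sdiff_union_of_subset hZX]
    -- An element of `Z` is the image of exactly one variable, a hidden one, and carries neither a
    -- leg of `N` nor an open end. Its green vertex is therefore already present in the expansion of
    -- `D`.
    have e3 : greens Z (star O' (fun w => if w ∈ wires M then g (f w) else e w) (wires (M + N))) =
        greens (X \ O) fun x => (wires M).filter (f · = x) := by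
      rw [hZ, greens_image fun x hx y hy h => (hfresh y (Finset.mem_sdiff.1 hy).1
        (Finset.mem_sdiff.1 hy).2).2.2 x (Finset.mem_sdiff.1 hx).1 h]
      refine greens_congr fun x hx => ?_
      obtain ⟨hx1, hx2⟩ := Finset.mem_sdiff.1 hx
      obtain ⟨f1, f2, f3⟩ := hfresh x hx1 hx2
      rw [Function.comp_apply, hF, star, if_neg f2, Multiset.filter_eq_nil.2 f1, zero_add, zero_add]
      exact Multiset.filter_congr fun w hw =>
        ⟨f3 _ (hM.maps w hw), fun h => by rw [h]⟩
    -- Outside `Z`, only open variables of `D` contribute legs from `M`.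
    have e4 : greens (X' \ Z)
        (star O' (fun w => if w ∈ wires M then g (f w) else e w) (wires (M + N))) =
        greens (X' \ Z) (fun y => star O' e (wires N) y +
          ∑ x ∈ O, if g x = y then (wires M).filter (f · = x) else 0) := by
      refine greens_congr fun y hy => ?_
      rw [hF, filter_comp_eq hM.maps]
      congr 1
      refine (Finset.sum_subset hO fun x hx hxO => if_neg ?_).symm
      rintro rfl
      refine (Finset.mem_sdiff.1 hy).2 ?_
      rw [hZ]
      exact Finset.mem_image_of_mem g (Finset.mem_sdiff.2 ⟨hx, hxO⟩)
    rw [e3, e4]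
    abel
  have e5 : M + greens (X \ O) (fun x => (wires M).filter (f · = x)) +
        greens O (fun x => c x ::ₘ (wires M).filter (f · = x)) +
        (N + greens (X' \ Z) fun y => star O' e (wires N) y +
          ∑ x ∈ O, if g x = y then {c x} else 0) =
      (M + N + greens (X \ O) (fun x => (wires M).filter (f · = x))) +
        greens (X' \ Z) (fun y => star O' e (wires N) y +
          ∑ x ∈ O, if g x = y then {c x} else 0) +
        greens O (fun x => c x ::ₘ (wires M).filter (f · = x)) := by abel
  have hd : ((expand X O M f).rename (fun x => if x ∈ O then c x else x) +
        (N + greens (X' \ Z) fun y => star O' e (wires N) y +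
          ∑ x ∈ O, if g x = y then {c x} else 0)).IsDiagram := by
    refine isDiagram_of_nodup hnodup ?_ ?_
    · have l1 : wires ((expand X O M f).rename (fun x => if x ∈ O then c x else x)) =
          wires M + (O.val.map c + wires M) := by
        have hid : (wires M).map (fun x => if x ∈ O then c x else x) = wires M := by
          conv_rhs => rw [← Multiset.map_id (wires M)]
          exact Multiset.map_congr rfl fun w hw => if_neg (hMO w hw)
        rw [wires_rename, wires_expand hO hM, Multiset.map_add, Multiset.map_add, hid]
        congr 2
        exact Multiset.map_congr rfl fun x hx => if_pos hx
      have l2 : ∑ y ∈ X' \ Z, star O' e (wires N) y ≤ O'.val + wires N := by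
        rw [← sum_open_eq hO', ← sum_filter_eq hN', ← Finset.sum_add_distrib,
          sum_filter_eq hN', ← Finset.sum_sdiff hZX]
        exact Multiset.le_add_right _ _
      have l3 : ∑ y ∈ X' \ Z, ∑ x ∈ O, (if g x = y then {c x} else 0 : Multiset ℕ) =
          O.val.map c := by
        rw [Finset.sum_comm, Finset.sum_congr rfl fun x hx => by
          rw [Finset.sum_ite_eq, if_pos (hgO x hx)]]
        have := Multiset.sum_map_singleton (O.val.map c)
        rwa [Multiset.map_map] at this
      rw [wires_add, wires_add, wires_greens, Finset.sum_add_distrib, l1, l3]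
      calc _ ≤ wires M + (O.val.map c + wires M) +
            (wires N + ((O'.val + wires N) + O.val.map c)) := by gcongr
        _ ≤ (wires M + (O.val.map c + wires M) +
            (wires N + ((O'.val + wires N) + O.val.map c))) + O'.val := Multiset.le_add_right _ _
        _ = _ := by abel
    · simp [hasArity_greens, haN, (hasArity_expand hM).2 ha]
  refine ⟨?_, hd⟩
  rw [e1, e5] at hd ⊢
  rw [e2]
  exact (derivable_fuse_greens hgO hd).1

/-- Equations may be instantiated and used inside any larger net, provided that hidden variables
are not captured. -/
lemma R.app {O : Finset ℕ} {D D' : Net ℕ} (h : R E O D D') (g : ℕ → ℕ) (C : Net ℕ)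
    (O' : Finset ℕ)
    (hfresh : ∀ x, (x ∈ wires D ∨ x ∈ wires D') → x ∉ O → g x ∉ wires C ∧ g x ∉ O' ∧
      ∀ y, (y ∈ wires D ∨ y ∈ wires D' ∨ y ∈ O) → g y = g x → y = x) :
    R E O' (D.rename g + C) (D'.rename g + C) := by
  refine ⟨by simp [h.1], fun ha => ?_⟩
  simp only [hasArity_add, hasArity_rename] at ha
  obtain ⟨ha, haC⟩ := ha
  let X : Finset ℕ := O ∪ (wires D + wires D').toFinset
  have hXm : ∀ x, x ∈ X ↔ x ∈ O ∨ x ∈ wires D ∨ x ∈ wires D' := by simp [X]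
  let X' : Finset ℕ := X.image g ∪ (wires C).toFinset ∪ O'
  obtain ⟨M, f, hM, hMB⟩ := exists_isExpansion (X := X) (X ∪ X') (D := D)
    fun w hw => (hXm w).2 (.inr (.inl hw))
  obtain ⟨M', f', hM', hMB'⟩ := exists_isExpansion (X := X) (X ∪ X') (D := D')
    fun w hw => (hXm w).2 (.inr (.inr hw))
  obtain ⟨N, e, hN, hNB⟩ := exists_isExpansion (X := X')
    ((wires M + wires M').toFinset) (D := C) fun w hw => by simp [X', hw]
  -- The open end `x` of the inner diagram will be joined to the context by the wire `x + b`; beyond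
  -- the bound `b` these wires meet neither legs nor the open ends in `O'`.
  obtain ⟨b, hb⟩ : ∃ b, ∀ w, w ∈ (wires M + wires M' + wires N + O'.val).toFinset → w < b :=
    ⟨(wires M + wires M' + wires N + O'.val).toFinset.sup id + 1,
      fun w hw => Nat.lt_succ_of_le (Finset.le_sup (f := id) hw)⟩
  simp only [Multiset.mem_toFinset, Multiset.mem_add, Finset.mem_val] at hb
  simp only [Multiset.mem_toFinset, Multiset.mem_add] at hNB
  have hO : O ⊆ X := Finset.subset_union_left
  have hX : ∀ x ∈ X, g x ∈ X' := fun x hx =>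
    Finset.mem_union_left _ (Finset.mem_union_left _ (Finset.mem_image_of_mem g hx))
  have hO' : O' ⊆ X' := Finset.subset_union_right
  have hc : (O.val.map fun x => x + b).Nodup :=
    Multiset.Nodup.map (fun x y h => by simpa using h) O.nodup
  have hfresh' : ∀ x ∈ X, x ∉ O → (∀ w ∈ wires N, e w ≠ g x) ∧ g x ∉ O' ∧
      ∀ y ∈ X, g y = g x → y = x := by
    intro x hx hxO
    obtain ⟨f1, f2, f3⟩ := hfresh x (((hXm x).1 hx).resolve_left hxO) hxO
    refine ⟨fun w hw hwx => f1 ?_, f2, fun y hy => f3 y ?_⟩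
    · rw [← hN.rename_eq, wires_rename, ← hwx]
      exact Multiset.mem_map_of_mem e hw
    · have := (hXm y).1 hy
      tauto
  have nd : ∀ M'' : Net ℕ, (wires M'').Nodup → (∀ w ∈ wires M'', w ∉ X ∪ X') →
      (∀ w ∈ wires M'', w < b) → (∀ w ∈ wires N, w ∉ wires M'') →
      (wires M'' + wires N + (O.val.map fun x => x + b) + O'.val).Nodup := by
    intro M'' h1 h2 h3 h4
    refine Multiset.nodup_add.2 ⟨Multiset.nodup_add.2 ⟨Multiset.nodup_add.2 ⟨h1, hN.nodup, ?_⟩,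
      hc, ?_⟩, O'.nodup, ?_⟩
    · exact Multiset.disjoint_right.2 fun hw => h4 _ hw
    · refine Multiset.disjoint_left.2 fun {w} hw hw' => ?_
      obtain ⟨x, -, rfl⟩ := Multiset.mem_map.1 hw'
      rcases Multiset.mem_add.1 hw with hw | hw
      · have := h3 _ hw; omega
      · have := hb _ (.inl (.inr hw)); omega
    · refine Multiset.disjoint_left.2 fun {w} hw hw' => ?_
      rw [Multiset.mem_add, Multiset.mem_add] at hw
      rcases hw with (hw | hw) | hw
      · exact h2 w hw (Finset.mem_union_right _ (hO' hw'))
      · exact hN.notMem w hw (hO' hw')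
      · obtain ⟨x, -, rfl⟩ := Multiset.mem_map.1 hw
        have := hb _ (.inr hw')
        omega
  have haN : HasArity N := by
    rw [← hN.rename_eq] at haC
    simpa using haC
  have exp : ∀ D'' M'' f'', IsExpansion X D'' M'' f'' → (∀ w ∈ wires M'', w ∉ X ∪ X') →
      (∀ w ∈ wires N, w ∉ wires M'') → IsExpansion X' (D''.rename g + C) (M'' + N)
        fun w => if w ∈ wires M'' then g (f'' w) else e w := by
    intro D'' M'' f'' h1 h2 h3
    refine ⟨?_, ?_, ?_, ?_⟩
    · rw [wires_add]
      exact Multiset.nodup_add.2 ⟨h1.nodup, hN.nodup, Multiset.disjoint_right.2 fun hw => h3 _ hw⟩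
    · intro w hw
      rw [wires_add, Multiset.mem_add] at hw
      exact hw.elim (fun hw hx => h2 w hw (Finset.mem_union_right _ hx)) (hN.notMem w)
    · intro w hw
      rw [wires_add, Multiset.mem_add] at hw
      by_cases hm : w ∈ wires M''
      · rw [if_pos hm]
        exact hX _ (h1.maps w hm)
      · rw [if_neg hm]
        exact hN.maps w (hw.resolve_left hm)
    · rw [rename_add, rename_congr (D := M'') (g := g ∘ f'') fun w hw => by simp [hw],
        rename_congr (D := N) (g := e) fun w hw => by simp [h3 w hw], ← rename_rename,
        h1.rename_eq, hN.rename_eq]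
  have hNM : ∀ w ∈ wires N, w ∉ wires M := fun w hw hw' => hNB w hw (.inl hw')
  have hNM' : ∀ w ∈ wires N, w ∉ wires M' := fun w hw hw' => hNB w hw (.inr hw')
  obtain ⟨g1, g2⟩ := derivable_glue (E := E) (c := fun x => x + b) (Z := (X \ O).image g) hO hX hO'
    hM ha haN hN.maps (nd M hM.nodup hMB (fun w hw => hb w (.inl (.inl (.inl hw)))) hNM) rfl hfresh'
  obtain ⟨g1', g2'⟩ := derivable_glue (E := E) (c := fun x => x + b) (Z := (X \ O).image g) hO hX
    hO' hM' (h.1.1 ha) haN hN.maps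
    (nd M' hM'.nodup hMB' (fun w hw => hb w (.inl (.inl (.inr hw)))) hNM') rfl hfresh'
  refine ⟨X', _, _, X', _, _, hO', hO', exp D M f hM hMB hNM, exp D' M' f' hM' hMB' hNM', ?_⟩
  refine g1.symm.trans (Derivable.trans ?_ g1')
  -- The two glued diagrams share their context. What differs is the expansion of `D` or `D'` with
  -- its open ends shifted by `b`, so the hypothesis applies after renaming.
  refine .context _ (derivable_rename (h.derivable ha hO hO hM hM') ?_) g2 g2'
  intro x hx y hy hxy
  have hmem : ∀ x, x ∈ wires (expand X O M f) ∨ x ∈ wires (expand X O M' f') → x ∈ O ∨ x < b := by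
    intro x hx
    rw [wires_expand hO hM, wires_expand hO hM'] at hx
    simp only [Multiset.mem_add, Finset.mem_val] at hx
    have h1 := hb x
    tauto
  have h1 := hmem x hx
  have h2 := hmem y hy
  simp only at hxy
  split_ifs at hxy with h3 h4 h4
  · omega
  · have := h2.resolve_left h4; omega
  · have := h1.resolve_left h3; omega
  · exact hxy

end

/-! ### Diagrams and their expansions; identification of variables -/

section
variable {E : Set Equation}

lemma count_map_sub {a b : ℕ} (hab : a ≠ b) (L : Multiset ℕ) (z : ℕ) :
    (L.map (sub a b)).count z =
      if z = b then L.count a + L.count b else if z = a then 0 else L.count z := by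
  induction L using Multiset.induction_on with
  | empty => simp
  | cons w L ih =>
    rw [Multiset.map_cons, Multiset.count_cons, ih]
    simp only [Multiset.count_cons]
    by_cases hw : w = a
    · subst hw
      simp only [sub_self]
      split_ifs <;> simp_all
      omega
    · rw [sub_of_ne hw]
      split_ifs <;> simp_all
      omega

lemma isDiagram_rename_sub {D : Net ℕ} {a b : ℕ} (hd : D.IsDiagram) (hab : a ≠ b)
    (hc : (wires D).count a + (wires D).count b ≤ 2) : (D.rename (sub a b)).IsDiagram := by
  refine isDiagram_iff.2 ⟨fun z => ?_, by simpa using (isDiagram_iff.1 hd).2⟩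
  rw [wires_rename, count_map_sub hab]
  have := (isDiagram_iff.1 hd).1 z
  split_ifs <;> omega

lemma derivable_unit {c : Colour} {x y : ℕ} {C : Net ℕ}
    (h : Net.IsDiagram (C + {spider c 0 {x, y}})) :
    Derivable E (C + {spider c 0 {x, y}}) (C + {line x y}) ∧
      Net.IsDiagram (C + {line x y}) := by
  have h' : Net.IsDiagram (C + {line x y}) := isDiagram_of_wires_le h (by simp) (by
    have := (isDiagram_iff.1 h).2
    simp_all)
  refine ⟨?_, h'⟩
  rw [add_comm C, add_comm C] at *
  exact derivable_ax C (.unit c x y) h h'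

lemma derivable_scalar {c : Colour} {C : Net ℕ} (h : C.IsDiagram) :
    Derivable E (C + {spider c 0 0}) C := by
  have := derivable_ax (E := E) C (.scalar c 0 (by
      rw [ang]
      exact Real.Angle.pi_ne_zero.symm)) (isDiagram_of_wires_le h (by simp) (by
        simpa using (isDiagram_iff.1 h).2)) (by simpa using h)
  rwa [add_comm, zero_add] at this

/-- A diagram is derivably equal to its expansion. -/
lemma derivable_expand_self {X O : Finset ℕ} {D M : Net ℕ} {f : ℕ → ℕ} (hD : D.IsDiagram)
    (hO : ∀ x, x ∈ O ↔ (wires D).count x = 1) (h : IsExpansion X D M f) :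
    Derivable E (expand X O M f) D := by
  classical
  have hOX : O ⊆ X := fun x hx => h.wires_subset x (Multiset.count_pos.1 (by
    rw [(hO x).1 hx]; exact one_pos))
  set S := star O f (wires M) with hS
  -- `Y` is the set of variables whose green vertices have already been removed; their legs carry
  -- the name of the variable itself.
  let gY : Finset ℕ → ℕ → ℕ := fun Y w => if f w ∈ Y then f w else w
  have hMX : ∀ w ∈ wires M, ∀ y ∈ X, w ≠ y := fun w hw y hy e => h.notMem w hw (e ▸ hy)
  have key : ∀ Y ⊆ X, Derivable E (expand X O M f) (M.rename (gY Y) + greens (X \ Y) S) ∧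
      (M.rename (gY Y) + greens (X \ Y) S).IsDiagram := by
    intro Y
    induction Y using Finset.induction_on with
    | empty =>
      intro _
      have : M.rename (gY ∅) + greens (X \ ∅) S = expand X O M f := by
        rw [rename_eq_self fun w _ => by simp [gY], Finset.sdiff_empty]
        rfl
      rw [this]
      exact ⟨.refl _, isDiagram_expand hOX h (isDiagram_iff.1 hD).2⟩
    | insert x Y hx ih =>
      intro hY
      obtain ⟨hxX, hYX⟩ := Finset.insert_subset_iff.1 hY
      obtain ⟨ih1, ih2⟩ := ih hYX
      set K := M.rename (gY Y) + greens ((X \ Y).erase x) S with hK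
      set N := M.rename (gY (insert x Y)) + greens (X \ insert x Y) S with hN
      have e1 : M.rename (gY Y) + greens (X \ Y) S = K + {spider .green 0 (S x)} := by
        rw [greens_erase (Finset.mem_sdiff.2 ⟨hxX, hx⟩), hK]
        abel
      rw [e1] at ih1 ih2
      have hKd : K.IsDiagram := isDiagram_of_le ih2 (Multiset.le_add_right _ _)
      set F := (wires M).filter (f · = x) with hF
      have hFm : ∀ w, w ∈ F ↔ w ∈ wires M ∧ f w = x := fun w => Multiset.mem_filter
      have hSx : S x = (if x ∈ O then {x} else 0) + F := rfl
      have hcard : F.card = (wires D).count x := by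
        rw [← h.rename_eq, wires_rename, Multiset.count_map, hF]
        simp only [eq_comm]
      have hρ : ∀ ρ : ℕ → ℕ, (∀ w ∈ F, ρ w = x) → (∀ z, z ∉ F → ρ z = z) → K.rename ρ = N := by
        intro ρ h1 h2
        rw [hK, hN, rename_add, rename_rename, rename_greens]
        congr 1
        · refine rename_congr fun w hw => ?_
          simp only [Function.comp_apply, gY, Finset.mem_insert]
          by_cases hwY : f w ∈ Y
          · simp only [hwY, or_true, if_true]
            exact h2 _ fun hf => hMX _ ((hFm _).1 hf).1 _ (hYX hwY) rfl
          · by_cases hwx : f w = x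
            · simp only [hwx, hx, if_false, true_or, if_true]
              exact h1 w ((hFm w).2 ⟨hw, hwx⟩)
            · simp only [hwY, hwx, if_false, or_self]
              exact h2 w fun hf => hwx ((hFm w).1 hf).2
        · rw [← Finset.sdiff_insert]
          refine greens_congr fun y hy => ?_
          have hyx : y ≠ x := fun e => by simp [e] at hy
          have hyX : y ∈ X := (Finset.mem_sdiff.1 hy).1
          conv_rhs => rw [← Multiset.map_id (S y)]
          refine Multiset.map_congr rfl fun w hw => h2 w fun hf => ?_
          obtain ⟨hf1, hf2⟩ := (hFm w).1 hf
          rw [hS, star, Multiset.mem_add, Multiset.mem_filter] at hw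
          rcases hw with hw | hw
          · split_ifs at hw
            · exact hMX w hf1 y hyX (by simpa using hw)
            · simp at hw
          · exact hyx (hw.2.symm.trans hf2)
      have hcountF : ∀ z ∈ F, (wires K).count z = 1 := by
        intro z hz
        obtain ⟨hz1, hz2⟩ := (hFm z).1 hz
        rw [hK, wires_add, wires_rename, wires_greens, Multiset.count_add, Multiset.count_sum',
          Finset.sum_eq_zero, add_zero, Multiset.count_map,
          Multiset.filter_congr (q := fun w => z = w), ← Multiset.count_eq_card_filter_eq,
          Multiset.count_eq_one_of_mem h.nodup hz1]
        · intro w hw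
          simp only [gY]
          split_ifs with hwY
          · refine ⟨fun e => absurd e (hMX z hz1 _ (hYX hwY)), ?_⟩
            rintro rfl
            exact absurd (hz2 ▸ hwY) hx
          · rfl
        · intro y hy
          obtain ⟨hyx, hyX⟩ := Finset.mem_erase.1 hy
          refine Multiset.count_eq_zero.2 fun hw => ?_
          rw [hS, star, Multiset.mem_add, Multiset.mem_filter] at hw
          rcases hw with hw | hw
          · split_ifs at hw
            · exact hMX z hz1 y (Finset.mem_sdiff.1 hyX).1 (by simpa using hw)
            · simp at hw
          · exact hyx (hw.2.symm.trans hz2)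
      have hxK : x ∉ wires K := by
        rw [hK, wires_add, wires_rename, wires_greens, Multiset.mem_add, Multiset.mem_map,
          Multiset.mem_sum]
        rintro (⟨w, hw, e⟩ | ⟨y, hy, hw⟩)
        · simp only [gY] at e
          split_ifs at e with hwY
          · exact hx (e ▸ hwY)
          · exact hMX w hw x hxX e
        · rw [hS, star, Multiset.mem_add, Multiset.mem_filter] at hw
          rcases hw with hw | hw
          · split_ifs at hw
            · exact (Finset.mem_erase.1 hy).1 (Multiset.mem_singleton.1 hw).symm
            · simp at hw
          · exact hMX x hw.1 x hxX rfl
      have h2 := (isDiagram_iff.1 hD).1 x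
      -- In a diagram a variable has at most two legs. Without legs its green vertex is a scalar;
      -- with one leg the variable is an open end, with two it is an inner wire, and in both cases
      -- its green vertex has two legs and is a plain wire.
      have hcases : F.card = 0 ∨ F.card = 1 ∨ F.card = 2 := by omega
      rcases hcases with h0 | h0 | h0
      · have hxO : x ∉ O := fun hxO => by
          have := (hO x).1 hxO
          omega
        rw [Multiset.card_eq_zero] at h0
        have e : K = N := by
          rw [← hρ id (by simp [h0]) (by simp)]
          exact (rename_eq_self (by simp)).symm
        rw [hSx, if_neg hxO, h0, add_zero] at ih1
        rw [e] at ih1 hKd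
        exact ⟨ih1.trans (derivable_scalar hKd), hKd⟩
      · have hxO : x ∈ O := (hO x).2 (by omega)
        obtain ⟨w, hw⟩ := Multiset.card_eq_one.1 h0
        have hwF : w ∈ F := by simp [hw]
        have hwx : w ≠ x := hMX w ((hFm w).1 hwF).1 x hxX
        have e : S x = {w, x} := by
          rw [hSx, if_pos hxO, hw, Multiset.pair_comm]
          rfl
        rw [e] at ih1 ih2
        have hc := hcountF w hwF
        obtain ⟨u1, u2⟩ := derivable_unit (E := E) ih2
        have e2 : K.rename (sub w x) = N := hρ _ (by simp [hw]) fun z hz =>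
          sub_of_ne fun e => hz (e ▸ hwF)
        rw [← e2]
        refine ⟨ih1.trans (u1.trans (derivable_merge u2 hc)), isDiagram_rename_sub hKd hwx ?_⟩
        rw [hc, Multiset.count_eq_zero.2 hxK]
        omega
      · have hxO : x ∉ O := fun hxO => by
          have := (hO x).1 hxO
          omega
        obtain ⟨w, w', hw⟩ := Multiset.card_eq_two.1 h0
        have hwF : w ∈ F := by simp [hw]
        have hwF' : w' ∈ F := by simp [hw]
        have hww : w ≠ w' := by
          have : F.Nodup := h.nodup.filter _
          rw [hw] at this
          simpa using this
        have hwx : w' ≠ x := hMX w' ((hFm w').1 hwF').1 x hxX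
        rw [hSx, if_neg hxO, zero_add, hw] at ih1 ih2
        have hc := hcountF w hwF
        have hc' := hcountF w' hwF'
        obtain ⟨u1, u2⟩ := derivable_unit (E := E) ih2
        have hd2 := isDiagram_rename_sub hKd hww (by omega)
        have hx0 := Multiset.count_eq_zero.2 hxK
        have hwx' : w ≠ x := hMX w ((hFm w).1 hwF).1 x hxX
        have hxc : (wires (K.rename (sub w w'))).count x = 0 := by
          rw [wires_rename, count_map_sub hww, if_neg hwx.symm, if_neg hwx'.symm, hx0]
        have hwc : (wires (K.rename (sub w w'))).count w' = 2 := by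
          rw [wires_rename, count_map_sub hww, if_pos rfl, hc, hc']
        -- Joining the two legs leaves an inner wire named `w'`, which still has to get its name `x`
        -- in `D`.
        have u3 := derivable_rename_sub (E := E) hd2 hwc (Multiset.count_eq_zero.1 hxc)
        have e2 : (K.rename (sub w w')).rename (sub w' x) = N := by
          rw [rename_rename]
          refine hρ _ (fun z hz => ?_) fun z hz => ?_
          · have : z = w ∨ z = w' := by simpa [hw] using hz
            rcases this with rfl | rfl
            · simp
            · simp [sub_of_ne hww.symm]
          · have h1 : z ≠ w := fun e => hz (e ▸ hwF)
            have h2 : z ≠ w' := fun e => hz (e ▸ hwF')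
            simp [sub_of_ne h1, sub_of_ne h2]
        rw [← e2]
        exact ⟨ih1.trans (u1.trans ((derivable_merge u2 hc).trans u3)),
          isDiagram_rename_sub hd2 hwx (by omega)⟩
  have := (key X subset_rfl).1
  rwa [Finset.sdiff_self, show greens ∅ S = 0 from rfl, add_zero,
    rename_congr (g := f) fun w hw => by simp [gY, h.maps w hw], h.rename_eq] at this

/-- For diagrams, `R` is derivability. -/
lemma R_iff_derivable {O : Finset ℕ} {D D' : Net ℕ} (hD : D.IsDiagram) (hD' : D'.IsDiagram)
    (hO : ∀ x, x ∈ O ↔ (wires D).count x = 1) (hO' : ∀ x, x ∈ O ↔ (wires D').count x = 1) :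
    R E O D D' ↔ Derivable E D D' := by
  have ha := (isDiagram_iff.1 hD).2
  have ha' := (isDiagram_iff.1 hD').2
  obtain ⟨X, M, f, hX, h⟩ := exists_expand O D
  obtain ⟨X', M', f', hX', h'⟩ := exists_expand O D'
  have s := derivable_expand_self (E := E) hD hO h
  have s' := derivable_expand_self (E := E) hD' hO' h'
  refine ⟨fun hR => s.symm.trans ((hR.derivable ha hX hX' h h').trans s'), fun hd => ?_⟩
  exact ⟨iff_of_true ha ha', fun _ => ⟨X, M, f, X', M', f', hX, hX', h, h',
    s.trans (hd.trans s'.symm)⟩⟩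

/-- A piece of wire identifies two variables. -/
lemma R.line {O : Finset ℕ} {s x : ℕ} (hs : s ∉ O) (hsx : s ≠ x) (C : Net ℕ) :
    R E O ({line s x} + C) (C.rename (sub s x)) := by
  refine ⟨by simp, fun ha => ?_⟩
  have haC : HasArity C := (hasArity_add.1 ha).2
  let X : Finset ℕ := O ∪ {s, x} ∪ (wires C).toFinset
  have hOX : O ⊆ X := fun y hy => by simp [X, hy]
  have hsX : s ∈ X := by simp [X]
  have hxX : x ∈ X := by simp [X]
  obtain ⟨M, f, hM, -⟩ := exists_isExpansion (X := X) ∅ (D := C) fun w hw => by simp [X, hw]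
  obtain ⟨w, hw⟩ := Infinite.exists_notMem_finset (X ∪ (wires M).toFinset)
  obtain ⟨w', hw'⟩ := Infinite.exists_notMem_finset (insert w (X ∪ (wires M).toFinset))
  simp only [Finset.mem_union, Finset.mem_insert, Multiset.mem_toFinset, not_or] at hw hw'
  obtain ⟨hwX, hwM⟩ := hw
  obtain ⟨hww, hwX', hwM'⟩ := hw'
  let F : ℕ → ℕ := fun y => if y = w then s else if y = w' then x else f y
  have hFw : F w = s := by simp [F]
  have hFw' : F w' = x := by simp [F, hww]
  have hFM : ∀ y ∈ wires M, F y = f y := fun y hy => by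
    have h1 : y ≠ w := fun e => hwM (e ▸ hy)
    have h2 : y ≠ w' := fun e => hwM' (e ▸ hy)
    simp [F, h1, h2]
  have hexp : IsExpansion X ({RedGreen.line s x} + C) ({RedGreen.line w w'} + M) F := by
    refine ⟨?_, ?_, ?_, ?_⟩
    · simp [hM.nodup, hwM, hwM', Ne.symm hww]
    · intro y hy
      simp only [wires_add, wires_singleton, line_legs, Multiset.mem_add, Multiset.insert_eq_cons,
        Multiset.mem_cons, Multiset.mem_singleton] at hy
      rcases hy with (rfl | rfl) | hy
      exacts [hwX, hwX', hM.notMem y hy]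
    · intro y hy
      simp only [wires_add, wires_singleton, line_legs, Multiset.mem_add, Multiset.insert_eq_cons,
        Multiset.mem_cons, Multiset.mem_singleton] at hy
      rcases hy with (rfl | rfl) | hy
      · rwa [hFw]
      · rwa [hFw']
      · rw [hFM y hy]; exact hM.maps y hy
    · rw [rename_add, rename_congr hFM, hM.rename_eq]
      simp [hFw, hFw', RedGreen.line]
  have hexp' : IsExpansion X (C.rename (sub s x)) M (sub s x ∘ f) := by
    refine ⟨hM.nodup, hM.notMem, fun y hy => ?_, ?_⟩
    · simp only [Function.comp_apply]
      by_cases e : f y = s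
      · rwa [e, sub_self]
      · rw [sub_of_ne e]; exact hM.maps y hy
    · rw [← rename_rename, hM.rename_eq]
  refine ⟨X, _, _, X, _, _, hOX, hOX, hexp, hexp', ?_⟩
  have hd := isDiagram_expand hOX hexp ha
  have hd' := isDiagram_expand (O := O) hOX hexp' (by simpa using haC)
  set A := (wires M).filter (f · = s) with hA
  set B := star O f (wires M) x with hB
  set G := greens ((X.erase s).erase x) (star O f (wires M)) with hG
  have hxs : x ∈ X.erase s := Finset.mem_erase.2 ⟨hsx.symm, hxX⟩
  have hstar : ∀ y, star O F (wires ({RedGreen.line w w'} + M)) y =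
      (if s = y then {w} else 0) + (if x = y then {w'} else 0) + star O f (wires M) y := by
    intro y
    rw [star, star, wires_add, Multiset.filter_add,
      Multiset.filter_congr (s := wires M) (q := fun z => f z = y) fun z hz => by rw [hFM z hz]]
    simp only [wires_singleton, line_legs, Multiset.insert_eq_cons, ← Multiset.singleton_add,
      Multiset.filter_add, Multiset.filter_singleton, hFw, hFw', Multiset.empty_eq_zero]
    abel
  -- The piece of wire joins the green vertices of `s` and `x`. The vertex of `s` absorbs it, and
  -- then the two vertices fuse along `w'`.
  have e1 : expand X O ({RedGreen.line w w'} + M) F =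
      {⟨.spider .green 0, w ::ₘ A⟩, RedGreen.line w w'} +
        ({spider .green 0 (w' ::ₘ B)} + (M + G)) := by
    rw [expand, greens_erase hsX, greens_erase hxs, hstar, hstar,
      greens_congr (X := (X.erase s).erase x) (T := star O f (wires M))]
    · rw [if_pos rfl, if_neg hsx.symm, if_neg hsx, if_pos rfl, add_zero, zero_add,
        Multiset.singleton_add, Multiset.singleton_add, ← hB, ← hG]
      rw [show star O f (wires M) s = A by rw [star, if_neg hs, zero_add]]
      simp only [Multiset.insert_eq_cons, ← Multiset.singleton_add, spider]
      abel
    · intro y hy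
      obtain ⟨hy1, hy2⟩ := Finset.mem_erase.1 hy
      rw [hstar, if_neg (Finset.ne_of_mem_erase hy2).symm, if_neg hy1.symm, zero_add, zero_add]
  have hstar' : ∀ y, star O (sub s x ∘ f) (wires M) y =
      if y = s then 0 else (if y = x then A else 0) + star O f (wires M) y := by
    intro y
    by_cases hys : y = s
    · subst hys
      rw [if_pos rfl, star, if_neg hs, zero_add, Multiset.filter_eq_nil]
      intro z _
      simp only [Function.comp_apply]
      by_cases e : f z = y
      · rw [e, sub_self]; exact hsx.symm
      · rwa [sub_of_ne e]
    · rw [if_neg hys, star, star, ← add_assoc, add_comm (if y = x then A else 0), add_assoc]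
      congr 1
      ext z
      simp only [Multiset.count_add, Multiset.count_filter, Function.comp_apply, hA]
      by_cases hyx : y = x
      · subst hyx
        by_cases e : f z = s
        · simp [e, hsx]
        · simp [sub_of_ne e, e]
      · by_cases e : f z = s
        · simp [e, hyx, Ne.symm hys, Ne.symm hyx]
        · simp [sub_of_ne e, hyx]
  -- After the substitution no leg belongs to `s`, whose vertex remains as a scalar of phase `0`.
  have e2 : expand X O M (sub s x ∘ f) =
      ({spider .green (0 + 0) (A + B)} + (M + G)) + {spider .green 0 0} := by
    rw [expand, greens_erase hsX, greens_erase hxs, hstar', hstar', if_pos rfl, if_neg hsx.symm,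
      if_pos rfl, greens_congr (X := (X.erase s).erase x) (T := star O f (wires M)), add_zero]
    · abel
    · intro y hy
      obtain ⟨hy1, hy2⟩ := Finset.mem_erase.1 hy
      rw [hstar', if_neg (Finset.ne_of_mem_erase hy2), if_neg hy1, zero_add]
  rw [e1] at hd ⊢
  rw [e2] at hd' ⊢
  have hdm : Net.IsDiagram ({⟨.spider .green 0, w' ::ₘ A⟩} +
      ({spider .green 0 (w' ::ₘ B)} + (M + G))) := by
    refine isDiagram_of_wires_le hd ?_ ?_
    · simp only [wires_add]
      gcongr
      simp only [wires_singleton, line_legs, Multiset.insert_eq_cons,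
        ← Multiset.singleton_add, wires_add]
      rw [show {w} + A + ({w} + {w'}) = {w'} + A + ({w} + {w}) by abel]
      exact Multiset.le_add_right _ _
    · have := (isDiagram_iff.1 hd).2
      simp_all
  refine (derivable_ax _ (.absorb _ w w' A) hd hdm).trans ?_
  refine Derivable.trans ?_ (derivable_scalar (isDiagram_of_le hd' (Multiset.le_add_right _ _))).symm
  have e3 : ({⟨.spider .green 0, w' ::ₘ A⟩} + ({spider .green 0 (w' ::ₘ B)} + (M + G)) : Net ℕ) =
      {spider .green 0 (w' ::ₘ A), spider .green 0 (w' ::ₘ B)} + (M + G) := by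
    simp only [Multiset.insert_eq_cons, ← Multiset.singleton_add, spider]
    abel
  rw [e3] at hdm ⊢
  exact derivable_fuse hdm

end

section
variable {E : Set Equation}

/-! ### Equations between nets with hidden variables -/

/-- The green phase `α` at the variable `x`. -/
noncomputable def Z (α : Real.Angle) (x : ℕ) : Net ℕ := {spider .green α {x}}

/-- The red vertex with one leg. -/
noncomputable def X1 (α : Real.Angle) (x : ℕ) : Net ℕ := {spider .red α {x}}

/-- The red vertex with two legs. -/
noncomputable def X2 (α : Real.Angle) (x y : ℕ) : Net ℕ := {spider .red α {x, y}}

/-- The red vertex of phase `0` with three legs. -/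
noncomputable def X3 (x y z : ℕ) : Net ℕ := {spider .red 0 {x, y, z}}

/-- The net with one `H`. -/
def H (x y : ℕ) : Net ℕ := {had x y}

/-- The net with one piece of wire. -/
def L (x y : ℕ) : Net ℕ := {line x y}

@[simp] lemma wires_Z (α : Real.Angle) (x : ℕ) : wires (Z α x) = {x} := by simp [Z]
@[simp] lemma wires_X1 (α : Real.Angle) (x : ℕ) : wires (X1 α x) = {x} := by simp [X1]
@[simp] lemma wires_X2 (α : Real.Angle) (x y : ℕ) : wires (X2 α x y) = {x, y} := by simp [X2]
@[simp] lemma wires_X3 (x y z : ℕ) : wires (X3 x y z) = {x, y, z} := by simp [X3]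
@[simp] lemma wires_H (x y : ℕ) : wires (H x y) = {x, y} := by simp [H]
@[simp] lemma wires_L (x y : ℕ) : wires (L x y) = {x, y} := by simp [L]

@[simp] lemma hasArity_Z (α : Real.Angle) (x : ℕ) : HasArity (Z α x) := by simp [Z]
@[simp] lemma hasArity_X1 (α : Real.Angle) (x : ℕ) : HasArity (X1 α x) := by simp [X1]
@[simp] lemma hasArity_X2 (α : Real.Angle) (x y : ℕ) : HasArity (X2 α x y) := by simp [X2]
@[simp] lemma hasArity_X3 (x y z : ℕ) : HasArity (X3 x y z) := by simp [X3]
@[simp] lemma hasArity_H (x y : ℕ) : HasArity (H x y) := by simp [H]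
@[simp] lemma hasArity_L (x y : ℕ) : HasArity (L x y) := by simp [L]

@[simp] lemma rename_Z (g : ℕ → ℕ) (α : Real.Angle) (x : ℕ) : (Z α x).rename g = Z α (g x) := by
  simp [Z, spider]
@[simp] lemma rename_X1 (g : ℕ → ℕ) (α : Real.Angle) (x : ℕ) :
    (X1 α x).rename g = X1 α (g x) := by simp [X1, spider]
@[simp] lemma rename_X2 (g : ℕ → ℕ) (α : Real.Angle) (x y : ℕ) :
    (X2 α x y).rename g = X2 α (g x) (g y) := by simp [X2, spider]
@[simp] lemma rename_X3 (g : ℕ → ℕ) (x y z : ℕ) :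
    (X3 x y z).rename g = X3 (g x) (g y) (g z) := by simp [X3, spider]
@[simp] lemma rename_H (g : ℕ → ℕ) (x y : ℕ) : (H x y).rename g = H (g x) (g y) := by
  simp [H, had]
@[simp] lemma rename_L (g : ℕ → ℕ) (x y : ℕ) : (L x y).rename g = L (g x) (g y) := by
  simp [L, line]

lemma X2_comm (α : Real.Angle) (x y : ℕ) : X2 α x y = X2 α y x := by
  rw [X2, Multiset.pair_comm, X2]
lemma H_comm (x y : ℕ) : H x y = H y x := by rw [H, had_comm, H]
lemma L_comm (x y : ℕ) : L x y = L y x := by rw [L, line_comm, L]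

/-- Without hidden variables nothing can be captured, so `g` is arbitrary and may identify
variables. -/
lemma R.open_app {O : Finset ℕ} {D D' : Net ℕ} (h : R E O D D')
    (hD : ∀ x, (x ∈ wires D ∨ x ∈ wires D') → x ∈ O) (g : ℕ → ℕ) (C : Net ℕ) (O' : Finset ℕ) :
    R E O' (D.rename g + C) (D'.rename g + C) :=
  h.app g C O' fun x hx hxO => absurd (hD x hx) hxO

lemma R.hidden_app {O : Finset ℕ} {D D' : Net ℕ} (h : R E O D D') (k : ℕ)
    (hD : ∀ x, (x ∈ wires D ∨ x ∈ wires D') → x ∈ O ∨ x = k) (g : ℕ → ℕ) (C : Net ℕ)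
    (O' : Finset ℕ) (hC : g k ∉ wires C) (hO' : g k ∉ O') (hO : ∀ x ∈ O, g x ≠ g k) :
    R E O' (D.rename g + C) (D'.rename g + C) := by
  refine h.app g C O' fun x hx hxO => ?_
  obtain rfl := (hD x hx).resolve_left hxO
  refine ⟨hC, hO', fun y hy hyx => ?_⟩
  have : y ∈ O ∨ y = x := by
    have := hD y
    tauto
  exact this.resolve_left fun hyO => hO y hyO hyx

/-- The wires in `W` have at most two ends, and the wires with one end are those in `O`. -/
def OpenEnds (W : Multiset ℕ) (O : Finset ℕ) : Prop :=
  (∀ x ∈ W, W.count x ≤ 2) ∧ (∀ x ∈ O, W.count x = 1) ∧ ∀ x ∈ W, W.count x = 1 → x ∈ O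

/-- All quantifiers are bounded, so `decide` settles the condition for concrete wires. -/
instance (W : Multiset ℕ) (O : Finset ℕ) : Decidable (OpenEnds W O) := by
  unfold OpenEnds
  infer_instance

lemma OpenEnds.isDiagram {D : Net ℕ} {W : Multiset ℕ} {O : Finset ℕ} (h : OpenEnds W O)
    (hW : wires D = W) (ha : HasArity D) : D.IsDiagram := by
  refine isDiagram_iff.2 ⟨fun x => ?_, ha⟩
  by_cases hx : x ∈ W
  · exact hW ▸ h.1 x hx
  · rw [hW, Multiset.count_eq_zero.2 hx]
    omega

lemma OpenEnds.mem_iff {D : Net ℕ} {W : Multiset ℕ} {O : Finset ℕ} (h : OpenEnds W O)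
    (hW : wires D = W) (x : ℕ) : x ∈ O ↔ (wires D).count x = 1 := by
  rw [hW]
  exact ⟨h.2.1 x, fun hx => h.2.2 x (Multiset.count_pos.1 (by omega)) hx⟩

lemma R_iff_derivable_of_openEnds {O : Finset ℕ} {D D' : Net ℕ} (W W' : Multiset ℕ)
    (hW : wires D = W) (hW' : wires D' = W') (hD : HasArity D) (hD' : HasArity D')
    (h : OpenEnds W O) (h' : OpenEnds W' O) : R E O D D' ↔ Derivable E D D' :=
  R_iff_derivable (h.isDiagram hW hD) (h'.isDiagram hW' hD') (h.mem_iff hW) (h'.mem_iff hW')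

lemma R.of_ax {O : Finset ℕ} {D D' : Net ℕ} (h : Ax D D') (W W' : Multiset ℕ)
    (hW : wires D = W) (hW' : wires D' = W') (hD : HasArity D) (hD' : HasArity D')
    (ho : OpenEnds W O) (ho' : OpenEnds W' O) : R E O D D' :=
  (R_iff_derivable_of_openEnds W W' hW hW' hD hD' ho ho').2
    (.ax h (ho.isDiagram hW hD) (ho'.isDiagram hW' hD'))

/-- For the basic rules it suffices to compute with one convenient expansion of `D`, when `D'` is a
diagram already. -/
lemma R.of_expand {O X : Finset ℕ} {D D' M : Net ℕ} {f : ℕ → ℕ} (h : IsExpansion X D M f)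
    (hX : O ⊆ X) (hD : HasArity D) (W' : Multiset ℕ) (hW' : wires D' = W') (hD' : HasArity D')
    (ho' : OpenEnds W' O) (hd : (expand X O M f).IsDiagram → Derivable E (expand X O M f) D') :
    R E O D D' := by
  obtain ⟨X', M', f', hX', h'⟩ := exists_expand O D'
  exact ⟨iff_of_true hD hD', fun _ => ⟨X, M, f, X', M', f', hX, hX', h, h',
    (hd (isDiagram_expand hX h hD)).trans (derivable_expand_self (ho'.isDiagram hW' hD')
      (ho'.mem_iff hW') h').symm⟩⟩

lemma derivable_fuse_of_eq {A C : Net ℕ} {c : Colour} {α β : Real.Angle} (hd : A.IsDiagram) (w : ℕ)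
    (S T : Multiset ℕ) {S' T' : Multiset ℕ} (U : Multiset ℕ)
    (hA : A = {spider c α S'} + {spider c β T'} + C)
    (hS : S' = w ::ₘ S) (hT : T' = w ::ₘ T) (hU : S + T = U) :
    Derivable E A ({spider c (α + β) U} + C) ∧ Net.IsDiagram ({spider c (α + β) U} + C) := by
  subst hA hS hT hU
  refine ⟨derivable_fuse hd, isDiagram_of_wires_le hd ?_ ?_⟩
  · simp only [wires_add, wires_singleton, spider_legs]
    gcongr <;> exact Multiset.le_cons_self _ _
  · have := (isDiagram_iff.1 hd).2
    simp_all

lemma greens_singleton (x : ℕ) (S : ℕ → Multiset ℕ) :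
    greens {x} S = {spider .green 0 (S x)} := rfl

/-- An open variable that occurs in no factor is a green vertex with one leg: the constant function
1. -/
lemma R_Z_zero : R E {0} 0 (Z 0 0) :=
  R.of_expand (X := {0}) (M := 0) (f := id) ⟨by simp, by simp, by simp, by simp⟩ (by simp)
    (by simp) _ (wires_Z _ _) (by simp) (by decide) fun _ => derivable_of_eq rfl

lemma R_Z_add (α β : Real.Angle) : R E {0} (Z α 0 + Z β 0) (Z (α + β) 0) := by
  refine R.of_expand (X := {0}) (M := Z α 1 + Z β 2) (f := fun _ => 0)
    ⟨by simp, by simp, by simp, by simp⟩ (by simp) (by simp) _ (wires_Z _ _) (by simp)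
    (by decide) fun hd => ?_
  have e : expand {0} {0} (Z α 1 + Z β 2) (fun _ => 0) =
      Z α 1 + Z β 2 + {spider .green 0 {0, 1, 2}} := by
    rw [expand, greens_singleton, wires_add, wires_Z, wires_Z]
    rfl
  rw [e] at hd ⊢
  obtain ⟨d1, hd1⟩ := derivable_fuse_of_eq (E := E) hd 1 0 {0, 2} {0, 2}
    (show _ = {spider .green α {1}} + {spider .green 0 {0, 1, 2}} + Z β 2 by
      simp only [Z]; abel) (by decide) (by decide) (by decide)
  obtain ⟨d2, hd2⟩ := derivable_fuse_of_eq (E := E) hd1 2 {0} 0 {0} (C := 0)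
    (show _ = {spider .green (α + 0) {0, 2}} + {spider .green β {2}} + 0 by
      simp only [Z]; abel) (by decide) (by decide) (by decide)
  simp only [add_zero] at d1 d2
  exact d1.trans d2

lemma R_Z_hidden {α : Real.Angle} (hα : α ≠ ang Real.pi) : R E ∅ (Z α 0) 0 := by
  refine R.of_expand (X := {0}) (M := Z α 1) (f := fun _ => 0)
    ⟨by simp, by simp, by simp, by simp⟩ (by simp) (by simp) _ wires_zero (by simp)
    (by decide) fun hd => ?_
  have e : expand {0} ∅ (Z α 1) (fun _ => 0) = Z α 1 + {spider .green 0 {1}} := by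
    rw [expand, greens_singleton, wires_Z]
    rfl
  rw [e] at hd ⊢
  obtain ⟨d1, hd1⟩ := derivable_fuse_of_eq (E := E) hd 1 0 0 0 (C := 0)
    (show _ = {spider .green α {1}} + {spider .green 0 {1}} + 0 by
      simp only [Z]; abel) (by decide) (by decide) (by decide)
  rw [add_zero, add_zero] at d1 hd1
  exact d1.trans (.ax (.scalar _ _ hα) hd1 (by simp [isDiagram_iff]))

lemma R_X1_hidden (α : Real.Angle) : R E ∅ (X1 α 0) 0 := by
  refine R.of_expand (X := {0}) (M := X1 α 1) (f := fun _ => 0)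
    ⟨by simp, by simp, by simp, by simp⟩ (by simp) (by simp) _ wires_zero (by simp)
    (by decide) fun hd => ?_
  have e : expand {0} ∅ (X1 α 1) (fun _ => 0) = {spider .red α {1}, spider .green 0 {1}} := by
    rw [expand, greens_singleton, wires_X1]
    rfl
  rw [e] at hd ⊢
  exact .ax (.scalar_zero .red α 1) hd (by simp [isDiagram_iff])

/-- A green vertex with two legs identifies its legs. -/
lemma R_green_two (α : Real.Angle) : R E {0, 1} (Z α 0 + L 0 1) {spider .green α {0, 1}} := by
  refine R.of_expand (X := {0, 1}) (M := Z α 3 + L 4 5) (f := fun n => if n = 5 then 1 else 0)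
    ⟨by simp, by simp, by simp, by simp⟩ (by simp) (by simp) {0, 1} (by simp) (by simp)
    (by decide) fun hd => ?_
  have e : expand {0, 1} {0, 1} (Z α 3 + L 4 5) (fun n => if n = 5 then 1 else 0) =
      Z α 3 + {spider .green 0 {0, 3, 4}} + {spider .green 0 {1, 5}} + {line 4 5} := by
    rw [expand, greens_insert (by simp), greens_singleton, wires_add, wires_Z, wires_L,
      show star {0, 1} (fun n => if n = 5 then 1 else 0) ({3} + {4, 5}) 0 = {0, 3, 4} by decide,
      show star {0, 1} (fun n => if n = 5 then 1 else 0) ({3} + {4, 5}) 1 = {1, 5} by decide, L]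
    abel
  rw [e] at hd ⊢
  have d1 := derivable_merge (E := E) hd (by simp [Z])
  have hd1 := isDiagram_rename_sub (isDiagram_of_le hd (Multiset.le_add_right _ _))
    (by decide : 4 ≠ 5) (by simp [Z])
  have e2 : (Z α 3 + {spider .green 0 {0, 3, 4}} + {spider .green 0 {1, 5}}).rename (sub 4 5) =
      Z α 3 + {spider .green 0 {0, 3, 5}} + {spider .green 0 {1, 5}} := by
    simp [sub, spider]
  rw [e2] at d1 hd1
  obtain ⟨d2, hd2⟩ := derivable_fuse_of_eq (E := E) hd1 5 {0, 3} {1} {0, 1, 3}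
    (show _ = {spider .green 0 {0, 3, 5}} + {spider .green 0 {1, 5}} + Z α 3 by abel)
    (by decide) (by decide) (by decide)
  obtain ⟨d3, hd3⟩ := derivable_fuse_of_eq (E := E) hd2 3 {0, 1} 0 {0, 1} (C := 0)
    (show _ = {spider .green (0 + 0) {0, 1, 3}} + {spider .green α {3}} + 0 by
      simp only [Z]; abel) (by decide) (by decide) (by decide)
  simp only [add_zero, zero_add] at d2 d3
  exact d1.trans (d2.trans d3)

/-- A green vertex with three legs identifies its legs. -/
lemma R_green_three : R E {0, 1, 2} (L 0 1 + L 0 2) {spider .green 0 {0, 1, 2}} := by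
  let f : ℕ → ℕ := fun n => if n = 4 then 1 else if n = 6 then 2 else 0
  refine R.of_expand (X := {0, 1, 2}) (M := L 3 4 + L 5 6) (f := f)
    ⟨by simp, by simp, by simp [f], by simp [f]⟩ (by simp) (by simp) {0, 1, 2} (by simp)
    (by simp) (by decide) fun hd => ?_
  have e : expand {0, 1, 2} {0, 1, 2} (L 3 4 + L 5 6) f =
      {spider .green 0 {0, 3, 5}} + {spider .green 0 {1, 4}} + {spider .green 0 {2, 6}} +
        {line 3 4} + {line 5 6} := by
    rw [expand, greens_insert (by simp), greens_insert (by simp), greens_singleton, wires_add,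
      wires_L, wires_L,
      show star {0, 1, 2} f ({3, 4} + {5, 6}) 0 = {0, 3, 5} by decide,
      show star {0, 1, 2} f ({3, 4} + {5, 6}) 1 = {1, 4} by decide,
      show star {0, 1, 2} f ({3, 4} + {5, 6}) 2 = {2, 6} by decide, L, L]
    abel
  rw [e] at hd ⊢
  have d1 := derivable_merge (E := E) hd (by simp)
  have hd1 := isDiagram_rename_sub (isDiagram_of_le hd (Multiset.le_add_right _ _))
    (by decide : 5 ≠ 6) (by simp)
  have e2 : ({spider .green 0 {0, 3, 5}} + {spider .green 0 {1, 4}} + {spider .green 0 {2, 6}} +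
      {line 3 4} : Net ℕ).rename (sub 5 6) =
      {spider .green 0 {0, 3, 6}} + {spider .green 0 {1, 4}} + {spider .green 0 {2, 6}} +
        {line 3 4} := by
    simp [sub, spider, line]
  rw [e2] at d1 hd1
  have d2 := derivable_merge (E := E) hd1 (by simp)
  have hd2 := isDiagram_rename_sub (isDiagram_of_le hd1 (Multiset.le_add_right _ _))
    (by decide : 3 ≠ 4) (by simp)
  have e3 : ({spider .green 0 {0, 3, 6}} + {spider .green 0 {1, 4}} +
      {spider .green 0 {2, 6}} : Net ℕ).rename (sub 3 4) =
      {spider .green 0 {0, 4, 6}} + {spider .green 0 {1, 4}} + {spider .green 0 {2, 6}} := by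
    simp [sub, spider]
  rw [e3] at d2 hd2
  obtain ⟨d3, hd3⟩ := derivable_fuse_of_eq (E := E) hd2 4 {0, 6} {1} {0, 1, 6} rfl
    (by decide) (by decide) (by decide)
  obtain ⟨d4, -⟩ := derivable_fuse_of_eq (E := E) hd3 6 {0, 1} {2} {0, 1, 2} (C := 0)
    (add_zero _).symm (by decide) (by decide) (by decide)
  simp only [add_zero] at d3 d4
  exact d1.trans (d2.trans (d3.trans d4))

end

/-! ### Rewriting rules for nets with variables -/

section
variable {E : Set Equation} {O : Finset ℕ}

/-- One step of a calculation: the equality `A = A'` reorders the factors so that the next rule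
finds its left-hand side in front. -/
lemma R.step {A A' B D : Net ℕ} (h : R E O A' B) (hA : A = A') (h' : R E O B D) : R E O A D :=
  hA ▸ h.trans h'

/-- The valuation of the variables `0, 1, 2, …` by the entries of a list. -/
def val (l : List ℕ) (n : ℕ) : ℕ := l.getD n 0

@[simp] lemma val_zero (a : ℕ) (l : List ℕ) : val (a :: l) 0 = a := rfl
@[simp] lemma val_one (a b : ℕ) (l : List ℕ) : val (a :: b :: l) 1 = b := rfl
@[simp] lemma val_two (a b c : ℕ) (l : List ℕ) : val (a :: b :: c :: l) 2 = c := rfl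
@[simp] lemma val_three (a b c d : ℕ) (l : List ℕ) : val (a :: b :: c :: d :: l) 3 = d := rfl

lemma R.subst {s x : ℕ} (hs : s ∉ O) (hsx : s ≠ x) {C C' : Net ℕ} (hC : C.rename (sub s x) = C') :
    R E O (L s x + C) C' := hC ▸ R.line hs hsx C

/-- Open ends may be hidden. -/
lemma R.hide {O' : Finset ℕ} {D D' : Net ℕ} (h : R E O D D') (hO : O' ⊆ O) : R E O' D D' := by
  have := h.app id 0 O' fun x _ hx => ⟨by simp, fun hx' => hx (hO hx'), fun y _ hy => hy⟩
  rwa [rename_eq_self (by simp), rename_eq_self (by simp), add_zero, add_zero] at this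

/-! #### Rules for green vertices -/

lemma R.Z_zero (x : ℕ) (C : Net ℕ) : R E O (Z 0 x + C) C := by
  simpa using (R_Z_zero.symm.open_app (by simp) (val [x]) C O)

lemma R.Z_add (α β : Real.Angle) (x : ℕ) (C : Net ℕ) :
    R E O (Z α x + Z β x + C) (Z (α + β) x + C) := by
  simpa using ((R_Z_add α β).open_app (by simp) (val [x]) C O)

lemma R.Z_hidden {α : Real.Angle} (hα : α ≠ ang Real.pi) {x : ℕ} {C : Net ℕ} (hC : x ∉ wires C)
    (hO : x ∉ O) : R E O (Z α x + C) C := by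
  simpa using ((R_Z_hidden hα).hidden_app 0 (by simp) (val [x]) C O hC hO (by simp))

lemma R.X1_hidden (α : Real.Angle) {x : ℕ} {C : Net ℕ} (hC : x ∉ wires C)
    (hO : x ∉ O) : R E O (X1 α x + C) C := by
  simpa using ((R_X1_hidden α).hidden_app 0 (by simp) (val [x]) C O hC hO (by simp))

lemma R.green_two (α : Real.Angle) (x y : ℕ) (C : Net ℕ) :
    R E O ({spider .green α {x, y}} + C) (Z α x + L x y + C) := by
  simpa [spider] using ((R_green_two α).symm.open_app (by simp) (val [x, y]) C O)

lemma R.green_three (x y z : ℕ) (C : Net ℕ) :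
    R E O ({spider .green 0 {x, y, z}} + C) (L x y + L x z + C) := by
  simpa [spider] using (R_green_three.symm.open_app (by simp) (val [x, y, z]) C O)

/-! #### Rules for red vertices -/

lemma R.X1_X1 {α β : Real.Angle} (h : α + β ≠ ang Real.pi) {x : ℕ} {C : Net ℕ} (hC : x ∉ wires C)
    (hO : x ∉ O) : R E O (X1 α x + X1 β x + C) C := by
  have h1 : R E ∅ (X1 α 0 + X1 β 0) {spider .red (α + β) (0 + 0)} :=
    R.of_ax (.fuse .red α β 0 0 0) {0, 0} 0 rfl rfl (by simp) (by simp)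
      (by decide) (by decide)
  have h2 : R E ∅ {spider .red (α + β) 0} 0 :=
    R.of_ax (.scalar .red _ h) 0 0 rfl rfl (by simp) (by simp) (by decide) (by decide)
  simpa using ((h1.trans h2).hidden_app 0 (by simp) (val [x]) C O hC hO (by simp))

lemma R.X1_X2 (α β : Real.Angle) {x y : ℕ} (hxy : y ≠ x) {C : Net ℕ} (hC : x ∉ wires C)
    (hO : x ∉ O) : R E O (X1 α x + X2 β x y + C) (X1 (α + β) y + C) := by
  have h1 : R E {1} (X1 α 0 + X2 β 0 1) (X1 (α + β) 1) :=
    R.of_ax (.fuse .red α β 0 0 {1}) {0, 0, 1} {1} rfl rfl (by simp) (by simp)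
      (by decide) (by decide)
  simpa using (h1.hidden_app 0 (by simp) (val [x, y]) C O hC hO (by simpa using hxy))

lemma R.X1_X3 (α : Real.Angle) {x y z : ℕ} (hxy : y ≠ x) (hxz : z ≠ x) {C : Net ℕ}
    (hC : x ∉ wires C) (hO : x ∉ O) : R E O (X1 α x + X3 x y z + C) (X2 α y z + C) := by
  have h1 : R E {1, 2} (X1 α 0 + X3 0 1 2) (X2 (α + 0) 1 2) :=
    R.of_ax (.fuse .red α 0 0 0 {1, 2}) {0, 0, 1, 2} {1, 2} rfl rfl (by simp) (by simp)
      (by decide) (by decide)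
  simpa using (h1.hidden_app 0 (by simp; omega) (val [x, y, z]) C O hC hO (by simp [hxy, hxz]))

lemma R.X2_X2 (α β : Real.Angle) {x y z : ℕ} (hxy : y ≠ x) (hxz : z ≠ x) {C : Net ℕ}
    (hC : x ∉ wires C) (hO : x ∉ O) :
    R E O (X2 α x y + X2 β x z + C) (X2 (α + β) y z + C) := by
  have h1 : R E {1, 2} (X2 α 0 1 + X2 β 0 2) (X2 (α + β) 1 2) :=
    R.of_ax (.fuse .red α β 0 {1} {2}) {0, 1, 0, 2} {1, 2} rfl rfl (by simp) (by simp)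
      (by decide) (by decide)
  simpa using (h1.hidden_app 0 (by simp) (val [x, y, z]) C O hC hO (by simp [hxy, hxz]))

lemma R.X2_zero (x y : ℕ) (C : Net ℕ) : R E O (X2 0 x y + C) (L x y + C) := by
  have h1 : R E {0, 1} (X2 0 0 1) (L 0 1) :=
    R.of_ax (.unit .red 0 1) {0, 1} {0, 1} rfl rfl (by simp) (by simp)
      (by decide) (by decide)
  simpa using (h1.open_app (by simp) (val [x, y]) C O)

/-! #### Rules for both colours -/

lemma R.Z_X1 (α : Real.Angle) {x : ℕ} {C : Net ℕ} (hC : x ∉ wires C) (hO : x ∉ O) :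
    R E O (Z α x + X1 0 x + C) C := by
  have h1 : R E ∅ (Z α 0 + X1 0 0) 0 :=
    R.of_ax (.scalar_zero .green α 0) {0, 0} 0 rfl rfl (by simp) (by simp)
      (by decide) (by decide)
  simpa using (h1.hidden_app 0 (by simp) (val [x]) C O hC hO (by simp))

lemma R.copy (a b : ℕ) (C : Net ℕ) : R E O (X1 0 a + L a b + C) (X1 0 a + X1 0 b + C) := by
  have h1 : R E {0, 1} (X1 0 2 + {spider .green 0 {2, 0, 1}}) (X1 0 0 + X1 0 1) :=
    R.of_ax (.copy .red 2 0 1) {2, 2, 0, 1} {0, 1} rfl rfl (by simp) (by simp)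
      (by decide) (by decide)
  have h2 : R E {0, 1} (X1 0 0 + L 0 1) (X1 0 0 + X1 0 1) := by
    refine R.step (R.subst (s := 2) (x := 0) (by decide) (by decide) (C := X1 0 2 + L 2 1)
      (by simp [sub])).symm rfl ?_
    refine R.step (R.green_three 2 0 1 (X1 0 2)).symm (by abel) ?_
    exact R.step h1 (by abel) (R.refl _ _)
  simpa using (h2.open_app (by simp) (val [a, b]) C O)

/-- For all values of `y` and `z` exactly one value of `x` satisfies the parity constraint.
Diagrammatically, a green dot is copied by the red vertex, and green dots of phase `0` are trivial
factors. -/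
lemma R.X3_hidden {x y z : ℕ} (hxy : y ≠ x) (hxz : z ≠ x) {C : Net ℕ} (hC : x ∉ wires C)
    (hO : x ∉ O) : R E O (X3 x y z + C) C := by
  have h1 : R E {1, 2} (Z 0 0 + X3 0 1 2) (Z 0 1 + Z 0 2) :=
    R.of_ax (.copy .green 0 1 2) {0, 0, 1, 2} {1, 2} rfl rfl (by simp) (by simp)
      (by decide) (by decide)
  have h2 : R E {1, 2} (X3 0 1 2) 0 := by
    refine R.step (R.Z_zero 0 (X3 0 1 2)).symm rfl (h1.trans ?_)
    refine (R.Z_zero 1 (Z 0 2)).trans ?_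
    exact R.step (R.Z_zero 2 0) (by abel) (R.refl _ _)
  simpa using (h2.hidden_app 0 (by simp) (val [x, y, z]) C O hC hO (by simp [hxy, hxz]))

/-- A red vertex with three legs is a function of two of them. -/
lemma R.bialgebra (a b v w : ℕ) (C : Net ℕ) :
    R E O (X3 a v w + X3 b v w + C) (L a b + X3 a v w + C) := by
  have h1 : R E {0, 1, 2, 3} (X3 0 4 5 + X3 1 6 7 + {spider .green 0 {2, 4, 6}} +
      {spider .green 0 {3, 5, 7}}) ({spider .green 0 {0, 1, 8}} + X3 8 2 3) :=
    R.of_ax (.bialgebra .red 0 1 2 3 4 5 6 7 8) {0, 4, 5, 1, 6, 7, 2, 4, 6, 3, 5, 7}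
      {0, 1, 8, 8, 2, 3} rfl rfl (by simp) (by simp) (by decide) (by decide)
  have h2 : R E {0, 1, 2, 3} (X3 0 2 3 + X3 1 2 3) (L 0 1 + X3 0 2 3) := by
    have l1 : R E {0, 1, 2, 3} (X3 0 2 3 + X3 1 2 3) (X3 0 4 5 + X3 1 6 7 +
        {spider .green 0 {2, 4, 6}} + {spider .green 0 {3, 5, 7}}) := by
      refine R.symm ?_
      refine R.step (R.green_three 2 4 6 (X3 0 4 5 + X3 1 6 7 + {spider .green 0 {3, 5, 7}}))
        (by abel) ?_
      refine R.step (R.green_three 3 5 7 (X3 0 4 5 + X3 1 6 7 + L 2 4 + L 2 6)) (by abel) ?_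
      refine R.step (R.subst (s := 4) (x := 2) (by decide) (by decide)
        (C := X3 0 4 5 + X3 1 6 7 + L 6 2 + L 5 3 + L 7 3) (by simp [sub]; rfl))
        (by rw [L_comm 2 4, L_comm 2 6, L_comm 3 5, L_comm 3 7]; abel) ?_
      refine R.step (R.subst (s := 6) (x := 2) (by decide) (by decide)
        (C := X3 0 2 5 + X3 1 6 7 + L 5 3 + L 7 3) (by simp [sub]; rfl)) (by abel) ?_
      refine R.step (R.subst (s := 5) (x := 3) (by decide) (by decide)
        (C := X3 0 2 5 + X3 1 2 7 + L 7 3) (by simp [sub]; rfl)) (by abel) ?_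
      refine R.step (R.subst (s := 7) (x := 3) (by decide) (by decide)
        (C := X3 0 2 3 + X3 1 2 7) (by simp [sub])) (by abel) (R.refl _ _)
    refine l1.trans (h1.trans ((R.green_three 0 1 8 _).trans ?_))
    exact R.step (R.subst (s := 8) (x := 0) (by decide) (by decide) (C := L 0 1 + X3 8 2 3)
        (by simp [sub])) (by rw [L_comm 0 8]; abel) (R.refl _ _)
  simpa using (h2.open_app (by simp; omega) (val [a, b, v, w]) C O)

/-! #### Rules for `H` -/

lemma R.H_H {a b w : ℕ} (ha : a ≠ w) (hb : b ≠ w) {C : Net ℕ} (hC : w ∉ wires C) (hO : w ∉ O) :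
    R E O (H a w + H w b + C) (L a b + C) := by
  have h1 : R E {0, 1} (H 0 2 + H 2 1) (L 0 1) :=
    R.of_ax (.had_had 0 1 2) {0, 2, 2, 1} {0, 1} rfl rfl (by simp)
      (by simp) (by decide) (by decide)
  simpa using (h1.hidden_app 2 (by simp; omega) (val [a, b, w]) C O hC hO (by simp [ha, hb]))

lemma R.H_X1 {a w : ℕ} (ha : a ≠ w) {C : Net ℕ} (hC : w ∉ wires C) (hO : w ∉ O) :
    R E O (H a w + X1 0 w + C) C := by
  have h1 : R E {0} (H 0 1 + X1 0 1) (Z 0 0) :=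
    R.of_ax (.had_eps .red 0 1) {0, 1, 1} {0} rfl rfl (by simp) (by simp)
      (by decide) (by decide)
  refine R.trans ?_ (R.Z_zero a C)
  simpa using (h1.hidden_app 1 (by simp; omega) (val [a, w]) C O hC hO (by simp [ha]))

/-- The sum of (-1)^(aw) over w vanishes unless a = 0. -/
lemma R.H_hidden {a w : ℕ} (ha : a ≠ w) {C : Net ℕ} (hC : w ∉ wires C) (hO : w ∉ O) :
    R E O (H a w + C) (X1 0 a + C) := by
  have h1 : R E {0} (H 0 1 + Z 0 1) (X1 0 0) :=
    R.of_ax (.had_eps .green 0 1) {0, 1, 1} {0} rfl rfl (by simp) (by simp)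
      (by decide) (by decide)
  refine R.step (R.Z_zero w (H a w + C)).symm rfl ?_
  refine R.step (A' := H a w + Z 0 w + C) (B := X1 0 a + C) ?_ (by abel) (R.refl _ _)
  simpa using (h1.hidden_app 1 (by simp; omega) (val [a, w]) C O hC hO (by simp [ha]))

/-- This is the axiom that moves a phase through `H`, with the far end hidden: there the remaining
`H` becomes a red dot and fuses with the red phase. -/
lemma R.H_Z (α : Real.Angle) {a w : ℕ} (ha : a ≠ w) {C : Net ℕ} (hC : w ∉ wires C) (hO : w ∉ O) :
    R E O (H a w + Z α w + C) (X1 α a + C) := by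
  have h1 : R E {0, 2} (H 0 1 + {spider .green α {1, 2}}) (X2 α 0 3 + H 3 2) :=
    R.of_ax (.had_phase .green α 0 2 1 3) {0, 1, 1, 2} {0, 3, 3, 2} rfl rfl (by simp)
      (by simp) (by decide) (by decide)
  have h2 : R E {0} (H 0 1 + Z α 1) (X1 α 0) := by
    refine R.step (R.subst (s := 2) (x := 1) (by decide) (by decide) (C := H 0 1 + Z α 1)
      (by simp [sub])).symm rfl ?_
    refine R.step (R.green_two α 1 2 (H 0 1)).symm (by rw [L_comm 2 1]; abel) ?_
    refine R.step (h1.hide (by decide)) (by abel) ?_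
    refine R.step (R.H_hidden (a := 3) (w := 2) (by decide) (C := X2 α 0 3) (by simp) (by decide))
      (by abel) ?_
    refine R.step (R.X1_X2 0 α (x := 3) (y := 0) (by decide) (C := 0) (by simp) (by decide))
      (by rw [X2_comm α 3 0, add_zero]) (R.of_eq (by simp))
  simpa using (h2.hidden_app 1 (by simp; omega) (val [a, w]) C O hC hO (by simp [ha]))

/-- Exponents add: (-1)^(sv) (-1)^(sw) = (-1)^(sz), where the new hidden variable z is the sum v +
w. -/
lemma R.H_delta {s v w z : ℕ} (hs : s ≠ z) (hv : v ≠ z) (hw : w ≠ z) {C : Net ℕ}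
    (hC : z ∉ wires C) (hO : z ∉ O) :
    R E O (H s v + H s w + C) (H s z + X3 z v w + C) := by
  have h1 : R E {0, 1, 2} (H 0 3 + X3 3 1 2) ({spider .green 0 {0, 4, 5}} + H 4 1 + H 5 2) :=
    R.of_ax (.had_delta .red 0 1 2 4 5 3) {0, 3, 3, 1, 2} {0, 4, 5, 4, 1, 5, 2} rfl rfl
      (by simp) (by simp) (by decide) (by decide)
  have h2 : R E {0, 1, 2} (H 0 1 + H 0 2) (H 0 3 + X3 3 1 2) := by
    refine R.symm (h1.trans ?_)
    refine R.step (R.green_three 0 4 5 (H 4 1 + H 5 2)) (by abel) ?_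
    refine R.step (R.subst (s := 4) (x := 0) (by decide) (by decide)
      (C := L 5 0 + H 4 1 + H 5 2) (by simp [sub]; rfl))
        (by rw [L_comm 0 4, L_comm 0 5]; abel) ?_
    exact R.step (R.subst (s := 5) (x := 0) (by decide) (by decide)
      (C := H 0 1 + H 5 2) (by simp [sub])) (by abel) (R.refl _ _)
  simpa using (h2.hidden_app 3 (by simp; omega) (val [s, v, w, z]) C O hC hO (by simp [hs, hv, hw]))

end

section
variable {E : Set Equation} {O : Finset ℕ}

/-! ### Consequences of the axioms -/

lemma X3_rotate (x y z : ℕ) : X3 x y z = X3 z x y := by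
  have : ({x, y, z} : Multiset ℕ) = {z, x, y} := by
    simp only [Multiset.insert_eq_cons, ← Multiset.singleton_add]
    abel
  rw [X3, X3, this]

/-- Since w + w = 0. The equality of two copies of w is itself written as a parity constraint with a
third variable 0; by `R.bialgebra` this variable equals z, and the constraint that is left
disappears because one copy of w is hidden. -/
lemma R.X3_self (z w : ℕ) (C : Net ℕ) : R E O (X3 z w w + C) (X1 0 z + C) := by
  have h : R E {0, 1} (X3 0 1 1) (X1 0 0) := by
    refine R.step (R.subst (s := 2) (x := 1) (by decide) (by decide) (C := X3 0 1 2)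
      (by simp [sub])).symm rfl ?_
    refine R.step (R.X2_zero 1 2 (X3 0 1 2)).symm (by rw [L_comm]) ?_
    refine R.step (R.X1_X3 0 (x := 3) (by decide) (by decide) (C := X3 0 1 2) (by simp)
      (by decide)).symm rfl ?_
    refine R.step (R.bialgebra 0 3 1 2 (X1 0 3)) (by abel) ?_
    refine R.step (R.subst (s := 3) (x := 0) (by decide) (by decide) (C := X3 2 0 1 + X1 0 3)
      (by simp [sub]; rfl)) (by rw [L_comm, X3_rotate 0 1 2]; abel) ?_
    exact R.X3_hidden (by decide) (by decide) (by simp) (by decide)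
  simpa using (h.open_app (by simp; omega) (val [z, w]) C O)

/-- The Hopf law for edges: combine both `H`s into one at the variable w + w, which is 0. This makes
edges count modulo 2. -/
lemma R.H_sq (v w : ℕ) (C : Net ℕ) : R E O (H v w + H v w + C) C := by
  have h : R E {0, 1} (H 0 1 + H 0 1) 0 := by
    refine R.step (R.H_delta (z := 2) (by decide) (by decide) (by decide) (C := 0) (by simp)
      (by decide)) (add_zero _).symm ?_
    refine R.step (R.X3_self 2 1 (H 0 2)) (by abel) ?_
    exact R.step (R.H_X1 (a := 0) (w := 2) (by decide) (C := 0) (by simp) (by decide)) (by abel)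
      (R.refl _ _)
  simpa using (h.open_app (by simp) (val [v, w]) C O)

/-- A phase at a variable with value 0 is trivial: copying the red dot puts the phase on a wire of
its own, where it is a suppressed scalar. -/
lemma R.Z_absorb (α : Real.Angle) (x : ℕ) (C : Net ℕ) :
    R E O (Z α x + X1 0 x + C) (X1 0 x + C) := by
  have h : R E {0} (Z α 0 + X1 0 0) (X1 0 0) := by
    refine R.step (R.subst (s := 1) (x := 0) (by decide) (by decide) (C := Z α 1 + X1 0 0)
      (by simp [sub])).symm rfl ?_
    refine R.step (R.copy 0 1 (Z α 1)) (by rw [L_comm]; abel) ?_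
    exact R.step (R.Z_X1 α (x := 1) (C := X1 0 0) (by simp) (by decide)) (by abel) (R.refl _ _)
  simpa using (h.open_app (by simp) (val [x]) C O)

lemma R.X1_absorb {α : Real.Angle} (hα : α ≠ ang Real.pi) (x : ℕ) (C : Net ℕ) :
    R E O (X1 α x + X1 0 x + C) (X1 0 x + C) := by
  have h : R E {0} (X1 α 0 + X1 0 0) (X1 0 0) := by
    refine R.step (R.subst (s := 1) (x := 0) (by decide) (by decide) (C := X1 α 1 + X1 0 0)
      (by simp [sub])).symm rfl ?_
    refine R.step (R.copy 0 1 (X1 α 1)) (by rw [L_comm]; abel) ?_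
    exact R.step (R.X1_X1 (α := α) (β := 0) (by simpa using hα) (x := 1) (C := X1 0 0) (by simp)
      (by decide)) (by abel) (R.refl _ _)
  simpa using (h.open_app (by simp) (val [x]) C O)

lemma R.X2_hidden (α : Real.Angle) {x y : ℕ} (hxy : y ≠ x) {C : Net ℕ} (hC : x ∉ wires C)
    (hO : x ∉ O) : R E O (X2 α x y + C) C := by
  have h : R E {1} (X2 α 0 1) 0 := by
    refine R.step (R.X1_X3 α (x := 2) (y := 0) (z := 1) (by decide) (by decide) (C := 0) (by simp)
      (by decide)).symm (add_zero _).symm ?_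
    refine R.step (R.X3_hidden (x := 0) (y := 1) (z := 2) (by decide) (by decide) (C := X1 α 2)
      (by simp) (by decide)) (by rw [X3_rotate 0 1 2]; abel) ?_
    exact R.step (R.X1_hidden α (C := 0) (by simp) (by decide)) (add_zero _).symm (R.refl _ _)
  simpa using (h.hidden_app 0 (by simp) (val [x, y]) C O hC hO (by simp [hxy]))

/-- A piece of wire allows to replace one of its ends by the other. -/
lemma R.L_H (a b : ℕ) (C : Net ℕ) : R E O (L a b + H a b + C) (L a b + H b b + C) := by
  have h : R E {0, 1} (L 0 1 + H 0 1) (L 0 1 + H 1 1) := by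
    refine R.step (R.subst (s := 2) (x := 0) (by decide) (by decide) (C := L 2 1 + H 2 1)
      (by simp [sub])).symm rfl ?_
    exact R.step (R.subst (s := 2) (x := 1) (by decide) (by decide) (C := L 0 2 + H 2 1)
      (by simp [sub])) (by rw [L_comm 2 0]; abel) (R.refl _ _)
  simpa using (h.open_app (by simp; omega) (val [a, b]) C O)

/-- Red vertices are linear: an `H` on one leg is the product of `H`s on the two others. -/
lemma R.H_X3 (y v w s : ℕ) (C : Net ℕ) :
    R E O (H y s + X3 y v w + C) (H v s + H w s + X3 y v w + C) := by
  have h : R E {0, 1, 2, 3} (H 0 3 + X3 0 1 2) (H 1 3 + H 2 3 + X3 0 1 2) := by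
    refine R.symm ?_
    -- The two `H`s are folded into one at a new variable `4`, the sum of `1` and `2`. By
    -- `R.bialgebra` it equals `0`, which satisfies the same constraint.
    refine R.step (R.H_delta (s := 3) (v := 1) (w := 2) (z := 4) (by decide) (by decide) (by decide)
      (C := X3 0 1 2) (by simp) (by decide)) (by rw [H_comm 1 3, H_comm 2 3]) ?_
    refine R.step (R.bialgebra 0 4 1 2 (H 3 4)) (by abel) ?_
    exact R.step (R.subst (s := 4) (x := 0) (by decide) (by decide) (C := H 3 4 + X3 0 1 2)
      (by simp [sub]; rfl)) (by rw [L_comm]; abel) (R.of_eq (by rw [H_comm]))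
  simpa using (h.open_app (by simp; omega) (val [y, v, w, s]) C O)

/-! ### The Euler decomposition -/

variable (E) in
/-- The Euler decomposition of `H` with angle `τ`. -/
def Euler (τ : Real.Angle) : Prop := R E {0, 1} (H 0 1) (Z τ 0 + X2 τ 0 1 + Z τ 1)

lemma Euler.H_eq {τ : Real.Angle} (h : Euler E τ) (a b : ℕ) (C : Net ℕ) :
    R E O (H a b + C) (Z τ a + X2 τ a b + Z τ b + C) := by
  simpa using (R.open_app h (by simp) (val [a, b]) C O)

lemma R.Z_cancel {α β : Real.Angle} (h : α + β = 0) (x : ℕ) (C : Net ℕ) :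
    R E O (Z α x + Z β x + C) C := by
  refine (R.Z_add α β x C).trans ?_
  rw [h]
  exact R.Z_zero x C

lemma Euler.X2_eq {τ : Real.Angle} (h : Euler E τ) (a b : ℕ) (C : Net ℕ) :
    R E O (X2 τ a b + C) (Z (-τ) a + H a b + Z (-τ) b + C) := by
  refine R.symm ?_
  refine R.step (h.H_eq a b (Z (-τ) a + Z (-τ) b + C)) (by abel) ?_
  refine R.step (R.Z_cancel (add_neg_cancel τ) a (Z τ b + Z (-τ) b + X2 τ a b + C)) (by abel) ?_
  exact R.step (R.Z_cancel (add_neg_cancel τ) b (X2 τ a b + C)) (by abel) (R.refl _ _)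

/-- The decomposition expresses the red phase τ by `H` between green phases -τ. As `H` is an
involution, the inverse red phase -τ is `H` between green phases τ, and moving these to the other
side gives the decomposition for -τ. -/
lemma Euler.neg {τ : Real.Angle} (h : Euler E τ) : Euler E (-τ) := by
  have h1 : R E {0, 1} (Z τ 0 + H 0 1 + Z τ 1) (X2 (-τ) 0 1) := by
    refine R.step (R.subst (s := 2) (x := 1) (by decide) (by decide)
      (C := Z τ 0 + H 0 2 + Z τ 2) (by simp [sub])).symm rfl ?_
    refine R.step (R.X2_zero 2 1 _).symm rfl ?_
    refine R.step (R.X2_X2 τ (-τ) (x := 3) (y := 2) (z := 1) (by decide) (by decide)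
      (C := Z τ 0 + H 0 2 + Z τ 2) (by simp) (by decide)).symm (by rw [add_neg_cancel]) ?_
    refine R.step (h.X2_eq 3 2 (X2 (-τ) 3 1 + (Z τ 0 + H 0 2 + Z τ 2))) (by abel) ?_
    refine R.step (R.Z_cancel (add_neg_cancel τ) 2 (Z (-τ) 3 + H 3 2 + X2 (-τ) 3 1 +
      (Z τ 0 + H 0 2))) (by abel) ?_
    refine R.step (R.H_H (a := 3) (w := 2) (b := 0) (by decide) (by decide)
      (C := Z (-τ) 3 + X2 (-τ) 3 1 + Z τ 0) (by simp) (by decide)) (by rw [H_comm 0 2]; abel) ?_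
    refine (R.subst (s := 3) (x := 0) (by decide) (by decide) (by simp [sub]; rfl)).trans ?_
    exact R.step (R.Z_cancel (add_neg_cancel τ) 0 (X2 (-τ) 0 1)) (by abel) (R.refl _ _)
  have h2 := h1.open_app (by simp) id (Z (-τ) 0 + Z (-τ) 1) {0, 1}
  rw [rename_eq_self (by simp), rename_eq_self (by simp)] at h2
  refine R.trans (R.symm ?_) (h2.trans (R.of_eq (by abel)))
  refine R.step (R.Z_cancel (add_neg_cancel τ) 0 (Z τ 1 + Z (-τ) 1 + H 0 1)) (by abel) ?_
  exact R.Z_cancel (add_neg_cancel τ) 1 (H 0 1)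

/-- Put a red dot on one end of the decomposition. The `H` becomes trivial, the dot absorbs the
green phase next to it and fuses with the red one; so the red dot of phase τ is inverse to the green
dot of phase τ. -/
lemma Euler.X1_eq {τ : Real.Angle} (h : Euler E τ) (x : ℕ) (C : Net ℕ) :
    R E O (X1 τ x + C) (Z (-τ) x + C) := by
  have h1 : R E {0} (Z τ 0 + X1 τ 0) 0 := by
    refine R.symm ?_
    refine R.step (R.H_X1 (a := 0) (w := 1) (by decide) (C := 0) (by simp) (by decide)).symm rfl ?_
    refine R.step (h.H_eq 0 1 (X1 0 1)) (by abel) ?_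
    refine R.step (R.Z_absorb τ 1 (Z τ 0 + X2 τ 0 1)) (by abel) ?_
    refine R.step (R.X1_X2 0 τ (x := 1) (y := 0) (by decide) (C := Z τ 0) (by simp) (by decide))
      (by rw [X2_comm τ 0 1]; abel) ?_
    exact R.of_eq (by rw [zero_add, add_comm])
  have h2 := h1.open_app (by simp) (val [x]) (Z (-τ) x + C) O
  simp only [rename_add, rename_Z, rename_X1, rename_zero, val_zero, zero_add] at h2
  refine R.step (R.Z_cancel (add_neg_cancel τ) x (X1 τ x + C)).symm rfl ?_
  exact R.step h2 (by abel) (R.refl _ _)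

/-! ### Local complementation of a path with three vertices implies the Euler decomposition -/

/-- The hypothesis is local complementation at the centre `0` of a path with ends `1` and `2`, where
the hidden variable `3` sits at the dot of the centre. Summing over outputs extracts simpler
equations. -/
lemma euler_of_path {τ : Real.Angle} (hτ : τ + τ = ang Real.pi) (hτ' : τ ≠ ang Real.pi)
    (h : R E {0, 1, 2} (X2 (-τ) 0 3 + H 3 1 + H 3 2 + Z τ 1 + Z τ 2) (H 0 1 + H 0 2 + H 1 2)) :
    Euler E τ := by
  -- Hiding `0` removes the red gate on the left and contracts two `H`s on each side, so `1` and `2`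
  -- become equal. The edge of the triangle turns into a loop, to be compared with the phase τ + τ =
  -- π.
  have loop : R E {1} (H 1 1) (Z (ang Real.pi) 1) := by
    have h1 : R E {1} (L 1 2 + H 1 2) (L 1 2 + Z τ 1 + Z τ 2) := by
      refine R.step (R.H_H (a := 1) (w := 0) (b := 2) (by decide) (by decide) (C := H 1 2)
        (by simp) (by decide)).symm rfl ?_
      refine R.step (h.hide (by decide)).symm (by rw [H_comm 1 0]) ?_
      refine R.step (R.X2_hidden (-τ) (x := 0) (y := 3) (by decide)
        (C := H 3 1 + H 3 2 + Z τ 1 + Z τ 2) (by simp) (by decide)) (by abel) ?_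
      exact R.step (R.H_H (a := 1) (w := 3) (b := 2) (by decide) (by decide) (C := Z τ 1 + Z τ 2)
        (by simp) (by decide)) (by rw [H_comm 1 3]; abel) (R.of_eq (by abel))
    refine R.step (R.subst (s := 2) (x := 1) (by decide) (by decide) (C := H 1 2)
      (by simp [sub])).symm rfl ?_
    refine R.step h1 (by rw [L_comm]) ?_
    refine R.step (R.subst (s := 2) (x := 1) (by decide) (by decide) (C := Z τ 1 + Z τ 2)
      (by simp [sub]; rfl)) (by rw [L_comm]; abel) ?_
    rw [← hτ]
    exact R.step (R.Z_add τ τ 1 0) (add_zero _).symm (R.of_eq (add_zero _))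
  -- Hiding only `2` turns its `H` and phase into a red dot on the left; on the right it identifies
  -- `0` with `1` and again makes the remaining edge a loop.
  have h2 : R E {0, 1} (X2 (-τ) 0 3 + H 3 1 + X1 τ 3 + Z τ 1) (L 0 1 + Z (ang Real.pi) 1) := by
    refine R.step (R.H_Z τ (a := 3) (w := 2) (by decide) (C := X2 (-τ) 0 3 + H 3 1 + Z τ 1) (by simp)
      (by decide)).symm (by abel) ?_
    refine R.step (h.hide (by decide)) (by abel) ?_
    refine R.step (R.H_H (a := 0) (w := 2) (b := 1) (by decide) (by decide) (C := H 0 1)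
      (by simp) (by decide)) (by rw [H_comm 1 2]; abel) ?_
    refine R.step (R.L_H 0 1 0) (add_zero _).symm ?_
    have := loop.open_app (by simp) id (L 0 1) {0, 1}
    rw [rename_eq_self (by simp), rename_eq_self (by simp)] at this
    exact R.step this (by abel) (R.of_eq (by abel))
  -- The inverses of the red gate and of the green phase at `1` are applied. On the right the phase
  -- becomes π - τ = τ.
  have h3 : R E {1, 4} (X1 τ 4 + H 4 1) (Z τ 1 + X2 τ 4 1) := by
    have h4 := h2.hidden_app 3 (by simp; omega) id (X2 τ 0 4 + Z (-τ) 1) {1, 4} (by simp) (by decide)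
      (by decide)
    rw [rename_eq_self (by simp), rename_eq_self (by simp)] at h4
    refine R.trans (R.symm ?_) (h4.trans ?_)
    · refine R.step (R.X2_X2 (-τ) τ (x := 0) (y := 3) (z := 4) (by decide) (by decide)
        (C := H 3 1 + X1 τ 3 + Z τ 1 + Z (-τ) 1) (by simp) (by decide)) (by abel) ?_
      rw [neg_add_cancel]
      refine (R.X2_zero 3 4 _).trans ?_
      refine (R.subst (s := 3) (x := 4) (by decide) (by decide) (by simp [sub]; rfl)).trans ?_
      exact R.step (R.Z_cancel (add_neg_cancel τ) 1 (X1 τ 4 + H 4 1)) (by abel) (R.refl _ _)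
    · refine R.step (R.subst (s := 0) (x := 1) (by decide) (by decide)
        (C := Z (ang Real.pi) 1 + X2 τ 0 4 + Z (-τ) 1) (by simp [sub]; rfl)) (by abel) ?_
      refine R.step (R.Z_add (ang Real.pi) (-τ) 1 (X2 τ 1 4)) (by abel) ?_
      rw [← hτ, add_neg_cancel_right, X2_comm]
      exact R.refl _ _
  have h5 : ∀ (O : Finset ℕ) (a b : ℕ) (C : Net ℕ),
      R E O (X1 τ a + H a b + C) (Z τ b + X2 τ a b + C) := by
    intro O a b C
    simpa [Function.update] using
      (h3.open_app (by simp) (fun n => if n = 4 then a else b) C O)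
  -- The right-hand side of `h5` is symmetric up to the place of its phase. Using it forwards and
  -- then backwards with the ends exchanged carries both dots from `0` to the other end of a trivial
  -- `H`, where the red dot of phase `0` absorbs them.
  have h6 : R E {0} (X1 τ 0 + Z τ 0) 0 := by
    refine R.step (R.H_X1 (a := 0) (w := 1) (by decide) (C := X1 τ 0 + Z τ 0) (by simp)
      (by decide)).symm rfl ?_
    refine R.step (h5 _ 0 1 (Z τ 0 + X1 0 1)) (by abel) ?_
    refine R.step (h5 _ 1 0 (Z τ 1 + X1 0 1)).symm (by rw [X2_comm]; abel) ?_
    refine R.step (R.Z_absorb τ 1 (X1 τ 1 + H 1 0)) (by abel) ?_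
    refine R.step (R.X1_absorb hτ' 1 (H 1 0)) (by abel) ?_
    exact R.step (R.H_X1 (a := 0) (w := 1) (by decide) (C := 0) (by simp) (by decide))
      (by rw [H_comm]; abel) (R.refl _ _)
  -- Inserting the trivial product of the two dots next to `H` makes `h5` applicable, with the green
  -- phase at `0` left over.
  have h7 := h6.symm.open_app (by simp) id (H 0 1) {0, 1}
  rw [rename_eq_self (by simp), rename_eq_self (by simp), zero_add] at h7
  refine h7.trans ?_
  exact R.step (h5 _ 0 1 (Z τ 0)) (by abel) (R.of_eq (by abel))

/-! ### The Euler decomposition implies local complementation of stars -/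

/-- The product of the `H`s between `m` and the variables in a list. -/
def fan (m : ℕ) (l : List ℕ) : Net ℕ := (l.map (H m)).sum

/-- Green phases `α` at the variables in a list. -/
noncomputable def phases (α : Real.Angle) (l : List ℕ) : Net ℕ := (l.map (Z α)).sum

/-- The product of the `H`s between any two variables in a list. -/
def clique : List ℕ → Net ℕ
  | [] => 0
  | v :: l => fan v l + clique l

@[simp] lemma fan_nil (m : ℕ) : fan m [] = 0 := rfl
@[simp] lemma fan_cons (m v : ℕ) (l : List ℕ) : fan m (v :: l) = H m v + fan m l := by simp [fan]
@[simp] lemma phases_nil (α : Real.Angle) : phases α [] = 0 := rfl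
@[simp] lemma phases_cons (α : Real.Angle) (v : ℕ) (l : List ℕ) :
    phases α (v :: l) = Z α v + phases α l := by simp [phases]
@[simp] lemma clique_cons (v : ℕ) (l : List ℕ) : clique (v :: l) = fan v l + clique l := rfl
@[simp] lemma clique_nil : clique [] = 0 := rfl

lemma mem_wires_phases {α : Real.Angle} {x : ℕ} {l : List ℕ} :
    x ∈ wires (phases α l) ↔ x ∈ l := by
  induction l with
  | nil => simp
  | cons v l ih => simp [ih]

lemma R.phases_cancel (α : Real.Angle) (l : List ℕ) (C : Net ℕ) :
    R E O (phases α l + phases (-α) l + C) C := by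
  induction l with
  | nil => exact R.of_eq (by simp)
  | cons v l ih =>
    refine R.step (R.Z_cancel (add_neg_cancel α) v (phases α l + phases (-α) l + C)) ?_ ih
    simp only [phases_cons]
    abel

/-- `R.H_X3` for each member of the list: if y = v + w, the edges at y are those at v together with
those at w. -/
lemma R.fan_X3 (y v w : ℕ) (l : List ℕ) (C : Net ℕ) :
    R E O (fan y l + X3 y v w + C) (fan v l + fan w l + X3 y v w + C) := by
  induction l generalizing C with
  | nil => exact R.of_eq (by simp)
  | cons s l ih =>
    refine R.step (R.H_X3 y v w s (fan y l + C)) (by simp only [fan_cons]; abel) ?_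
    refine R.step (ih (H v s + H w s + C)) (by abel) (R.of_eq ?_)
    simp only [fan_cons]
    abel

/-- The sum over a variable of green phase `τ` that is joined to the variables in a list. -/
lemma Euler.fan_eq {τ : Real.Angle} (h : Euler E τ) (hτ : τ ≠ ang Real.pi) (l : List ℕ) :
    ∀ (O : Finset ℕ) (m : ℕ) (C : Net ℕ), m ∉ O → m ∉ wires C → m ∉ l →
      R E O (Z τ m + fan m l + C) (phases (-τ) l + clique l + C) := by
  induction hn : l.length using Nat.strong_induction_on generalizing l with
  | _ n ih =>
  intro O m C hO hC hl
  match l, hn with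
  | [], _ =>
    simp only [fan_nil, phases_nil, clique_nil, add_zero, zero_add]
    exact R.Z_hidden hτ hC hO
  | [v], _ =>
    have hv : v ≠ m := fun e => hl (by simp [e])
    refine R.step (R.H_Z τ (a := v) (w := m) hv hC hO) (by
      simp only [fan_cons, fan_nil]
      rw [H_comm]
      abel) ?_
    exact R.step (h.X1_eq v C) rfl (R.of_eq (by simp))
  | v :: w :: l, hn =>
    -- Two neighbours v and w of `m` are replaced by a single new one, y = v + w. Since the shorter
    -- list is not a tail of the given one, the induction is on the length; open ends and context
    -- must vary because y and its constraint become part of the context.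
    obtain ⟨y, hy⟩ := Infinite.exists_notMem_finset
      (O ∪ (wires C + wires (fan v l) + wires (fan w l) + wires (clique l)).toFinset ∪ {m, v, w} ∪
        l.toFinset)
    simp only [Finset.mem_union, Multiset.mem_toFinset, Multiset.mem_add, Finset.mem_insert,
      Finset.mem_singleton, List.mem_toFinset, not_or] at hy
    obtain ⟨⟨⟨hyO, ⟨⟨hyC, hyv⟩, hyw⟩, hyc⟩, hym, hyv', hyw'⟩, hyl⟩ := hy
    simp only [List.mem_cons, not_or] at hl
    obtain ⟨hmv, hmw, hml⟩ := hl
    have hym' : ∀ l : List ℕ, y ≠ m → y ∉ l → y ∉ wires (fan m l) := by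
      intro l h1 h2
      induction l with
      | nil => simp
      | cons s l ih =>
        simp only [List.mem_cons, not_or] at h2
        simp [h1, h2.1, ih h2.2]
    refine R.step (R.H_delta (s := m) (v := v) (w := w) (z := y) (Ne.symm hym) (Ne.symm hyv')
      (Ne.symm hyw') (C := Z τ m + fan m l + C) (by simp [hym, hyC, hym' l hym hyl]) hyO)
      (by simp only [fan_cons]; abel) ?_
    refine R.step (ih (y :: l).length (by simp [← hn]) (y :: l) rfl O m (X3 y v w + C) hO
      (by simp [hC, hmv, hmw, Ne.symm hym]) (by simp [hml, Ne.symm hym]))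
      (by simp only [fan_cons]; abel) ?_
    refine R.step (R.fan_X3 y v w l (phases (-τ) (y :: l) + clique l + C))
      (by simp only [clique_cons]; abel) ?_
    -- The green phase -τ at y becomes a red dot of phase τ and fuses with the constraint y = v + w
    -- into a red phase between v and w. The Euler decomposition turns it into the missing edge
    -- between v and w and their phases -τ.
    refine R.step (h.X1_eq y (fan v l + fan w l + X3 y v w + phases (-τ) l + clique l + C)).symm
      (by simp only [phases_cons]; abel) ?_
    refine R.step (R.X1_X3 τ (x := y) (y := v) (z := w) (Ne.symm hyv') (Ne.symm hyw')
      (C := fan v l + fan w l + phases (-τ) l + clique l + C)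
      (by simp [hyv, hyw, hyc, hyC, mem_wires_phases, hyl]) hyO) (by abel) ?_
    refine (h.X2_eq v w _).trans (R.of_eq ?_)
    simp only [clique_cons, fan_cons, phases_cons]
    abel

/-- Local complementation at the centre `o` of a star. -/
lemma Euler.star_eq {τ : Real.Angle} (h : Euler E τ) (hτ : τ ≠ ang Real.pi) {o m : ℕ}
    {l : List ℕ} {C : Net ℕ} (hO : m ∉ O) (hC : m ∉ wires C) (hl : m ∉ l) (ho : m ≠ o) :
    R E O (X2 (-τ) o m + fan m l + phases τ l + C) (fan o l + clique l + C) := by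
  -- The red gate of phase -τ becomes an edge between `o` and `m` with phases τ at both ends, so `o`
  -- is one more neighbour of `m`, and `m` has the phase needed for `fan_eq`. The phases -τ that
  -- arise cancel those at `o` and in `l`.
  refine R.step (h.neg.X2_eq o m (fan m l + phases τ l + C)) (by abel) ?_
  rw [neg_neg]
  refine R.step (h.fan_eq hτ (o :: l) O m (Z τ o + phases τ l + C) hO
    (by simp [ho, hC, mem_wires_phases, hl]) (by simp [ho, hl]))
    (by simp only [fan_cons]; rw [H_comm o m]; abel) ?_
  refine R.step (R.phases_cancel τ (o :: l) (clique (o :: l) + C))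
    (by simp only [phases_cons]; abel) (R.of_eq ?_)
  simp only [clique_cons]

end

section
variable {E : Set Equation} {O : Finset ℕ} {V : Type}

/-! ### Graph states as nets of `H`s -/

/-- The `H` between the variables at the ends of an edge. -/
def edgeH (q : V → ℕ) : Sym2 V → Net ℕ :=
  Sym2.lift ⟨fun v w => H (q v) (q w), fun _ _ => H_comm _ _⟩

@[simp] lemma edgeH_mk (q : V → ℕ) (v w : V) : edgeH q s(v, w) = H (q v) (q w) := rfl

@[simp] lemma edgeHad_mk (v w : V) :
    edgeHad s(v, w) = had (.half v w) (.half w v) := rfl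

lemma map_eq_sum_singleton {ι α : Type} (s : Finset ι) (F : ι → α) :
    s.val.map F = ∑ i ∈ s, {F i} := by
  have := Multiset.sum_map_singleton (s.val.map F)
  rw [Multiset.map_map] at this
  exact this.symm

lemma rename_sum {W W' ι : Type} (f : W → W') (s : Finset ι) (F : ι → Net W) :
    Net.rename f (∑ i ∈ s, F i) = ∑ i ∈ s, Net.rename f (F i) := by
  classical
  induction s using Finset.induction_on with
  | empty => simp
  | insert a s ha ih => rw [Finset.sum_insert ha, Finset.sum_insert ha, rename_add, ih]

lemma wires_sum {W ι : Type} (s : Finset ι) (F : ι → Net W) :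
    wires (∑ i ∈ s, F i) = ∑ i ∈ s, wires (F i) := by
  classical
  induction s using Finset.induction_on with
  | empty => simp
  | insert a s ha ih => rw [Finset.sum_insert ha, Finset.sum_insert ha, wires_add, ih]

lemma hasArity_sum {W ι : Type} (s : Finset ι) (F : ι → Net W) :
    HasArity (∑ i ∈ s, F i) ↔ ∀ i ∈ s, HasArity (F i) := by
  classical
  induction s using Finset.induction_on with
  | empty => simp
  | insert a s ha ih => rw [Finset.sum_insert ha, hasArity_add, ih, Finset.forall_mem_insert]

lemma filter_sum {α ι : Type} (p : α → Prop) [DecidablePred p] (s : Finset ι)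
    (F : ι → Multiset α) : (∑ i ∈ s, F i).filter p = ∑ i ∈ s, (F i).filter p := by
  classical
  induction s using Finset.induction_on with
  | empty => simp
  | insert a s ha ih => rw [Finset.sum_insert ha, Finset.sum_insert ha, Multiset.filter_add, ih]

lemma hasArity_edgeH (q : V → ℕ) (e : Sym2 V) : HasArity (edgeH q e) := by
  induction e with | _ v w => simp

/-- Derivations may be carried out simultaneously in all the parts of a diagram. -/
lemma derivable_sum {ι : Type} (s : Finset ι) (F F' : ι → Net ℕ) (C : Net ℕ)
    (hw : ∀ i ∈ s, wires (F i) = wires (F' i)) (ha : ∀ i ∈ s, HasArity (F' i))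
    (h : ∀ i ∈ s, (F i).IsDiagram → Derivable E (F i) (F' i))
    (hd : (∑ i ∈ s, F i + C).IsDiagram) :
    Derivable E (∑ i ∈ s, F i + C) (∑ i ∈ s, F' i + C) := by
  classical
  induction s using Finset.induction_on generalizing C with
  | empty => exact .refl _
  | insert a s has ih =>
    simp only [Finset.forall_mem_insert] at hw ha h
    rw [Finset.sum_insert has] at hd
    rw [Finset.sum_insert has, Finset.sum_insert has]
    have hd' : (F' a + (∑ i ∈ s, F i + C)).IsDiagram := by
      rw [add_assoc] at hd
      refine isDiagram_of_wires_le hd (by rw [wires_add, wires_add (F a), hw.1]) ?_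
      have := (isDiagram_iff.1 hd).2
      rw [hasArity_add] at this ⊢
      exact ⟨ha.1, this.2⟩
    have e1 : ∀ A B : Net ℕ, A + B + C = B + (A + C) := fun A B => by abel
    refine Derivable.trans (D' := F' a + (∑ i ∈ s, F i + C)) ?_ ?_
    · rw [add_assoc] at hd ⊢
      exact .context _ (h.1 (isDiagram_of_le hd (Multiset.le_add_right _ _))) hd hd'
    · have e2 : F' a + (∑ i ∈ s, F i + C) = ∑ i ∈ s, F i + (F' a + C) := by abel
      rw [e2] at hd' ⊢
      rw [e1]
      exact ih (F' a + C) hw.2 ha.2 h.2 hd'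

lemma out_injective (ν : Wire V ↪ ℕ) : Function.Injective fun v => ν (.out v) := by
  intro v w h
  have := ν.injective h
  injection this

lemma greens_image_eq_sum {ι : Type} {s : Finset ι} {g : ι → ℕ} (hg : Set.InjOn g s)
    (S : ℕ → Multiset ℕ) :
    greens (s.image g) S = ∑ i ∈ s, {spider .green 0 (S (g i))} := by
  rw [greens, Finset.image_val_of_injOn hg, Multiset.map_map, map_eq_sum_singleton]
  rfl

variable [Fintype V]

open Classical in
/-- The ends at the dot of `v` of the wires along the edges. -/
noncomputable def halves (G : SimpleGraph V) (v : V) : Multiset (Wire V) :=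
  (Finset.univ.filter fun w => G.Adj v w).val.map (Wire.half v)

lemma nodup_halves (G : SimpleGraph V) (v : V) : (halves G v).Nodup :=
  Multiset.Nodup.map (fun _ _ h => by injection h) (Finset.nodup _)

lemma mem_halves {G : SimpleGraph V} {v : V} {z : Wire V} :
    z ∈ halves G v ↔ ∃ w, G.Adj v w ∧ z = .half v w := by
  simp [halves, eq_comm]

open Classical in
/-- The `H`s along the edges. -/
noncomputable def edgeNet (G : SimpleGraph V) : Net (Wire V) := ∑ e ∈ G.edgeFinset, {edgeHad e}

-- Each half of an edge has one end at an `H` and one at a dot. Thus no wire occurs twice among the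
-- `H`s, which makes `edgeNet` ready to serve as the vertices of an expansion.
open Classical in
lemma wires_edgeNet (G : SimpleGraph V) : wires (edgeNet G) = ∑ v, halves G v := by
  rw [edgeNet, wires_sum]
  ext z
  rw [Multiset.count_sum', Multiset.count_sum']
  simp only [wires_singleton]
  rcases z with v | v | ⟨v, w⟩
  · rw [Finset.sum_eq_zero, Finset.sum_eq_zero]
    · intro w _
      exact Multiset.count_eq_zero.2 fun h => by simp [mem_halves] at h
    · intro e _
      refine Multiset.count_eq_zero.2 fun h => ?_
      induction e with | _ a b => simp at h
  · rw [Finset.sum_eq_zero, Finset.sum_eq_zero]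
    · intro w _
      exact Multiset.count_eq_zero.2 fun h => by simp [mem_halves] at h
    · intro e _
      refine Multiset.count_eq_zero.2 fun h => ?_
      induction e with | _ a b => simp at h
  · have h1 : ∀ e ∈ G.edgeFinset, Multiset.count (Wire.half v w) (edgeHad e).legs =
        if s(v, w) = e then 1 else 0 := by
      intro e he
      induction e with | _ a b =>
      have hab : a ≠ b := (by simpa using he : G.Adj a b).ne
      simp only [edgeHad_mk, had_legs, Multiset.insert_eq_cons, Multiset.count_cons,
        Multiset.count_singleton, Wire.half.injEq, Sym2.eq_iff]
      by_cases c1 : v = a ∧ w = b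
      · obtain ⟨rfl, rfl⟩ := c1
        simp [hab]
      · by_cases c2 : v = b ∧ w = a
        · simp [c2]
          intro e
          exact absurd e.symm hab
        · simp [c1, c2]
    rw [Finset.sum_congr rfl h1, Finset.sum_ite_eq]
    have h2 : ∀ x ∈ Finset.univ, Multiset.count (Wire.half v w) (halves G x) =
        if v = x then (if G.Adj v w then 1 else 0) else 0 := by
      intro x _
      split_ifs with c1 c2
      · subst c1
        exact Multiset.count_eq_one_of_mem (nodup_halves G v) (mem_halves.2 ⟨w, c2, rfl⟩)
      · subst c1
        exact Multiset.count_eq_zero.2 fun h => by simp_all [mem_halves]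
      · exact Multiset.count_eq_zero.2 fun h => by
          obtain ⟨y, -, hy⟩ := mem_halves.1 h
          injection hy with e
          exact c1 e
    rw [Finset.sum_congr rfl h2, Finset.sum_ite_eq]
    simp

lemma nodup_wires_edgeNet (G : SimpleGraph V) : (wires (edgeNet G)).Nodup := by
  classical
  rw [wires_edgeNet, Multiset.nodup_iff_count_le_one]
  intro z
  rw [Multiset.count_sum']
  rcases z with v | v | ⟨v, w⟩
  · rw [Finset.sum_eq_zero]
    · exact zero_le_one
    · exact fun x _ => Multiset.count_eq_zero.2 fun h => by simp [mem_halves] at h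
  · rw [Finset.sum_eq_zero]
    · exact zero_le_one
    · exact fun x _ => Multiset.count_eq_zero.2 fun h => by simp [mem_halves] at h
  · rw [Finset.sum_eq_single v]
    · exact Multiset.nodup_iff_count_le_one.1 (nodup_halves G v) _
    · intro x _ hx
      refine Multiset.count_eq_zero.2 fun h => ?_
      obtain ⟨y, -, hy⟩ := mem_halves.1 h
      injection hy with e
      exact hx e.symm
    · simp

open Classical in
lemma rename_edgeNet (G : SimpleGraph V) {F : Wire V → ℕ} {q : V → ℕ}
    (hF : ∀ v w, F (.half v w) = q v) :
    Net.rename F (edgeNet G) = ∑ e ∈ G.edgeFinset, edgeH q e := by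
  rw [edgeNet, rename_sum]
  refine Finset.sum_congr rfl fun e _ => ?_
  induction e with | _ a b => simp [H, had, hF]

open Classical in
lemma graphState_eq (G : SimpleGraph V) (o : V → Wire V) :
    graphState G o = ∑ v, {spider .green 0 (o v ::ₘ halves G v)} + edgeNet G := by
  rw [graphState, map_eq_sum_singleton, map_eq_sum_singleton]
  rfl

lemma filter_halves (G : SimpleGraph V) {F : Wire V → ℕ} {q : V → ℕ}
    (hF : ∀ v w, F (.half v w) = q v) (v : V) (x : ℕ) :
    (halves G v).filter (F · = x) = if q v = x then halves G v else 0 := by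
  split_ifs with h
  · rw [Multiset.filter_eq_self]
    intro z hz
    obtain ⟨w, -, rfl⟩ := mem_halves.1 hz
    rw [hF, h]
  · rw [Multiset.filter_eq_nil]
    intro z hz
    obtain ⟨w, -, rfl⟩ := mem_halves.1 hz
    rwa [hF]

lemma filter_wires_edgeNet (G : SimpleGraph V) {ν : Wire V ↪ ℕ} {f : ℕ → ℕ} {q : V → ℕ}
    (hf : ∀ v w, f (ν (.half v w)) = q v) (hq : Function.Injective q) (v : V) :
    (wires ((edgeNet G).rename ν)).filter (f · = q v) = (halves G v).map ν := by
  classical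
  rw [wires_rename, Multiset.filter_map, wires_edgeNet, filter_sum]
  congr 1
  have h := fun x => filter_halves G (F := f ∘ ν) (q := q) hf x (q v)
  rw [Finset.sum_eq_single v]
  · exact (h v).trans (if_pos rfl)
  · exact fun x _ hx => (h x).trans (if_neg fun e => hx (hq e))
  · simp

lemma filter_wires_edgeNet_of_notMem (G : SimpleGraph V) {ν : Wire V ↪ ℕ} {f : ℕ → ℕ} {q : V → ℕ}
    (hf : ∀ v w, f (ν (.half v w)) = q v) {x : ℕ} (hx : ∀ v, q v ≠ x) :
    (wires ((edgeNet G).rename ν)).filter (f · = x) = 0 := by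
  classical
  rw [wires_rename, Multiset.filter_map, wires_edgeNet, filter_sum]
  rw [Finset.sum_eq_zero, Multiset.map_zero]
  exact fun v _ => (filter_halves G (F := f ∘ ν) (q := q) hf v x).trans (if_neg (hx v))

lemma mem_wires_edgeNet {G : SimpleGraph V} {z : Wire V} (hz : z ∈ wires (edgeNet G)) :
    ∃ v w, z = .half v w := by
  classical
  rw [wires_edgeNet, Multiset.mem_sum] at hz
  obtain ⟨v, -, hv⟩ := hz
  obtain ⟨w, -, rfl⟩ := mem_halves.1 hv
  exact ⟨v, w, rfl⟩

/-- The variables that stand for the output wires. -/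
def outs (ν : Wire V ↪ ℕ) : Finset ℕ := Finset.univ.image fun v => ν (.out v)

lemma mem_outs {ν : Wire V ↪ ℕ} {x : ℕ} : x ∈ outs ν ↔ ∃ v, ν (.out v) = x := by simp [outs]

open Classical in
/-- A graph state is the expansion of the product of `H`s along its edges. -/
lemma graphState_isExpansion (G : SimpleGraph V) (ν : Wire V ↪ ℕ) {f : ℕ → ℕ}
    (hf : ∀ v w, f (ν (.half v w)) = ν (.out v)) :
    IsExpansion (outs ν) (∑ e ∈ G.edgeFinset, edgeH (fun v => ν (.out v)) e)
      ((edgeNet G).rename ν) f ∧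
    expand (outs ν) (outs ν) ((edgeNet G).rename ν) f = (graphState G .out).rename ν := by
  refine ⟨⟨?_, ?_, ?_, ?_⟩, ?_⟩
  · rw [wires_rename]
    exact (nodup_wires_edgeNet G).map ν.injective
  · intro w hw hw'
    rw [wires_rename] at hw
    obtain ⟨z, hz, rfl⟩ := Multiset.mem_map.1 hw
    obtain ⟨v, w, rfl⟩ := mem_wires_edgeNet hz
    obtain ⟨x, hx⟩ := mem_outs.1 hw'
    have := ν.injective hx
    injection this
  · intro w hw
    rw [wires_rename] at hw
    obtain ⟨z, hz, rfl⟩ := Multiset.mem_map.1 hw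
    obtain ⟨v, w, rfl⟩ := mem_wires_edgeNet hz
    rw [hf]
    exact mem_outs.2 ⟨v, rfl⟩
  · rw [rename_rename]
    exact rename_edgeNet G hf
  · rw [expand, outs, greens_image_eq_sum (out_injective ν).injOn, graphState_eq, rename_add,
      rename_sum, add_comm]
    congr 1
    refine Finset.sum_congr rfl fun v _ => ?_
    rw [star, if_pos (Finset.mem_image_of_mem _ (Finset.mem_univ v)),
      filter_wires_edgeNet G hf (out_injective ν)]
    simp [spider]

end

/-! ### The rotated graph state as a net -/

section
variable {E : Set Equation} {V : Type} [Fintype V]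

open Classical in
/-- The neighbours of a vertex. -/
noncomputable def nbrs (G : SimpleGraph V) (u : V) : Finset V :=
  Finset.univ.filter fun v => G.Adj u v

lemma mem_nbrs {G : SimpleGraph V} {u v : V} : v ∈ nbrs G u ↔ G.Adj u v := by simp [nbrs]

open Classical in
lemma sum_split {A : Type} [AddCommMonoid A] (G : SimpleGraph V) (u : V) (F : V → A) :
    ∑ v, F v = F u + (∑ v ∈ nbrs G u, F v +
      ∑ v ∈ Finset.univ.filter (fun v => v ≠ u ∧ ¬ G.Adj u v), F v) := by
  rw [← Finset.add_sum_erase Finset.univ F (Finset.mem_univ u),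
    ← Finset.sum_filter_add_sum_filter_not (Finset.univ.erase u) (fun v => G.Adj u v)]
  congr 2
  · refine Finset.sum_congr ?_ fun _ _ => rfl
    ext v
    simp only [Finset.mem_filter, Finset.mem_erase, Finset.mem_univ, and_true, mem_nbrs,
      and_iff_right_iff_imp]
    exact fun h => h.ne'
  · refine Finset.sum_congr ?_ fun _ _ => rfl
    ext v
    simp

open Classical in
/-- The variables at the dots of a graph state whose vertex `u` is followed by a gate. -/
noncomputable def inner (ν : Wire V ↪ ℕ) (u : V) (m : ℕ) (v : V) : ℕ :=
  if v = u then m else ν (.out v)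

open Classical in
/-- The rotated graph state as a net of `H`s and phases. -/
noncomputable def rotatedNet (G : SimpleGraph V) (u : V) (ν : Wire V ↪ ℕ) (m : ℕ) (θ : ℝ) :
    Net ℕ :=
  ∑ e ∈ G.edgeFinset, edgeH (inner ν u m) e + X2 (ang θ) (ν (.out u)) m +
    ∑ v ∈ nbrs G u, Z (ang (-θ)) (ν (.out v))

-- The rotated graph state is not literally an expansion: in an expansion the phase of a neighbour
-- sits on an extra leg of its dot, and the red gate reaches the output through a green vertex with
-- two legs. Fusion and the removal of that vertex bridge the gap.
open Classical in
lemma exists_rotated_isExpansion (G : SimpleGraph V) (u : V) (ν : Wire V ↪ ℕ) (θ : ℝ) {m : ℕ}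
    (hm : ∀ z, ν z ≠ m) :
    ∃ X M f, outs ν ⊆ X ∧ IsExpansion X (rotatedNet G u ν m θ) M f ∧
      Derivable E (expand X (outs ν) M f) ((rotatedGraphState G u θ).rename ν) := by
  -- `w₀` is the leg of the red gate on the output side. It needs a name of its own, because the
  -- name of the output wire already denotes the variable there.
  obtain ⟨w₀, hw₀⟩ := Infinite.exists_notMem_finset
    (insert m ((Finset.univ.image fun v => ν (.out v)) ∪ (Finset.univ.image fun v => ν (.mid v)) ∪
      Finset.univ.image fun p : V × V => ν (.half p.1 p.2)))
  simp only [Finset.mem_insert, Finset.mem_union, Finset.mem_image, Finset.mem_univ, true_and,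
    not_or, not_exists, Prod.forall] at hw₀
  obtain ⟨hmw, ⟨hw1, hw2⟩, hw3⟩ := hw₀
  have hw : ∀ z, ν z ≠ w₀ := by
    rintro (v | v | ⟨v, w⟩)
    exacts [hw1 v, hw2 v, hw3 v w]
  set o : V → ℕ := fun v => ν (.out v) with ho
  set p := inner ν u m with hp
  have hpu : p u = m := by simp [hp, inner]
  have hpv : ∀ v, v ≠ u → p v = o v := fun v hv => by simp [hp, inner, hv, ho]
  have hpinj : Function.Injective p := by
    intro v w h
    by_cases hv : v = u <;> by_cases hw : w = u
    · rw [hv, hw]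
    · rw [hv, hpu, hpv w hw] at h
      exact absurd h.symm (hm _)
    · rw [hw, hpu, hpv v hv] at h
      exact absurd h (hm _)
    · rw [hpv v hv, hpv w hw] at h
      exact out_injective ν h
  have hpo : ∀ v, p v ≠ o u := by
    intro v
    by_cases hv : v = u
    · rw [hv, hpu]
      exact (hm _).symm
    · rw [hpv v hv]
      exact fun h => hv (out_injective ν h)
  -- No leg is named `out`, so the value `0` is irrelevant. The leg `w₀` lies outside the range of
  -- `ν` and takes the default value `o u` of the extension.
  let φ : Wire V → ℕ := fun z => match z with
    | .out _ => 0
    | .mid v => p v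
    | .half v _ => p v
  let f : ℕ → ℕ := Function.extend ν φ fun _ => o u
  have hfν : ∀ z, f (ν z) = φ z := fun z => ν.injective.extend_apply φ _ z
  have hfw : f w₀ = o u := Function.extend_apply' _ _ _ fun ⟨z, hz⟩ => hw z hz
  have hfh : ∀ v w, f (ν (.half v w)) = p v := fun v w => hfν _
  have hfm : ∀ v, f (ν (.mid v)) = p v := fun v => hfν _
  set K := (edgeNet G).rename ν with hK
  let M : Net ℕ := K + X2 (ang θ) w₀ (ν (.mid u)) + ∑ v ∈ nbrs G u, Z (ang (-θ)) (ν (.mid v))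
  have hMw : wires M = wires K + {w₀, ν (.mid u)} + ∑ v ∈ nbrs G u, {ν (.mid v)} := by
    simp [M, wires_sum]
  have hMcases : ∀ w ∈ wires M, (∃ a b, w = ν (.half a b)) ∨ w = w₀ ∨ w = ν (.mid u) ∨
      ∃ v ∈ nbrs G u, w = ν (.mid v) := by
    intro w hwM
    rw [hMw, Multiset.mem_add, Multiset.mem_add, Multiset.mem_sum] at hwM
    rcases hwM with (h | h) | ⟨v, hv, h⟩
    · rw [hK, wires_rename] at h
      obtain ⟨z, hz, rfl⟩ := Multiset.mem_map.1 h
      obtain ⟨a, b, rfl⟩ := mem_wires_edgeNet hz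
      exact .inl ⟨a, b, rfl⟩
    · simp only [Multiset.insert_eq_cons, Multiset.mem_cons, Multiset.mem_singleton] at h
      tauto
    · exact .inr (.inr (.inr ⟨v, hv, by simpa using h⟩))
  have hpX : ∀ v, p v ∈ insert m (outs ν) := by
    intro v
    by_cases hv : v = u
    · simp [hv, hpu]
    · rw [hpv v hv]
      exact Finset.mem_insert_of_mem (mem_outs.2 ⟨v, rfl⟩)
  have hMexp : IsExpansion (insert m (outs ν)) (rotatedNet G u ν m θ) M f := by
    refine ⟨?_, ?_, ?_, ?_⟩
    · rw [hMw]
      refine Multiset.nodup_add.2 ⟨Multiset.nodup_add.2 ⟨?_, ?_, ?_⟩, ?_, ?_⟩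
      · rw [hK, wires_rename]
        exact (nodup_wires_edgeNet G).map ν.injective
      · simpa using (hw _).symm
      · refine Multiset.disjoint_left.2 fun {w} h h' => ?_
        rw [hK, wires_rename] at h
        obtain ⟨z, hz, rfl⟩ := Multiset.mem_map.1 h
        obtain ⟨a, b, rfl⟩ := mem_wires_edgeNet hz
        simp [hw] at h'
      · rw [← map_eq_sum_singleton]
        refine Multiset.Nodup.map (fun v w h => ?_) (Finset.nodup _)
        simpa using h
      · refine Multiset.disjoint_right.2 fun {w} h h' => ?_
        obtain ⟨v, hv, h⟩ := Multiset.mem_sum.1 h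
        obtain rfl := Multiset.mem_singleton.1 h
        rcases Multiset.mem_add.1 h' with h' | h'
        · rw [hK, wires_rename] at h'
          obtain ⟨z, hz, e⟩ := Multiset.mem_map.1 h'
          obtain ⟨a, b, rfl⟩ := mem_wires_edgeNet hz
          simp at e
        · simp only [Multiset.insert_eq_cons, Multiset.mem_cons, Multiset.mem_singleton, hw,
            false_or, EmbeddingLike.apply_eq_iff_eq, Wire.mid.injEq] at h'
          exact (mem_nbrs.1 hv).ne' h'
    · intro w hwM hwX
      rw [Finset.mem_insert, mem_outs] at hwX
      rcases hMcases w hwM with ⟨a, b, rfl⟩ | rfl | rfl | ⟨v, hv, rfl⟩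
      · rcases hwX with h | ⟨x, h⟩
        · exact hm _ h
        · simp at h
      · rcases hwX with h | ⟨x, h⟩
        · exact hmw h
        · exact hw _ h
      · rcases hwX with h | ⟨x, h⟩
        · exact hm _ h
        · simp at h
      · rcases hwX with h | ⟨x, h⟩
        · exact hm _ h
        · simp at h
    · intro w hwM
      rcases hMcases w hwM with ⟨a, b, rfl⟩ | rfl | rfl | ⟨v, hv, rfl⟩
      · rw [hfh]; exact hpX a
      · rw [hfw]; exact Finset.mem_insert_of_mem (mem_outs.2 ⟨u, rfl⟩)
      · rw [hfm]; exact hpX u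
      · rw [hfm]; exact hpX v
    · simp only [M, rename_add, rename_X2, rename_sum, rename_Z, hfw, hfm, hpu, hK, rename_rename]
      rw [rename_edgeNet G (F := f ∘ ν) (q := p) hfh, rotatedNet]
      congr 1
      exact Finset.sum_congr rfl fun v hv => by rw [hpv v (mem_nbrs.1 hv).ne']
  refine ⟨_, M, f, Finset.subset_insert _ _, hMexp, ?_⟩
  have hd := isDiagram_expand (O := outs ν) (Finset.subset_insert m _) hMexp (by
    simp [rotatedNet, hasArity_sum, hasArity_edgeH])
  set T : V → Multiset ℕ := fun v => (halves G v).map ν with hT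
  have hfilter : ∀ x, (wires M).filter (f · = x) = (wires K).filter (f · = x) +
      ((if o u = x then {w₀} else 0) + (if m = x then {ν (.mid u)} else 0)) +
        ∑ v ∈ nbrs G u, if p v = x then {ν (.mid v)} else 0 := by
    intro x
    rw [hMw, Multiset.filter_add, Multiset.filter_add, filter_sum]
    simp only [Multiset.insert_eq_cons, ← Multiset.singleton_add, Multiset.filter_add,
      Multiset.filter_singleton, hfw, hfm, hpu, Multiset.empty_eq_zero]
  have hmo : m ∉ outs ν := fun h => by
    obtain ⟨v, hv⟩ := mem_outs.1 h
    exact hm _ hv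
  have hsm : star (outs ν) f (wires M) m = ν (.mid u) ::ₘ T u := by
    rw [star, if_neg hmo, hfilter, ← hpu, filter_wires_edgeNet G hfh hpinj, if_neg (hpo u).symm,
      if_pos rfl, Finset.sum_eq_zero, ← Multiset.singleton_add]
    · abel
    · intro v hv
      rw [if_neg fun h => (mem_nbrs.1 hv).ne' (hpinj h)]
  have hsu : star (outs ν) f (wires M) (o u) = {w₀, o u} := by
    rw [star, if_pos (mem_outs.2 ⟨u, rfl⟩), hfilter, filter_wires_edgeNet_of_notMem G hfh hpo,
      if_pos rfl, if_neg (hm _).symm, Finset.sum_eq_zero, Multiset.insert_eq_cons,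
      ← Multiset.singleton_add]
    · abel
    · intro v _
      rw [if_neg (hpo v)]
  have hsv : ∀ v, v ≠ u → star (outs ν) f (wires M) (o v) =
      o v ::ₘ ((if G.Adj u v then {ν (.mid v)} else 0) + T v) := by
    intro v hv
    rw [star, if_pos (mem_outs.2 ⟨v, rfl⟩), hfilter, if_neg fun h => hv (out_injective ν h).symm,
      if_neg (hm _).symm, ← hpv v hv, filter_wires_edgeNet G hfh hpinj,
      Finset.sum_congr rfl (g := fun w => if w = v then {ν (.mid w)} else 0) fun w _ => by
        simp only [hpinj.eq_iff],
      Finset.sum_ite_eq', ← Multiset.singleton_add]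
    simp only [mem_nbrs, hT]
    split_ifs <;> abel
  set B : Net ℕ := ∑ v ∈ Finset.univ.filter (fun v => v ≠ u ∧ ¬ G.Adj u v),
    {spider .green 0 (o v ::ₘ T v)} with hB
  have e1 : expand (insert m (outs ν)) (outs ν) M f =
      ∑ v ∈ nbrs G u, ({spider .green 0 (o v ::ₘ ν (.mid v) ::ₘ T v)} + Z (ang (-θ)) (ν (.mid v))) +
      (K + X2 (ang θ) w₀ (ν (.mid u)) + {spider .green 0 (ν (.mid u) ::ₘ T u)} + B +
        {spider .green 0 {w₀, o u}}) := by
    rw [expand, greens_insert hmo, hsm, outs, greens_image_eq_sum (out_injective ν).injOn,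
      sum_split G u, ← outs, hsu, Finset.sum_add_distrib,
      Finset.sum_congr (s₁ := nbrs G u) rfl (g := fun v =>
        ({spider .green 0 (o v ::ₘ ν (.mid v) ::ₘ T v)} : Net ℕ)) fun v hv => by
        rw [hsv v (mem_nbrs.1 hv).ne', if_pos (mem_nbrs.1 hv), Multiset.singleton_add],
      Finset.sum_congr (s₁ := Finset.univ.filter _) rfl (g := fun v =>
        ({spider .green 0 (o v ::ₘ T v)} : Net ℕ)) fun v hv => by
        obtain ⟨h1, h2⟩ := (Finset.mem_filter.1 hv).2
        rw [hsv v h1, if_neg h2, zero_add], ← hB]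
    simp only [M]
    abel
  have e2 : (rotatedGraphState G u θ).rename ν =
      {⟨.spider .red (ang θ), o u ::ₘ {ν (.mid u)}⟩} +
      (∑ v ∈ nbrs G u, ({spider .green 0 (ν (.mid v) ::ₘ T v)} +
        {spider .green (ang (-θ)) {o v, ν (.mid v)}}) +
      (K + {spider .green 0 (ν (.mid u) ::ₘ T u)} + B)) := by
    rw [rotatedGraphState, graphState_eq, map_eq_sum_singleton]
    simp only [rename_add, rename_sum]
    rw [sum_split G u, Finset.sum_add_distrib,
      Finset.sum_congr (s₁ := nbrs G u) rfl (g := fun v =>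
        ({spider .green 0 (ν (.mid v) ::ₘ T v)} : Net ℕ)) fun v hv => by
        simp [mem_nbrs.1 hv, spider, hT],
      Finset.sum_congr (s₁ := Finset.univ.filter fun v => v ≠ u ∧ ¬ G.Adj u v) rfl (g := fun v =>
        ({spider .green 0 (o v ::ₘ T v)} : Net ℕ)) fun v hv => by
        obtain ⟨h1, h2⟩ := (Finset.mem_filter.1 hv).2
        simp [h1, h2, spider, hT, ho], ← hB]
    simp only [rename_singleton, spider_kind, spider_legs, Multiset.map_cons, Multiset.map_singleton,
      Multiset.insert_eq_cons, true_or, if_true, nbrs]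
    simp only [spider, ho, hT, hK]
    abel
  rw [e1] at hd ⊢
  rw [e2]
  -- At a neighbour, the dot with a phase on an extra leg and the dot followed by a phase gate fuse
  -- to the same green vertex.
  have d1 := derivable_sum (E := E) (nbrs G u) _ (fun v =>
    ({spider .green 0 (ν (.mid v) ::ₘ T v)} +
      {spider .green (ang (-θ)) {o v, ν (.mid v)}} : Net ℕ)) _ (by
      intro v _
      simp only [wires_add, wires_singleton, spider_legs, wires_Z, Multiset.insert_eq_cons,
        ← Multiset.singleton_add]
      abel) (by simp) (by
      intro v _ hdv
      have hdv' : Net.IsDiagram ({spider .green 0 (ν (.mid v) ::ₘ T v)} +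
          {spider .green (ang (-θ)) {o v, ν (.mid v)}}) := by
        refine isDiagram_of_wires_le hdv (le_of_eq ?_) (by simp)
        simp only [wires_add, wires_singleton, spider_legs, wires_Z, Multiset.insert_eq_cons,
          ← Multiset.singleton_add]
        abel
      have s1 := (derivable_fuse_of_eq (E := E) hdv (ν (.mid v)) (o v ::ₘ T v) 0 (o v ::ₘ T v)
        (C := 0) (α := 0) (β := ang (-θ)) (c := .green)
        (S' := o v ::ₘ ν (.mid v) ::ₘ T v) (T' := {ν (.mid v)}) (by rw [add_zero]; rfl)
        (Multiset.cons_swap _ _ _) rfl (add_zero _)).1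
      have s2 := (derivable_fuse_of_eq (E := E) hdv' (ν (.mid v)) (T v) {o v} (o v ::ₘ T v)
        (C := 0) (α := 0) (β := ang (-θ)) (c := .green)
        (S' := ν (.mid v) ::ₘ T v) (T' := {o v, ν (.mid v)}) (by rw [add_zero]) rfl
        (Multiset.pair_comm _ _) (by rw [add_comm, Multiset.singleton_add])).1
      exact s1.trans s2.symm) hd
  refine d1.trans ?_
  have hd1 : Net.IsDiagram (∑ v ∈ nbrs G u, ({spider .green 0 (ν (.mid v) ::ₘ T v)} +
        {spider .green (ang (-θ)) {o v, ν (.mid v)}}) +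
      (K + X2 (ang θ) w₀ (ν (.mid u)) + {spider .green 0 (ν (.mid u) ::ₘ T u)} + B +
        {spider .green 0 {w₀, o u}})) := by
    refine isDiagram_of_wires_le hd (le_of_eq ?_) ?_
    · rw [wires_add, wires_add (∑ v ∈ nbrs G u, _)]
      congr 1
      rw [wires_sum, wires_sum]
      refine Finset.sum_congr rfl fun v _ => ?_
      simp only [wires_add, wires_singleton, spider_legs, wires_Z, Multiset.insert_eq_cons,
        ← Multiset.singleton_add]
      abel
    · have := (isDiagram_iff.1 hd).2
      rw [hasArity_add] at this ⊢
      exact ⟨by simp [hasArity_sum], this.2⟩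
  rw [← add_assoc] at hd1 ⊢
  -- The green vertex at the output of `u` is a plain wire, which the red gate then absorbs.
  obtain ⟨u1, u2⟩ := derivable_unit (E := E) hd1
  refine u1.trans ?_
  have e3 : ∑ v ∈ nbrs G u, ({spider .green 0 (ν (.mid v) ::ₘ T v)} +
        {spider .green (ang (-θ)) {o v, ν (.mid v)}}) +
      (K + X2 (ang θ) w₀ (ν (.mid u)) + {spider .green 0 (ν (.mid u) ::ₘ T u)} + B) +
        {line w₀ (o u)} =
      {⟨.spider .red (ang θ), w₀ ::ₘ {ν (.mid u)}⟩, line w₀ (o u)} +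
      (∑ v ∈ nbrs G u, ({spider .green 0 (ν (.mid v) ::ₘ T v)} +
        {spider .green (ang (-θ)) {o v, ν (.mid v)}}) +
      (K + {spider .green 0 (ν (.mid u) ::ₘ T u)} + B)) := by
    simp only [X2, spider, Multiset.insert_eq_cons, ← Multiset.singleton_add]
    abel
  rw [e3] at u2 ⊢
  refine derivable_ax _ (.absorb _ _ _ _) u2 (isDiagram_of_wires_le u2 ?_ ?_)
  · rw [wires_add, wires_add {_, line w₀ (o u)}]
    refine add_le_add_left ?_ _
    simp only [wires_singleton, line_legs, Multiset.insert_eq_cons,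
      ← Multiset.singleton_add, wires_add]
    rw [show ({w₀} + {ν (.mid u)} + ({w₀} + {o u}) : Multiset ℕ) =
      {o u} + {ν (.mid u)} + ({w₀} + {w₀}) by abel]
    exact Multiset.le_add_right _ _
  · have := (isDiagram_iff.1 u2).2
    rw [hasArity_add] at this ⊢
    exact ⟨by simp, this.2⟩

open Classical in
/-- Local complementation as an equation between nets of `H`s. -/
lemma derivable_rotated_iff (G : SimpleGraph V) (u : V) (ν : Wire V ↪ ℕ) (θ : ℝ) {m : ℕ}
    (hm : ∀ z, ν z ≠ m) :
    Derivable E ((rotatedGraphState G u θ).rename ν)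
        ((graphState (localComplement G u) Wire.out).rename ν) ↔
      R E (outs ν) (rotatedNet G u ν m θ)
        (∑ e ∈ (localComplement G u).edgeFinset, edgeH (fun v => ν (.out v)) e) := by
  obtain ⟨X, M, f, hX, hM, hd⟩ := exists_rotated_isExpansion (E := E) G u ν θ hm
  let φ : Wire V → ℕ := fun z => match z with
    | .out v => ν (.out v)
    | .mid v => ν (.out v)
    | .half v _ => ν (.out v)
  obtain ⟨h1, h2⟩ := graphState_isExpansion (localComplement G u) ν
    (f := Function.extend ν φ id) fun v w => ν.injective.extend_apply φ _ _
  have ha : HasArity (rotatedNet G u ν m θ) := by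
    simp [rotatedNet, hasArity_sum, hasArity_edgeH]
  rw [← h2]
  constructor
  · exact fun h => ⟨iff_of_true ha (by simp [hasArity_sum, hasArity_edgeH]), fun _ =>
      ⟨X, M, f, _, _, _, hX, subset_rfl, hM, h1, hd.trans h⟩⟩
  · exact fun h => hd.symm.trans (h.derivable ha hX subset_rfl hM h1)

end

section
variable {E : Set Equation} {O : Finset ℕ} {V : Type}

/-! ### Edges and local complementation -/

open Classical in
/-- The edges of the complete graph on a set of vertices. -/
noncomputable def pairs (s : Finset V) : Finset (Sym2 V) := s.sym2.filter fun e => ¬ e.IsDiag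

lemma mk_mem_pairs {s : Finset V} {a b : V} : s(a, b) ∈ pairs s ↔ (a ∈ s ∧ b ∈ s) ∧ a ≠ b := by
  simp [pairs]

lemma mk_injective (u : V) : Function.Injective fun v => s(u, v) := 
  fun _ _ h => Sym2.congr_right.1 h

lemma fan_map (m : ℕ) (q : V → ℕ) (s : Finset V) :
    fan m (s.toList.map q) = ∑ v ∈ s, H m (q v) := by
  rw [fan, List.map_map, ← Finset.sum_map_toList]
  rfl

lemma phases_map (α : Real.Angle) (q : V → ℕ) (s : Finset V) :
    phases α (s.toList.map q) = ∑ v ∈ s, Z α (q v) := by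
  rw [phases, List.map_map, ← Finset.sum_map_toList]
  rfl

lemma clique_map [DecidableEq V] (q : V → ℕ) {l : List V} (hl : l.Nodup) :
    clique (l.map q) = ∑ e ∈ pairs l.toFinset, edgeH q e := by
  induction l with
  | nil => simp [pairs]
  | cons a l ih =>
    obtain ⟨ha, hl⟩ := List.nodup_cons.1 hl
    have h : pairs (a :: l).toFinset = (l.toFinset.image fun v => s(a, v)) ∪ pairs l.toFinset := by
      ext e
      induction e with | _ b c =>
      simp only [Finset.mem_union, Finset.mem_image, mk_mem_pairs, List.mem_toFinset, List.mem_cons,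
        Sym2.eq_iff]
      constructor
      · rintro ⟨⟨rfl | hb, rfl | hc⟩, hbc⟩
        · exact absurd rfl hbc
        · exact .inl ⟨c, hc, .inl ⟨rfl, rfl⟩⟩
        · exact .inl ⟨b, hb, .inr ⟨rfl, rfl⟩⟩
        · exact .inr ⟨⟨hb, hc⟩, hbc⟩
      · rintro (⟨x, hx, ⟨rfl, rfl⟩ | ⟨rfl, rfl⟩⟩ | ⟨⟨hb, hc⟩, hbc⟩)
        · exact ⟨⟨.inl rfl, .inr hx⟩, fun h => ha (h ▸ hx)⟩
        · exact ⟨⟨.inr hx, .inl rfl⟩, fun h => ha (h ▸ hx)⟩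
        · exact ⟨⟨.inr hb, .inr hc⟩, hbc⟩
    rw [List.map_cons, clique_cons, ih hl, h, Finset.sum_union, Finset.sum_image
      (mk_injective a).injOn]
    · congr 1
      rw [fan, List.map_map, List.sum_toFinset _ hl]
      rfl
    · refine Finset.disjoint_left.2 fun e he he' => ?_
      obtain ⟨v, -, rfl⟩ := Finset.mem_image.1 he
      exact ha (List.mem_toFinset.1 (mk_mem_pairs.1 he').1.1)

open Classical in
/-- Double edges cancel. -/
lemma R.edgeH_symmDiff (q : V → ℕ) (s t : Finset (Sym2 V)) (C : Net ℕ) :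
    R E O (∑ e ∈ s, edgeH q e + ∑ e ∈ t, edgeH q e + C) (∑ e ∈ symmDiff s t, edgeH q e + C) := by
  have cancel : ∀ (r : Finset (Sym2 V)) (C : Net ℕ),
      R E O (∑ e ∈ r, edgeH q e + ∑ e ∈ r, edgeH q e + C) C := by
    intro r
    induction r using Finset.induction_on with
    | empty => exact fun C => R.of_eq (by simp)
    | insert e r he ih =>
      intro C
      rw [Finset.sum_insert he]
      refine R.step (ih (edgeH q e + edgeH q e + C)) (by abel) ?_
      induction e with | _ a b => exact R.H_sq _ _ C
  -- The common edges occur twice and cancel; the two differences remain.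
  refine R.step (cancel (s ∩ t) (∑ e ∈ s \ t, edgeH q e + ∑ e ∈ t \ s, edgeH q e + C)) ?_
    (R.of_eq ?_)
  · rw [← Finset.sum_inter_add_sum_sdiff s t, ← Finset.sum_inter_add_sum_sdiff t s,
      Finset.inter_comm t s]
    abel
  · rw [symmDiff_def, Finset.sup_eq_union, Finset.sum_union disjoint_sdiff_sdiff]

variable [Fintype V]

open Classical in
/-- The edges of `G` away from `u`. -/
noncomputable def farEdges (G : SimpleGraph V) (u : V) : Finset (Sym2 V) :=
  G.edgeFinset.filter fun e => u ∉ e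

open Classical in
lemma sum_edgeH (G : SimpleGraph V) (u : V) (q : V → ℕ) :
    ∑ e ∈ G.edgeFinset, edgeH q e =
      ∑ v ∈ nbrs G u, H (q u) (q v) + ∑ e ∈ farEdges G u, edgeH q e := by
  rw [← Finset.sum_filter_add_sum_filter_not G.edgeFinset fun e => u ∈ e]
  congr 1
  have h : G.edgeFinset.filter (fun e => u ∈ e) = (nbrs G u).image fun v => s(u, v) := by
    ext e
    simp only [Finset.mem_filter, SimpleGraph.mem_edgeFinset, Finset.mem_image, mem_nbrs]
    constructor
    · rintro ⟨he, v, rfl⟩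
      exact ⟨v, he, rfl⟩
    · rintro ⟨v, hv, rfl⟩
      exact ⟨hv, Sym2.mem_mk_left _ _⟩
  rw [h, Finset.sum_image (mk_injective u).injOn]
  rfl

lemma nbrs_localComplement (G : SimpleGraph V) (u : V) :
    nbrs (localComplement G u) u = nbrs G u := by
  ext v
  rw [mem_nbrs, mem_nbrs]
  simp only [localComplement, SimpleGraph.irrefl, false_and, Xor, not_false_eq_true, and_true,
    or_false, and_iff_right_iff_imp]
  exact SimpleGraph.Adj.ne

lemma mk_mem_farEdges {G : SimpleGraph V} {u a b : V} :
    s(a, b) ∈ farEdges G u ↔ G.Adj a b ∧ u ≠ a ∧ u ≠ b := by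
  simp [farEdges]

open Classical in
lemma farEdges_localComplement (G : SimpleGraph V) (u : V) :
    farEdges (localComplement G u) u = symmDiff (farEdges G u) (pairs (nbrs G u)) := by
  ext e
  induction e with | _ a b =>
  simp only [Finset.mem_symmDiff, mk_mem_farEdges, localComplement, mk_mem_pairs, mem_nbrs, Xor]
  have h1 : G.Adj u a → u ≠ a := fun h => h.ne
  have h2 : G.Adj u b → u ≠ b := fun h => h.ne
  have h3 : G.Adj a b → a ≠ b := fun h => h.ne
  tauto

lemma farEdges_localComplement_of_eq_empty {G : SimpleGraph V} {u : V} (h : farEdges G u = ∅) :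
    farEdges (localComplement G u) u = pairs (nbrs G u) := by
  classical
  rw [farEdges_localComplement, h]
  exact bot_symmDiff _

/-! ### The equivalence -/

/-- The edges at `u` form a star, to which `Euler.star_eq` applies with all other edges as context.
The clique that it creates on the neighbours is merged with these edges modulo 2, as local
complementation prescribes. -/
lemma vanDenNest_of_euler {θ : ℝ} (h : Euler E (ang (-θ))) (hθ : ang (-θ) ≠ ang Real.pi) :
    VanDenNest E θ := by
  classical
  intro V _ G u ν
  -- Finiteness leaves a name `m` outside the range of `ν` for the variable at the dot of `u`.
  have : Finite (Wire V) := by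
    refine Finite.of_injective (β := V ⊕ V ⊕ V × V) (fun z => match z with
      | .out v => .inl v
      | .mid v => .inr (.inl v)
      | .half v w => .inr (.inr (v, w))) ?_
    rintro (v | v | ⟨v, w⟩) (v' | v' | ⟨v', w'⟩) h <;> simp_all
  obtain ⟨m, hm'⟩ := (Set.finite_range ν).exists_notMem
  have hm : ∀ z, ν z ≠ m := fun z hz => hm' ⟨z, hz⟩
  rw [derivable_rotated_iff G u ν θ hm, rotatedNet, sum_edgeH G u, sum_edgeH _ u,
    nbrs_localComplement, farEdges_localComplement]
  set q : V → ℕ := fun v => ν (.out v) with hq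
  have hu : inner ν u m u = m := if_pos rfl
  have hv : ∀ v, v ≠ u → inner ν u m v = q v := fun v hv => if_neg hv
  have hfar : ∑ e ∈ farEdges G u, edgeH (inner ν u m) e = ∑ e ∈ farEdges G u, edgeH q e := by
    refine Finset.sum_congr rfl fun e he => ?_
    induction e with | _ a b =>
    obtain ⟨-, ha, hb⟩ := mk_mem_farEdges.1 he
    rw [edgeH_mk, edgeH_mk, hv a ha.symm, hv b hb.symm]
  rw [hfar, hu, Finset.sum_congr (s₁ := nbrs G u) rfl fun v hv' => by
    rw [hv v (mem_nbrs.1 hv').ne']]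
  have hang : ang θ = -ang (-θ) := by simp [ang]
  have key := h.star_eq (O := outs ν) hθ (o := q u) (m := m) (l := (nbrs G u).toList.map q)
    (C := ∑ e ∈ farEdges G u, edgeH q e) (fun hmo => by
      obtain ⟨v, hv⟩ := mem_outs.1 hmo
      exact hm _ hv) (by
      rw [wires_sum, Multiset.mem_sum]
      rintro ⟨e, -, he⟩
      induction e with | _ a b =>
      simp [hq, (hm _).symm] at he) (by simp [hq, hm]) (hm _).symm
  rw [fan_map, fan_map, phases_map, clique_map _ (Finset.nodup_toList _), Finset.toList_toFinset,
    ← hang] at key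
  refine R.step key (by abel) ?_
  exact R.step (R.edgeH_symmDiff q (farEdges G u) (pairs (nbrs G u))
    (∑ v ∈ nbrs G u, H (q u) (q v))) (by abel) (R.of_eq (by abel))

/-- The path with three vertices and centre `0`. -/
def pathGraph : SimpleGraph (Fin 3) where
  Adj v w := v ≠ w ∧ (v = 0 ∨ w = 0)
  symm := ⟨fun _ _ h => ⟨h.1.symm, h.2.symm⟩⟩
  loopless := ⟨fun _ h => h.1 rfl⟩

/-- Names for the wires in the graph states on three vertices. -/
def threeNames : Wire (Fin 3) ↪ ℕ where
  toFun z := match z with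
    -- The three ranges are disjoint, and `3` stays free for the variable at the dot of the centre.
    | .out v => v
    | .mid v => 10 + v
    | .half v w => 20 + 3 * v + w
  inj' := by
    rintro (v | v | ⟨v, w⟩) (v' | v' | ⟨v', w'⟩) h <;>
      simp only [Wire.out.injEq, Wire.mid.injEq, Wire.half.injEq, Fin.ext_iff, reduceCtorEq] at h ⊢ <;>
      omega

@[simp] lemma threeNames_out (v : Fin 3) : threeNames (.out v) = v := rfl

/-- Local complementation at the centre of the path gives the triangle; in the language of nets this
is the hypothesis of `euler_of_path`. -/
lemma euler_of_vanDenNest {θ : ℝ} (hθ : ang (-θ) + ang (-θ) = ang Real.pi)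
    (hθ' : ang (-θ) ≠ ang Real.pi) (h : VanDenNest E θ) : Euler E (ang (-θ)) := by
  classical
  have hm : ∀ z, threeNames z ≠ 3 := by
    rintro (v | v | ⟨v, w⟩)
    · exact v.isLt.ne
    · change 10 + (v : ℕ) ≠ 3
      omega
    · change 20 + 3 * (v : ℕ) + w ≠ 3
      omega
  have hn : nbrs pathGraph 0 = {1, 2} := by
    ext v
    rw [mem_nbrs]
    fin_cases v <;> simp [pathGraph]
  have hf : farEdges pathGraph 0 = ∅ := by
    refine Finset.eq_empty_of_forall_notMem fun e he => ?_
    induction e with | _ a b =>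
    obtain ⟨h, ha, hb⟩ := mk_mem_farEdges.1 he
    exact h.2.elim (fun h => ha h.symm) fun h => hb h.symm
  have hang : ang θ = -ang (-θ) := by simp [ang]
  have key := (derivable_rotated_iff pathGraph 0 threeNames θ hm).1 (h _ _ _ _)
  rw [rotatedNet, sum_edgeH _ 0, sum_edgeH _ 0, nbrs_localComplement, 
    farEdges_localComplement_of_eq_empty hf, hf, hn,
    show ({1, 2} : Finset (Fin 3)) = [1, 2].toFinset by decide,
    ← clique_map _ (by decide), hang] at key
  have hO : outs threeNames = {0, 1, 2} := by decide
  rw [hO] at key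
  refine euler_of_path hθ hθ' ?_
  refine R.step key ?_ (R.of_eq ?_)
  · simp [inner]
    abel
  · simp

/-! ### The Euler decomposition as an equation between diagrams -/

lemma R_euler (τ : Real.Angle) : R E {0, 1}
    {spider .green τ {0, 2}, spider .red τ {2, 3}, spider .green τ {3, 1}}
    (Z τ 0 + X2 τ 0 1 + Z τ 1) := by
  refine R.step (R.green_two τ 0 2 ({spider .red τ {2, 3}} + {spider .green τ {3, 1}})) (by
    simp only [Multiset.insert_eq_cons, ← Multiset.singleton_add]) ?_
  refine R.step (R.green_two τ 3 1 (Z τ 0 + L 0 2 + X2 τ 2 3)) (by rw [X2]; abel) ?_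
  refine R.step (R.subst (s := 2) (x := 0) (by decide) (by decide)
    (C := Z τ 3 + L 3 1 + Z τ 0 + X2 τ 2 3) (by simp [sub]; rfl)) (by rw [L_comm 0 2]; abel) ?_
  exact R.step (R.subst (s := 3) (x := 1) (by decide) (by decide)
    (C := Z τ 3 + Z τ 0 + X2 τ 0 3) (by simp [sub]; rfl)) (by abel) (R.of_eq (by abel))

/-- One choice of names suffices for the net equation; conversely, that equation yields the diagram
equation on the wires 0, 1, 2, 3, which are then renamed injectively. -/
lemma eulerDecomposition_iff : EulerDecomposition E ↔ Euler E (ang (-(Real.pi / 2))) := by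
  set τ := ang (-(Real.pi / 2)) with hτ
  have h : R E {0, 1} (H 0 1)
      {spider .green τ {0, 2}, spider .red τ {2, 3}, spider .green τ {3, 1}} ↔
      Derivable E (H 0 1)
        {spider .green τ {0, 2}, spider .red τ {2, 3}, spider .green τ {3, 1}} :=
    R_iff_derivable_of_openEnds {0, 1} ({0, 2} + ({2, 3} + {3, 1})) (by simp)
      (by simp) (by simp) (by simp) (by decide) (by decide)
  constructor
  · intro he
    exact (h.2 (he 0 1 2 3 (by decide))).trans (R_euler τ)
  · intro he a b x y hd
    have := derivable_rename (g := val [a, b, x, y]) (h.1 (R.trans he (R_euler τ).symm)) (by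
      have hs : ∀ z, (z ∈ wires (H 0 1) ∨ z ∈ wires ({spider .green τ {0, 2}, spider .red τ {2, 3},
          spider .green τ {3, 1}} : Net ℕ)) → z < 4 := by
        intro z hz
        simp at hz
        omega
      intro z hz z' hz' e
      have l1 := hs z hz
      have l2 := hs z' hz'
      rw [val, val, List.getD_eq_getElem _ _ (by simpa using l1),
        List.getD_eq_getElem _ _ (by simpa using l2)] at e
      exact (hd.getElem_inj_iff).1 e)
    simpa [H, had, spider] using this

lemma vanDenNest_iff_euler {θ : ℝ} (hθ : ang (-θ) + ang (-θ) = ang Real.pi) :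
    VanDenNest E θ ↔ Euler E (ang (-θ)) := by
  -- Otherwise π + π = π, and π would vanish modulo 2π.
  have hθ' : ang (-θ) ≠ ang Real.pi := by
    intro h
    rw [h] at hθ
    have : ang Real.pi = 0 := by simpa using hθ
    exact Real.Angle.pi_ne_zero this
  exact ⟨euler_of_vanDenNest hθ hθ', fun h => vanDenNest_of_euler h hθ'⟩

lemma euler_neg_iff {τ : Real.Angle} : Euler E (-τ) ↔ Euler E τ :=
  ⟨fun h => neg_neg τ ▸ h.neg, Euler.neg⟩

/-- For θ = π/2 the angle -θ is the one in the decomposition; for θ = -π/2 it has the opposite sign,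
which `euler_neg_iff` repairs. In both cases -θ doubles to π, as π = -π modulo 2π. -/
lemma vanDenNest_iff_eulerDecomposition :
    (VanDenNest E (-(Real.pi / 2)) ↔ EulerDecomposition E) ∧
      (VanDenNest E (Real.pi / 2) ↔ EulerDecomposition E) := by
  have half : ang (Real.pi / 2) + ang (Real.pi / 2) = ang Real.pi := by
    rw [ang, ang, ← Real.Angle.coe_add, add_halves]
  have neg_half : ang (-(Real.pi / 2)) + ang (-(Real.pi / 2)) = ang Real.pi := by
    rw [ang, ang, ← Real.Angle.coe_add, ← neg_add, add_halves, Real.Angle.coe_neg,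
      Real.Angle.neg_coe_pi]
  have e : ang (-(Real.pi / 2)) = -ang (Real.pi / 2) := Real.Angle.coe_neg _
  rw [eulerDecomposition_iff, vanDenNest_iff_euler (by rwa [neg_neg]),
    vanDenNest_iff_euler neg_half, neg_neg, e, euler_neg_iff]
  exact ⟨Iff.rfl, Iff.rfl⟩

end

end RedGreen

theorem mainTheorem1 (E : Set RedGreen.Equation) :
    (RedGreen.VanDenNest E (-(Real.pi / 2)) ↔ RedGreen.EulerDecomposition E) ∧
    (RedGreen.VanDenNest E (Real.pi / 2) ↔ RedGreen.EulerDecomposition E) :=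
  RedGreen.vanDenNest_iff_eulerDecomposition
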